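/- Let $(M,g)$ be a smooth Riemannian manifold without boundary of dimension $n$, let $x\in C^\infty(M;\mathbb R)$ satisfy $\mathrm dx\neq 0$ on $\{x=0\}$, and let $X=\{x\ge 0\}$, with interior $X^\circ=\{x>0\}$. Let $h$ be a smooth symmetric 2-cotensor such that $g_{sc}=x^{-4}\mathrm dx^2+x^{-2}h$ is a scattering metric on $X$, i.e. it is positive definite on $TX^\circ$ and $h$ is positive definite on $T\partial X$. Scattering vector fields are the fields $xV$ with $V$ smooth and tangent to $\partial X$; ${}^{sc}TX$ is the bundle of which they are the sections, with local frame $x^2\partial_x,\ x\partial_{y^j}$ in coordinates $(x,y)$ near $\partial X$. $\mathrm{Diff}^k_{sc}(X;\mathrm{Sym}^{3}\,{}^{sc}T^*X,\mathrm{Sym}^{3}\,{}^{sc}T^*X)$ is the set of operators on symmetric 3-tensors which, in local frames of ${}^{sc}TX$, are matrices of polynomials of degree at most $k$ in the scattering vector fields with coefficients smooth up to $\partial X$; $\mathrm{Diff}^{2,0}_{sc}=\mathrm{Diff}^2_{sc}$. For $\mathsf F\in\mathbb R$ put $\mathrm d^s_{\mathsf F}=e^{-\mathsf F/x}\,\mathrm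 d^s\,e^{\mathsf F/x}$, where $\mathrm d^s=\mathscr S\nabla^{g}$ is the symmetrized covariant derivative for the Levi-Civita connection of $g$, acting on symmetric tensors, and $\nabla_{\mathsf F}=e^{-\mathsf F/x}\,\nabla\,e^{\mathsf F/x}$, where $\nabla$ is the Levi-Civita connection of $g_{sc}$, acting from symmetric 3-tensors to all 4-tensors. Let $\delta^s_{\mathsf F}$ and $\nabla^*_{\mathsf F}$ be the formal adjoints of $\mathrm d^s_{\mathsf F}$ and $\nabla_{\mathsf F}$ with respect to $g_{sc}$. Then: 1. There is $\mathsf F_0>0$ such that for all $\mathsf F\ge \mathsf F_0$ the solenoidal Witten Laplacian $\delta^s_{\mathsf F}\mathrm d^s_{\mathsf F}$ on symmetric 3-tensors belongs to $\mathrm{Diff}^{2,0}_{sc}(X;\mathrm{Sym}^{3}\,{}^{sc}T^*X,\mathrm{Sym}^{3}\,{}^{sc}T^*X)$ and is jointly elliptic there: its homogeneous second-order principal symbol is invertible at every point of $X$ and every nonzero scattering covector, and its full symbol is invertible at every point of $\partial X$ and every scattering covector. 2. There are $A_0\in \mathrm{Diff}^1_{sc}$ and $A_1\in\mathrm{Diff}^0_{sc}$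 on $\mathrm{Sym}^{3}\,{}^{sc}T^*X$, independent of $\mathsf F$, such that for every $\mathsf F\in\mathbb R$, on symmetric 3-tensors over $X^\circ$, $$\delta^s_{\mathsf F}\mathrm d^s_{\mathsf F}=\tfrac14\nabla_{\mathsf F}^*\nabla_{\mathsf F}+\tfrac34\,\mathrm d^s_{\mathsf F}\delta^s_{\mathsf F}+A+R,\qquad A=A_0+\mathsf F A_1\in\mathrm{Diff}^1_{sc},$$ with some $R\in x\,\mathrm{Diff}^1_{sc}(X;\mathrm{Sym}^{3}\,{}^{sc}T^*X,\mathrm{Sym}^{3}\,{}^{sc}T^*X)$ (depending on $\mathsf F$). -/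

import Mathlib

open scoped Manifold ContDiff Bundle

noncomputable section

namespace Scat

/-- The model space `ℝⁿ`. -/
abbrev Eu (n : ℕ) : Type := EuclideanSpace ℝ (Fin n)

/-- The model with corners of a boundaryless `n`-manifold. -/
abbrev J (n : ℕ) : ModelWithCorners ℝ (Eu n) (Eu n) := modelWithCornersSelf ℝ (Eu n)

/-- The standard basis vectors of `ℝⁿ`. -/
def stdVec {n : ℕ} (i : Fin n) : Eu n := EuclideanSpace.single i (1 : ℝ)

section Coordinates

variable {E : Type*} [NormedAddCommGroup E] [NormedSpace ℝ E]

set_option maxSynthPendingDepth 3 in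
/-- The first-kind Christoffel form `(v, w, k) ↦ ½ (D_v B(w,k) + D_w B(v,k) - D_k B(v,w))` at `z` of
a metric `B` on (an open part of) a coordinate space `E`. -/
def christoffelForm (B : E → E →L[ℝ] E →L[ℝ] ℝ) (z : E) : E →L[ℝ] E →L[ℝ] E →L[ℝ] ℝ :=
  (2⁻¹ : ℝ) • (fderiv ℝ B z + (fderiv ℝ B z).flip -
    (ContinuousLinearMap.flipₗᵢ ℝ E E ℝ).toContinuousLinearEquiv.toContinuousLinearMap.comp
      (fderiv ℝ B z).flip)

set_option maxSynthPendingDepth 3 in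
theorem christoffelForm_apply (B : E → E →L[ℝ] E →L[ℝ] ℝ) (z v w k : E) :
    christoffelForm B z v w k =
      2⁻¹ * (fderiv ℝ B z v w k + fderiv ℝ B z w v k - fderiv ℝ B z k v w) := rfl

/-- The Christoffel symbols `Γ(v, w)` at `z` of the metric `B`, characterised by
`B(Γ(v, w), k) = christoffelForm B z v w k`. -/
def christoffel (B : E → E →L[ℝ] E →L[ℝ] ℝ) (z : E) : E →L[ℝ] E →L[ℝ] E :=
  (ContinuousLinearMap.compL ℝ E (E →L[ℝ] ℝ) E (B z).inverse).comp (christoffelForm B z)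

/-- The covariant derivative in coordinates. -/
def covDerivCoord {m : ℕ} (B : E → E →L[ℝ] E →L[ℝ] ℝ)
    (U : E → ContinuousMultilinearMap ℝ (fun _ : Fin m => E) ℂ) (z : E) :
    ContinuousMultilinearMap ℝ (fun _ : Fin (m + 1) => E) ℂ :=
  (fderiv ℝ U z -
    ((U z).fderivCompContinuousLinearMap fun _ => ContinuousLinearMap.id ℝ E).comp
      (ContinuousLinearMap.pi fun _ => christoffel B z)).uncurryLeft

/-- The coordinate formula
`(∇u)(v₀; v₁, …, vₘ) = (D_{v₀} u)(v₁, …, vₘ) - ∑ᵢ u(v₁, …, Γ(v₀, vᵢ), …, vₘ)`;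
the index of differentiation is the first one. -/
theorem covDerivCoord_apply {m : ℕ} (B : E → E →L[ℝ] E →L[ℝ] ℝ)
    (U : E → ContinuousMultilinearMap ℝ (fun _ : Fin m => E) ℂ) (z : E)
    (v : Fin (m + 1) → E) :
    covDerivCoord B U z v = fderiv ℝ U z (v 0) (fun i => v i.succ) -
      ∑ i, U z (Function.update (fun j : Fin m => v j.succ) i
        (christoffel B z (v 0) (v i.succ))) := by
  rw [covDerivCoord, ContinuousLinearMap.uncurryLeft_apply]
  simp only [sub_apply, ContinuousLinearMap.comp_apply,
    ContinuousMultilinearMap.fderivCompContinuousLinearMap_apply]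
  congr 1
  refine Finset.sum_congr rfl fun i _ => congrArg _ (funext fun j => ?_)
  by_cases h : j = i
  · subst h; simp [Fin.tail]
  · simp [Function.update_of_ne h, Fin.tail]

end Coordinates

section Tensors

variable {n : ℕ} {M : Type*} [TopologicalSpace M] [ChartedSpace (Eu n) M]

/-- Complex-valued covariant `m`-tensors at the point `p`. -/
abbrev Cov (n : ℕ) {M : Type*} [TopologicalSpace M] [ChartedSpace (Eu n) M] (m : ℕ) (p : M) :
    Type :=
  ContinuousMultilinearMap ℝ (fun _ : Fin m => TangentSpace (J n) p) ℂ

/-- Fields of covariant `m`-tensors (no regularity). -/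
abbrev TField (n : ℕ) (M : Type*) [TopologicalSpace M] [ChartedSpace (Eu n) M] (m : ℕ) : Type _ :=
  (p : M) → Cov n m p

/-- Fields of real bilinear forms on the tangent spaces (no regularity). -/
abbrev BField (n : ℕ) (M : Type*) [TopologicalSpace M] [ChartedSpace (Eu n) M] : Type _ :=
  (p : M) → TangentSpace (J n) p →L[ℝ] TangentSpace (J n) p →L[ℝ] ℝ

/-- Vector fields (no regularity). -/
abbrev VField (n : ℕ) (M : Type*) [TopologicalSpace M] [ChartedSpace (Eu n) M] : Type _ :=
  (p : M) → TangentSpace (J n) p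

/-- Operators from `m`-tensor fields to `k`-tensor fields. -/
abbrev Op (n : ℕ) (M : Type*) [TopologicalSpace M] [ChartedSpace (Eu n) M] (m k : ℕ) : Type _ :=
  TField n M m → TField n M k

/-- The derivative at `z` of the inverse of the preferred chart at `p₀`. -/
def dChartSymm (p₀ : M) (z : Eu n) :
    Eu n →L[ℝ] TangentSpace (J n) ((extChartAt (J n) p₀).symm z) :=
  mfderiv (J n) (J n) (extChartAt (J n) p₀).symm z

/-- The derivative at `p` of the preferred chart at `p`. -/
def dChart (p : M) : TangentSpace (J n) p →L[ℝ] Eu n :=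
  mfderiv (J n) (J n) (extChartAt (J n) p) p

/-- A tensor field written in the preferred chart at `p₀` (pullback by the inverse chart). -/
def tRep {m : ℕ} (u : TField n M m) (p₀ : M) (z : Eu n) :
    ContinuousMultilinearMap ℝ (fun _ : Fin m => Eu n) ℂ :=
  (u ((extChartAt (J n) p₀).symm z)).compContinuousLinearMap fun _ => dChartSymm p₀ z

/-- A field of bilinear forms written in the preferred chart at `p₀`. -/
def bRep (G : BField n M) (p₀ : M) (z : Eu n) : Eu n →L[ℝ] Eu n →L[ℝ] ℝ :=
  ((dChartSymm p₀ z).precomp ℝ).comp ((G ((extChartAt (J n) p₀).symm z)).comp (dChartSymm p₀ z))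

/-- The covariant derivative of tensor fields for the Levi-Civita connection of the metric `G`. -/
def covDeriv {m : ℕ} (G : BField n M) : Op n M m (m + 1) := fun u p =>
  (covDerivCoord (bRep G p) (tRep u p) (extChartAt (J n) p p)).compContinuousLinearMap
    fun _ => dChart p

/-- Symmetrization of a covariant tensor. -/
def symmetrize {m : ℕ} {p : M} (T : Cov n m p) : Cov n m p :=
  ((m.factorial : ℝ)⁻¹) • ∑ σ : Equiv.Perm (Fin m), T.domDomCongr σ

/-- The symmetric differential `dˢ = 𝒮 ∇` of the metric `G`. -/
def symDiff {m : ℕ} (G : BField n M) : Op n M m (m + 1) := fun u p => symmetrize (covDeriv G u p)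

/-- Conjugation of an operator by an exponential weight: `e^{-F/x} P e^{F/x}`. -/
def conjOp {m k : ℕ} (x : M → ℝ) (F : ℝ) (P : Op n M m k) : Op n M m k := fun u p =>
  Real.exp (-(F / x p)) • P (fun q => Real.exp (F / x q) • u q) p

/-- The differential of a real function. -/
def dFun (x : M → ℝ) (p : M) : TangentSpace (J n) p →L[ℝ] ℝ := mfderiv (J n) (modelWithCornersSelf ℝ ℝ) x p

/-- The field of bilinear forms `x⁻⁴ dx² + x⁻² h`. -/
def scMetric (x : M → ℝ) (h : BField n M) : BField n M := fun p =>
  (x p ^ 4)⁻¹ • (dFun x p).smulRight (dFun x p) + (x p ^ 2)⁻¹ • h p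

/-- Smoothness (up to and including the boundary) of a field of symmetric bilinear forms. -/
def IsSmoothSymForm (h : BField n M) [IsManifold (J n) ∞ M] : Prop :=
  (∀ p v w, h p v w = h p w v) ∧
  ContMDiff (J n) ((J n).prod (modelWithCornersSelf ℝ (Eu n →L[ℝ] Eu n →L[ℝ] ℝ))) ∞
    (fun p => Bundle.TotalSpace.mk' (Eu n →L[ℝ] Eu n →L[ℝ] ℝ) (E := fun p : M =>
      TangentSpace (J n) p →L[ℝ] TangentSpace (J n) p →L[ℝ] ℝ) p (h p))

/-- `x⁻⁴ dx² + x⁻² h` is positive definite as a form on the scattering tangent bundle of `{x ≥ 0}`: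
it is positive definite on the tangent spaces where `x > 0`, and `h` is positive definite on the
tangent spaces of the boundary `{x = 0}`. -/
def IsScMetric (x : M → ℝ) (h : BField n M) : Prop :=
  (∀ p, 0 < x p → ∀ v, v ≠ 0 → 0 < scMetric x h p v v) ∧
  (∀ p, x p = 0 → ∀ v, v ≠ 0 → dFun x p v = 0 → 0 < h p v v)

/-- Smooth complex tensor fields on the interior `{x > 0}`. -/
def TensorSections (x : M → ℝ) (m : ℕ) : Set (TField n M m) :=
  {u | ∀ p, 0 < x p → ContDiffAt ℝ ∞ (tRep u p) (extChartAt (J n) p p)}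

/-- Smooth complex symmetric tensor fields on the interior `{x > 0}`. -/
def SymSections (x : M → ℝ) (m : ℕ) : Set (TField n M m) :=
  {u | u ∈ TensorSections x m ∧
    ∀ p, 0 < x p → ∀ (σ : Equiv.Perm (Fin m)) v, u p (fun i => v (σ i)) = u p v}

/-- The Gram matrix of a bilinear form at `p`. -/
def gram (G : BField n M) (p : M) : Matrix (Fin n) (Fin n) ℝ :=
  Matrix.of fun i j => G p (stdVec i : Eu n) (stdVec j : Eu n)

/-- The Hermitian inner product of covariant tensors at `p` induced by the metric `G`. -/
def tInner {m : ℕ} (G : BField n M) (p : M) (S T : Cov n m p) : ℂ :=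
  ∑ a : Fin m → Fin n, ∑ b : Fin m → Fin n,
    ((∏ i, (gram G p)⁻¹ (a i) (b i) : ℝ) : ℂ) *
      (S (fun i => (stdVec (a i) : Eu n)) * starRingEnd ℂ (T (fun i => (stdVec (b i) : Eu n))))

/-- The Riemannian volume density of `G` in the preferred chart at `p₀`. -/
def volDensity (G : BField n M) (p₀ : M) (z : Eu n) : ℝ :=
  Real.sqrt (Matrix.det (Matrix.of fun i j => bRep G p₀ z (stdVec i) (stdVec j)))

/-- The `L²` pairing of tensor fields for the metric `G` over the domain of the preferred chart at
`p₀`. -/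
def chartPairing {m : ℕ} (G : BField n M) (p₀ : M) (S T : TField n M m) : ℂ :=
  ∫ z in (extChartAt (J n) p₀).target,
    (volDensity G p₀ z : ℂ) * tInner G ((extChartAt (J n) p₀).symm z)
      (S ((extChartAt (J n) p₀).symm z)) (T ((extChartAt (J n) p₀).symm z))

/-- `Q` maps `ℱ` to `ℰ` and is the formal adjoint of `P : ℰ → ℱ` on `{x > 0}` for the metric `G`:
`⟨P u, w⟩ = ⟨u, Q w⟩` for `w ∈ ℱ` and `u ∈ ℰ` compactly supported in `{x > 0}` (and, since the
condition is local, in one chart domain). -/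
def IsFormalAdjoint {m k : ℕ} (x : M → ℝ) (G : BField n M) (ℰ : Set (TField n M m))
    (ℱ : Set (TField n M k)) (P : Op n M m k) (Q : Op n M k m) : Prop :=
  (∀ w ∈ ℱ, Q w ∈ ℰ) ∧
  ∀ p₀ : M, ∀ u ∈ ℰ, ∀ w ∈ ℱ,
    (∃ K : Set M, IsCompact K ∧ K ⊆ (extChartAt (J n) p₀).source ∩ {p | 0 < x p} ∧
      ∀ p, p ∉ K → u p = 0) →
    chartPairing G p₀ (P u) w = chartPairing G p₀ u (Q w)

open Classical in
/-- The formal adjoint. It is unique as an operator on `ℱ` with values in tensors over `{x > 0}`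
(`0` if there is none). -/
def formalAdjoint {m k : ℕ} (x : M → ℝ) (G : BField n M) (ℰ : Set (TField n M m))
    (ℱ : Set (TField n M k)) (P : Op n M m k) : Op n M k m :=
  if hQ : ∃ Q, IsFormalAdjoint x G ℰ ℱ P Q then hQ.choose else 0

/-- `dˢ_F = e^{-F/x} dˢ e^{F/x}`, with `dˢ` taken for the metric `g`. -/
def dsF (x : M → ℝ) (g : BField n M) (F : ℝ) (m : ℕ) : Op n M m (m + 1) := conjOp x F (symDiff g)

/-- `δˢ_F`, the adjoint of `dˢ_F` on symmetric tensors for the scattering metric. -/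
def deltasF (x : M → ℝ) (g h : BField n M) (F : ℝ) (m : ℕ) : Op n M (m + 1) m :=
  formalAdjoint x (scMetric x h) (SymSections x m) (SymSections x (m + 1)) (dsF x g F m)

/-- `∇_F = e^{-F/x} ∇ e^{F/x}`, with `∇` taken for the scattering metric. -/
def nablaF (x : M → ℝ) (h : BField n M) (F : ℝ) (m : ℕ) : Op n M m (m + 1) :=
  conjOp x F (covDeriv (scMetric x h))

/-- `∇_F^*`, the adjoint for the scattering metric of `∇_F` as an operator from symmetric `m`-tensors
to arbitrary `(m + 1)`-tensors. -/
def nablaFStar (x : M → ℝ) (h : BField n M) (F : ℝ) (m : ℕ) : Op n M (m + 1) m :=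
  formalAdjoint x (scMetric x h) (SymSections x m) (TensorSections x (m + 1)) (nablaF x h F m)

/-- The solenoidal Witten Laplacian `δˢ_F dˢ_F` on symmetric `m`-tensors. -/
def wittenLaplacian (x : M → ℝ) (g h : BField n M) (F : ℝ) (m : ℕ) : Op n M m m :=
  fun u => deltasF x g h F m (dsF x g F m u)

end Tensors

section ScatteringOperators

variable {n : ℕ} {M : Type*} [TopologicalSpace M] [ChartedSpace (Eu n) M]

/-- `xV₁, …, xVₙ` is a smooth local frame over `U` of the scattering tangent bundle, whose sections
are the fields `xV` with `V` smooth and tangent to `{x = 0}`. Here `bᵢ = dx(Vᵢ) / x` is smooth since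
`Vᵢ` is tangent to the boundary. The `Vᵢ` form a frame of the bundle of which the fields tangent to
the boundary are the sections iff the pairs `(bᵢ, Vᵢ)` are linearly independent: where `x ≠ 0` this
says that the `Vᵢ` are independent. In coordinates `(x, y)` near a boundary point one has the
frame `V = (x∂ₓ, ∂_y)`, `b = (1, 0)`, `xV = (x²∂ₓ, x∂_y)`. -/
structure IsScFrame (x : M → ℝ) (U : Set M) (V : Fin n → VField n M) (b : Fin n → M → ℝ)
    [IsManifold (J n) ∞ M] : Prop where
  smooth : ∀ i, ContMDiffOn (J n) (J n).tangent ∞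
    (fun p => (⟨p, V i p⟩ : TangentBundle (J n) M)) U
  smooth_b : ∀ i, ContMDiffOn (J n) (modelWithCornersSelf ℝ ℝ) ∞ (b i) U
  tangent : ∀ i, ∀ p ∈ U, dFun x p (V i p) = x p * b i p
  indep : ∀ p ∈ U, LinearIndependent ℝ fun i => ((b i p, V i p) : ℝ × TangentSpace (J n) p)

/-- The derivative of the function `f` along the vector field `xV`. -/
def scDeriv (x : M → ℝ) (V : VField n M) (f : M → ℂ) (p : M) : ℂ :=
  mfderiv (J n) (modelWithCornersSelf ℝ ℂ) f p (x p • V p)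

/-- Iterated derivative `(xV_{w₁}) (xV_{w₂}) ⋯ f` along a word `w` in the frame `xV`. -/
def wordDeriv (x : M → ℝ) (V : Fin n → VField n M) (w : List (Fin n)) (f : M → ℂ) : M → ℂ :=
  w.foldr (fun i f' => scDeriv x (V i) f') f

/-- The components of a tensor field in the scattering frame `xV`. -/
def scComp {m : ℕ} (x : M → ℝ) (V : Fin n → VField n M) (u : TField n M m) (I : Fin m → Fin n)
    (p : M) : ℂ :=
  u p fun i => x p • V (I i) p

/-- Coefficients of a differential operator from `m`-tensors to `k`-tensors, indexed by the length
of a word, the word, and the indices of the components of the output and of the input. -/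
abbrev Coeffs (n : ℕ) (M : Type*) (m k : ℕ) : Type _ :=
  (r : ℕ) → (Fin r → Fin n) → (Fin k → Fin n) → (Fin m → Fin n) → M → ℂ

/-- Over `U`, the operator `P` on symmetric tensors is the scattering differential operator
`∑ a_w (xV)^w` of order at most `d`, in the components with respect to the scattering frame `xV`,
with coefficients `a_w` smooth up to and including the boundary. -/
structure Represents {m k : ℕ} [IsManifold (J n) ∞ M] (x : M → ℝ) (d : ℕ) (U : Set M)
    (V : Fin n → VField n M) (a : Coeffs n M m k) (P : Op n M m k) : Prop where
  isOpen : IsOpen U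
  frame : ∃ b, IsScFrame x U V b
  smooth : ∀ r w K I, ContMDiffOn (J n) (modelWithCornersSelf ℝ ℂ) ∞ (a r w K I) U
  eq : ∀ u ∈ SymSections x m, ∀ p ∈ U, 0 < x p → ∀ K : Fin k → Fin n,
    scComp x V (P u) K p = ∑ r ∈ Finset.range (d + 1), ∑ w : Fin r → Fin n, ∑ I : Fin m → Fin n,
      a r w K I p * wordDeriv x V (List.ofFn w) (scComp x V u I) p

/-- `P ∈ Diff^d_sc(X; Sym^m scT*X, Sym^k scT*X)`, where `X = {x ≥ 0}`. -/
def IsScDiff {m k : ℕ} [IsManifold (J n) ∞ M] (x : M → ℝ) (d : ℕ) (P : Op n M m k) : Prop :=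
  (∀ u ∈ SymSections x m, P u ∈ SymSections x k) ∧
  ∀ p, 0 ≤ x p → ∃ U, p ∈ U ∧ ∃ V a, Represents x d U V a P

/-- `P ∈ x Diff^d_sc(X; Sym^m scT*X, Sym^k scT*X)`. -/
def IsXScDiff {m k : ℕ} [IsManifold (J n) ∞ M] (x : M → ℝ) (d : ℕ) (P : Op n M m k) : Prop :=
  ∃ Q : Op n M m k, IsScDiff x d Q ∧ ∀ u ∈ SymSections x m, ∀ p, 0 < x p → P u p = x p • Q u p

/-- The homogeneous part of degree `r` of the symbol at `(p, ζ)`, applied to an array `v`;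
here `ζ` lists the components of a scattering covector in the coframe dual to the frame. -/
def symbolPart {m k : ℕ} (a : Coeffs n M m k) (r : ℕ) (p : M) (ζ : Fin n → ℝ)
    (v : (Fin m → Fin n) → ℂ) (K : Fin k → Fin n) : ℂ :=
  ∑ w : Fin r → Fin n, ∑ I : Fin m → Fin n,
    a r w K I p * (∏ j, (Complex.I * (ζ (w j) : ℂ))) * v I

/-- Injectivity on symmetric arrays of a map between arrays. -/
def InjOnSym {m k : ℕ} (T : ((Fin m → Fin n) → ℂ) → (Fin k → Fin n) → ℂ) : Prop :=
  ∀ v : (Fin m → Fin n) → ℂ, (∀ (σ : Equiv.Perm (Fin m)) I, v (fun i => I (σ i)) = v I) →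
    T v = 0 → v = 0

/-- Joint ellipticity of an operator in `Diff^d_sc(X; Sym^m scT*X, Sym^m scT*X)`: invertibility of
the joint symbol on the boundary of the fibre-compactified scattering cotangent bundle, that is, of
the homogeneous principal symbol at every point of `X` and nonzero covector (fibre infinity), and
of the full symbol at every boundary point and every covector (base infinity). -/
def IsJointElliptic {m : ℕ} [IsManifold (J n) ∞ M] (x : M → ℝ) (d : ℕ) (P : Op n M m m) : Prop :=
  IsScDiff x d P ∧
  ∀ p, 0 ≤ x p → ∃ U, p ∈ U ∧ ∃ V a, Represents x d U V a P ∧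
    (∀ ζ, ζ ≠ 0 → InjOnSym (symbolPart a d p ζ)) ∧
    (x p = 0 → ∀ ζ, InjOnSym fun v => ∑ r ∈ Finset.range (d + 1), symbolPart a r p ζ v)

end ScatteringOperators

end Scat

end

open Scat

/-! All operators are computed in a local frame `e_i = ϖ_i ∂_i` of the scattering tangent bundle:
the coordinate frame where `x > 0`, and `x²∂_x, x∂_y` near a boundary point, where `x` is made a
coordinate. In such a frame (`FrameChart`) the Gram matrix of `g_sc`, the connection coefficients of
`g_sc` and of `g`, and the divergences of the frame fields are smooth up to `x = 0`. Hence `dˢ_F`,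
`∇_F` and their adjoints become first order operators `∑ b_i e_i + c` on arrays of components, with
matrix coefficients smooth up to the boundary. Since `e_i(1/x) = τ_i` is smooth, conjugation by the
weight only adds `F ∑ τ_i b_i` to `c`, and the adjoint is conjugated with `-F`.

The formal adjoint is defined by a choice. Integration by parts (`FOp.integral_adj`) provides a
candidate in each frame. A symmetric field is determined by its pairings with test fields
(`FrameChart.comp_eq_of_pairOn_eq`), so the candidates agree on overlaps, an adjoint exists, and the
chosen one is given in every frame by `FrameChart.adjOp` (`IsLocalOp.comp_formalAdjoint`).

Ellipticity. If `L` is the symbol of `dˢ_F`, the symbol of `δˢ_F dˢ_F` is `L* L`: the principal one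
at every point, and the full one at the boundary, where the frame coefficients and divergences
vanish. As the fibre metrics are definite, it suffices that `L` is injective on symmetric arrays. At
the boundary `L v` is the symmetrization of `(iζ + Fτ) ⊗ v` minus Christoffel terms of `g`. These
carry the factor `ϖ_i ϖ_k / ϖ_l`, which survives only for tangential `i, k` and normal `l`. So `L`
is triangular with respect to the number of tangential indices, with diagonal entries positive
multiples of `iζ_j + Fτ_j` for the normal direction `j`; their real part is nonzero as soon as `F >
0`. The principal symbol has no Christoffel terms, and `j` may be any index with `ζ_j ≠ 0`. Both
cases are `eq_zero_of_symM_mulVec_eq_zero`.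

Weitzenböck formula. For symmetric `v` of rank `m + 1`, contraction of a symmetric product gives
`ι_i 𝒮(e^j ⊗ v) = (m+2)⁻¹ A_ij v + (m+1)/(m+2) 𝒮(e^j ⊗ ι_i v)` (`contrM_symM_tensM`), with `A` the
inverse Gram matrix. Comparing second order coefficients, those of `δˢdˢ - (m+2)⁻¹ ∇*∇ - (m+1)/(m+2)
dˢδˢ` are antisymmetric, so only commutators of frame fields remain and the difference has order
one. The same relation cancels the terms linear in `F` in the first order coefficients and those
quadratic in `F` in the zeroth order one. The difference is therefore exactly `A₀ + F A₁`, and the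
remainder can be taken to be zero. -/

open scoped Manifold ContDiff Bundle

set_option linter.unusedSectionVars false

noncomputable section

namespace Scat

/-! ### Multilinear algebra of arrays: symmetrization, contraction and triangularity -/

section Arrays

open Matrix Equiv

variable {n : ℕ}

/-- The `m`-th Kronecker power of a matrix, acting on arrays with `m` indices. -/
def kpow (m : ℕ) (A : Matrix (Fin n) (Fin n) ℂ) :
    Matrix (Fin m → Fin n) (Fin m → Fin n) ℂ :=
  Matrix.of fun I J => ∏ s, A (I s) (J s)

theorem kpow_mul (m : ℕ) (A B : Matrix (Fin n) (Fin n) ℂ) :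
    kpow m (A * B) = kpow m A * kpow m B := by
  ext I J
  simp only [kpow, Matrix.of_apply, Matrix.mul_apply, Finset.prod_univ_sum,
    Fintype.piFinset_univ, Finset.prod_mul_distrib]

theorem kpow_one (m : ℕ) : kpow m (1 : Matrix (Fin n) (Fin n) ℂ) = 1 := by
  ext I J
  simp only [kpow, Matrix.of_apply, Matrix.one_apply]
  by_cases h : I = J
  · subst h; simp
  · rw [if_neg h]
    obtain ⟨s, hs⟩ := Function.ne_iff.1 h
    exact Finset.prod_eq_zero (Finset.mem_univ s) (if_neg hs)

theorem kpow_conjTranspose (m : ℕ) (A : Matrix (Fin n) (Fin n) ℂ) :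
    (kpow m A)ᴴ = kpow m Aᴴ := by
  ext I J
  simp [kpow, Matrix.conjTranspose_apply]

theorem kpow_inv_mul (m : ℕ) (A : Matrix (Fin n) (Fin n) ℂ) (hA : IsUnit A.det) :
    kpow m A⁻¹ * kpow m A = 1 := by
  rw [← kpow_mul, Matrix.nonsing_inv_mul A hA, kpow_one]

theorem kpow_perm (m : ℕ) (A : Matrix (Fin n) (Fin n) ℂ) (I J : Fin m → Fin n)
    (ρ : Perm (Fin m)) : kpow m A (I ∘ ρ) (J ∘ ρ) = kpow m A I J := by
  simp only [kpow, Matrix.of_apply, Function.comp_apply]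
  exact Equiv.prod_comp ρ fun s => A (I s) (J s)

/-- Symmetric arrays. -/
def IsSymArr {m : ℕ} (v : (Fin m → Fin n) → ℂ) : Prop :=
  ∀ (ρ : Perm (Fin m)) I, v (I ∘ ρ) = v I

/-- The matrix of symmetrization. -/
def symM (n m : ℕ) : Matrix (Fin m → Fin n) (Fin m → Fin n) ℂ :=
  Matrix.of fun K I => (m.factorial : ℂ)⁻¹ * ∑ ρ : Perm (Fin m), if K ∘ ρ = I then 1 else 0

theorem symM_mulVec {m : ℕ} (v : (Fin m → Fin n) → ℂ) (K : Fin m → Fin n) :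
    (symM n m *ᵥ v) K = (m.factorial : ℂ)⁻¹ * ∑ ρ : Perm (Fin m), v (K ∘ ρ) := by
  simp only [symM, Matrix.mulVec, dotProduct, Matrix.of_apply, Finset.mul_sum, Finset.sum_mul]
  rw [Finset.sum_comm]
  refine Finset.sum_congr rfl fun ρ _ => ?_
  simp

theorem symM_mulVec_of_isSymArr {m : ℕ} {v : (Fin m → Fin n) → ℂ} (hv : IsSymArr v) :
    symM n m *ᵥ v = v := by
  ext K
  rw [symM_mulVec]
  simp only [hv _ K, Finset.sum_const, Finset.card_univ, Fintype.card_perm, Fintype.card_fin,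
    nsmul_eq_mul]
  rw [← mul_assoc, inv_mul_cancel₀ (Nat.cast_ne_zero.2 m.factorial_ne_zero), one_mul]

theorem isSymArr_symM_mulVec {m : ℕ} (v : (Fin m → Fin n) → ℂ) :
    IsSymArr (symM n m *ᵥ v) := by
  intro ρ I
  rw [symM_mulVec, symM_mulVec]
  congr 1
  exact Equiv.sum_comp (Equiv.mulLeft ρ) fun σ : Perm (Fin m) => v (I ∘ σ)

theorem symM_mul_symM (m : ℕ) : symM n m * symM n m = symM n m := by
  refine Matrix.ext_of_mulVec_single fun J => ?_
  rw [← Matrix.mulVec_mulVec, symM_mulVec_of_isSymArr (isSymArr_symM_mulVec _)]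

theorem symM_conjTranspose (m : ℕ) : (symM n m)ᴴ = symM n m := by
  ext K I
  simp only [symM, Matrix.conjTranspose_apply, Matrix.of_apply, star_mul', star_inv₀,
    star_natCast, star_sum, apply_ite (star : ℂ → ℂ), star_one, star_zero]
  congr 1
  refine Fintype.sum_equiv (Equiv.inv (Perm (Fin m))) _ _ fun ρ => if_congr ?_ rfl rfl
  constructor
  · rintro rfl; ext s; simp
  · rintro rfl; ext s; simp

/-- A Kronecker power does not change when row and column indices are permuted simultaneously.
Consequently symmetrization is an orthogonal projection for the induced fibre metrics, and adjoints
may be projected back to symmetric arrays. -/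
theorem symM_mul_kpow (m : ℕ) (A : Matrix (Fin n) (Fin n) ℂ) :
    symM n m * kpow m A = kpow m A * symM n m := by
  ext I J
  have h1 : (symM n m * kpow m A) I J =
      (m.factorial : ℂ)⁻¹ * ∑ ρ : Perm (Fin m), kpow m A (I ∘ ρ) J :=
    symM_mulVec (fun L => kpow m A L J) I
  have h2 : (kpow m A * symM n m) I J =
      (m.factorial : ℂ)⁻¹ * ∑ ρ : Perm (Fin m), kpow m A I (J ∘ ρ) := by
    have : symM n m = (symM n m)ᵀ := by
      conv_rhs => rw [← symM_conjTranspose (n := n) m]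
      ext K L
      simp only [symM, Matrix.conjTranspose_apply, Matrix.transpose_apply, Matrix.of_apply,
        star_mul', star_inv₀, star_natCast, star_sum, apply_ite (star : ℂ → ℂ), star_one,
        star_zero]
    rw [this, Matrix.mul_apply, ← symM_mulVec (fun L => kpow m A I L) J, Matrix.mulVec,
      dotProduct]
    exact Finset.sum_congr rfl fun L _ => mul_comm _ _
  rw [h1, h2]
  congr 1
  refine Fintype.sum_equiv (Equiv.inv (Perm (Fin m))) _ _ fun ρ => ?_
  rw [← kpow_perm m A I (J ∘ (Equiv.inv (Perm (Fin m)) ρ)) ρ]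
  congr 1
  ext s; simp

/-- A permutation of `m + 1` slots is a transposition with slot `0` together with a permutation of
the tail. The latter does not affect `f`, so the average over `(m+1)!` permutations collapses to `m
+ 1` terms. -/
theorem symM_mulVec_of_tail {m : ℕ} (f : (Fin (m + 1) → Fin n) → ℂ)
    (hf : ∀ i I (e : Perm (Fin m)), f (Fin.cons i (I ∘ e)) = f (Fin.cons i I))
    (K : Fin (m + 1) → Fin n) :
    (symM n (m + 1) *ᵥ f) K = ((m + 1 : ℕ) : ℂ)⁻¹ * ∑ p, f (K ∘ swap 0 p) := by
  rw [symM_mulVec, ← Equiv.sum_comp Perm.decomposeFin.symm, Fintype.sum_prod_type]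
  have : ∀ (p : Fin (m + 1)) (e : Perm (Fin m)),
      f (K ∘ Perm.decomposeFin.symm (p, e)) = f (K ∘ swap 0 p) := by
    intro p e
    have h := hf (K p) (fun s => K (swap 0 p s.succ)) e
    convert h using 2
    · ext s
      refine Fin.cases ?_ (fun t => ?_) s
      · simp
      · simp [Perm.decomposeFin_symm_apply_succ]
    · ext s
      refine Fin.cases ?_ (fun t => ?_) s
      · simp
      · simp
  simp only [this, Finset.sum_const, Finset.card_univ, Fintype.card_perm, Fintype.card_fin,
    nsmul_eq_mul, ← Finset.mul_sum]
  have h1 : (m.factorial : ℂ) ≠ 0 := Nat.cast_ne_zero.2 m.factorial_ne_zero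
  have h2 : ((m + 1 : ℕ) : ℂ) ≠ 0 := Nat.cast_ne_zero.2 m.succ_ne_zero
  rw [Nat.factorial_succ, Nat.cast_mul]
  field_simp

theorem cons_comp_swap_succ {m : ℕ} (j : Fin n) (I : Fin m → Fin n) (q : Fin m) :
    (Fin.cons j I : Fin (m + 1) → Fin n) ∘ swap 0 q.succ =
      Fin.cons (I q) (Function.update I q j) := by
  ext s
  refine Fin.cases ?_ (fun t => ?_) s
  · simp
  · by_cases h : t = q
    · subst h; simp
    · rw [Function.comp_apply, swap_apply_of_ne_of_ne (Fin.succ_ne_zero _)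
        (fun h' => h (Fin.succ_injective _ h'))]
      simp [Function.update_of_ne h]

theorem symM_mulVec_cons {m : ℕ} (f : (Fin (m + 1) → Fin n) → ℂ)
    (hf : ∀ i I (e : Perm (Fin m)), f (Fin.cons i (I ∘ e)) = f (Fin.cons i I))
    (j : Fin n) (I : Fin m → Fin n) :
    (symM n (m + 1) *ᵥ f) (Fin.cons j I) = ((m + 1 : ℕ) : ℂ)⁻¹ *
      (f (Fin.cons j I) + ∑ q, f (Fin.cons (I q) (Function.update I q j))) := by
  rw [symM_mulVec_of_tail f hf, Fin.sum_univ_succ]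
  simp only [cons_comp_swap_succ, swap_self]
  rfl

/-- The matrix of `v ↦ eⁱ ⊗ v`. -/
def tensM (m : ℕ) (i : Fin n) : Matrix (Fin (m + 1) → Fin n) (Fin m → Fin n) ℂ :=
  Matrix.of fun K I => if K 0 = i ∧ Fin.tail K = I then 1 else 0

/-- The matrix of the contraction with the `i`-th row of `A` in the first index. -/
def contrM (m : ℕ) (A : Matrix (Fin n) (Fin n) ℂ) (i : Fin n) :
    Matrix (Fin m → Fin n) (Fin (m + 1) → Fin n) ℂ :=
  Matrix.of fun I K => if Fin.tail K = I then A i (K 0) else 0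

theorem tensM_mulVec {m : ℕ} (i : Fin n) (v : (Fin m → Fin n) → ℂ) (K : Fin (m + 1) → Fin n) :
    (tensM m i *ᵥ v) K = if K 0 = i then v (Fin.tail K) else 0 := by
  simp only [tensM, Matrix.mulVec, dotProduct, Matrix.of_apply, ite_and]
  by_cases h : K 0 = i <;> simp [h]

theorem contrM_mulVec {m : ℕ} (A : Matrix (Fin n) (Fin n) ℂ) (i : Fin n)
    (w : (Fin (m + 1) → Fin n) → ℂ) (I : Fin m → Fin n) :
    (contrM m A i *ᵥ w) I = ∑ l, A i l * w (Fin.cons l I) := by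
  simp only [contrM, Matrix.mulVec, dotProduct, Matrix.of_apply]
  rw [← Equiv.sum_comp (Fin.consEquiv fun _ : Fin (m + 1) => Fin n), Fintype.sum_prod_type]
  refine Finset.sum_congr rfl fun l _ => ?_
  simp [Fin.consEquiv]

/-- For the fibre metrics induced by `A`, the adjoint of tensoring with `eⁱ` is contraction with the
`i`-th row of `A`. This identifies the leading coefficients of the adjoints. -/
theorem tensM_conjTranspose_mul_kpow (m : ℕ) (A : Matrix (Fin n) (Fin n) ℂ) (i : Fin n) :
    (tensM m i)ᴴ * kpow (m + 1) A = kpow m A * contrM m A i := by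
  ext I J
  have h1 : ((tensM m i)ᴴ * kpow (m + 1) A) I J = kpow (m + 1) A (Fin.cons i I) J := by
    simp only [Matrix.mul_apply, Matrix.conjTranspose_apply, tensM, Matrix.of_apply]
    rw [Finset.sum_eq_single (Fin.cons i I)]
    · simp
    · intro K _ hK
      rw [if_neg, star_zero, zero_mul]
      rintro ⟨rfl, rfl⟩
      exact hK (Fin.cons_self_tail K).symm
    · simp
  have h2 : (kpow m A * contrM m A i) I J = kpow m A I (Fin.tail J) * A i (J 0) := by
    simp only [Matrix.mul_apply, contrM, Matrix.of_apply]
    rw [Finset.sum_eq_single (Fin.tail J)]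
    · simp
    · intro K _ hK
      rw [if_neg (Ne.symm hK), mul_zero]
    · simp
  rw [h1, h2]
  simp only [kpow, Matrix.of_apply, Fin.prod_univ_succ, Fin.cons_zero, Fin.cons_succ, Fin.tail]
  ring

theorem contrM_mul_tensM (m : ℕ) (A : Matrix (Fin n) (Fin n) ℂ) (i j : Fin n) :
    contrM m A i * tensM m j = A i j • 1 := by
  refine Matrix.ext_of_mulVec_single fun J => ?_
  ext I
  rw [← Matrix.mulVec_mulVec, contrM_mulVec, Matrix.smul_mulVec, Matrix.one_mulVec]
  simp [tensM_mulVec]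

theorem tensM_mulVec_tail {m : ℕ} {v : (Fin m → Fin n) → ℂ} (hv : IsSymArr v) (j i : Fin n)
    (I : Fin m → Fin n) (e : Perm (Fin m)) :
    (tensM m j *ᵥ v) (Fin.cons i (I ∘ e)) = (tensM m j *ᵥ v) (Fin.cons i I) := by
  rw [tensM_mulVec, tensM_mulVec]
  simp [hv e I]

theorem isSymArr_contrM_mulVec {m : ℕ} (A : Matrix (Fin n) (Fin n) ℂ) (i : Fin n)
    {v : (Fin (m + 1) → Fin n) → ℂ} (hv : IsSymArr v) : IsSymArr (contrM m A i *ᵥ v) := by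
  intro ρ I
  rw [contrM_mulVec, contrM_mulVec]
  refine Finset.sum_congr rfl fun l _ => ?_
  rw [← hv (Perm.decomposeFin.symm (0, ρ)) (Fin.cons l I)]
  congr 2
  ext s
  refine Fin.cases ?_ (fun t => ?_) s
  · simp
  · simp [Perm.decomposeFin_symm_apply_succ]

/-- Contraction of a symmetric product with a covector. -/
theorem contrM_symM_tensM (m : ℕ) (A : Matrix (Fin n) (Fin n) ℂ) (i j : Fin n) :
    contrM (m + 1) A i * symM n (m + 2) * tensM (m + 1) j * symM n (m + 1) =
      (((m + 2 : ℕ) : ℂ)⁻¹ * A i j) • symM n (m + 1) +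
        (((m + 1 : ℕ) : ℂ) / ((m + 2 : ℕ) : ℂ)) •
          (symM n (m + 1) * tensM m j * contrM m A i * symM n (m + 1)) := by
  refine Matrix.ext_of_mulVec_single fun J => ?_
  simp only [Matrix.add_mulVec, Matrix.smul_mulVec, ← Matrix.mulVec_mulVec]
  set v := symM n (m + 1) *ᵥ Pi.single J 1 with hv
  have hs : IsSymArr v := isSymArr_symM_mulVec _
  ext I
  rw [contrM_mulVec]
  simp only [Pi.add_apply, Pi.smul_apply, smul_eq_mul]
  rw [symM_mulVec_of_tail _ (tensM_mulVec_tail (isSymArr_contrM_mulVec A i hs) j)]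
  simp only [symM_mulVec_cons _ (tensM_mulVec_tail hs j), tensM_mulVec, Fin.cons_zero,
    Fin.tail_cons, contrM_mulVec, Function.comp_apply, swap_apply_left]
  have h1 : ((m + 1 : ℕ) : ℂ) ≠ 0 := Nat.cast_ne_zero.2 m.succ_ne_zero
  have hup : ∀ (p : Fin (m + 1)) (l : Fin n),
      v (Fin.cons l (Fin.tail (I ∘ swap 0 p))) = v (Function.update I p l) := by
    intro p l
    rw [← hs (swap 0 p) (Function.update I p l)]
    congr 1
    ext s
    refine Fin.cases ?_ (fun t => ?_) s
    · simp
    · simp only [Fin.cons_succ, Fin.tail, Function.comp_apply]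
      rw [Function.update_of_ne]
      intro h
      rw [Equiv.swap_apply_eq_iff, swap_apply_right] at h
      exact Fin.succ_ne_zero _ h
  simp only [hup]
  simp only [mul_add, Finset.sum_add_distrib]
  -- In the symmetric product the contracted slot holds either `eʲ`, which produces the factor `A i
  -- j`, or an index of `v`, in which case `eʲ` occupies one of the remaining slots `p` and `v` is
  -- contracted.
  congr 1
  · simp only [mul_ite, mul_zero, Finset.sum_ite_eq', Finset.mem_univ, if_true]
    ring
  · have hc : ((m + 1 : ℕ) : ℂ) / ((m + 2 : ℕ) : ℂ) * (((m + 1 : ℕ) : ℂ)⁻¹ *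
        ∑ p, if I p = j then ∑ l, A i l * v (Function.update I p l) else 0) =
        ((m + 2 : ℕ) : ℂ)⁻¹ *
          ∑ p, if I p = j then ∑ l, A i l * v (Function.update I p l) else 0 := by
      field_simp
    rw [hc, Finset.mul_sum]
    simp only [Finset.mul_sum]
    rw [Finset.sum_comm]
    refine Finset.sum_congr rfl fun p _ => ?_
    by_cases h : I p = j
    · simp only [h, if_true, Finset.mul_sum]
      exact Finset.sum_congr rfl fun l _ => by push_cast; ring
    · simp [h]

/-- Triangularity of symmetrized symbols in the number of indices equal to `j`. -/
theorem eq_zero_of_symM_mulVec_eq_zero {m : ℕ} (j : Fin n) (s : Fin n → ℂ) (hs : s j ≠ 0)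
    (μ : Fin n → Fin n → Fin n → ℂ)
    (hμ : ∀ i k l, ¬ (i ≠ j ∧ k ≠ j ∧ l = j) → μ i k l = 0)
    (v : (Fin m → Fin n) → ℂ) (hv : IsSymArr v)
    (h : symM n (m + 1) *ᵥ (fun K => s (K 0) * v (Fin.tail K) +
      ∑ q, ∑ l, μ (K 0) (Fin.tail K q) l * v (Function.update (Fin.tail K) q l)) = 0) :
    v = 0 := by
  set f : (Fin (m + 1) → Fin n) → ℂ := fun K => s (K 0) * v (Fin.tail K) +
      ∑ q, ∑ l, μ (K 0) (Fin.tail K q) l * v (Function.update (Fin.tail K) q l) with hf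
  have hft : ∀ i I (e : Perm (Fin m)), f (Fin.cons i (I ∘ e)) = f (Fin.cons i I) := by
    intro i I e
    simp only [hf, Fin.cons_zero, Fin.tail_cons, hv e I, Function.comp_apply]
    congr 1
    refine Fintype.sum_equiv e _ _ fun q => ?_
    refine Finset.sum_congr rfl fun l _ => ?_
    rw [← hv e (Function.update I (e q) l)]
    congr 2
    ext t
    by_cases ht : t = q
    · subst ht; simp
    · rw [Function.comp_apply, Function.update_of_ne ht,
        Function.update_of_ne (fun h => ht (e.injective h)), Function.comp_apply]
  -- The induction is on the number of indices different from `j`.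
  let c : (Fin m → Fin n) → ℕ := fun I => (Finset.univ.filter fun t => I t ≠ j).card
  have hupd : ∀ I q, I q ≠ j → c (Function.update I q j) < c I := by
    intro I q hq
    refine Finset.card_lt_card ⟨fun t ht => ?_, fun hsub => ?_⟩
    · simp only [Finset.mem_filter, Finset.mem_univ, true_and] at ht ⊢
      by_cases htq : t = q
      · subst htq; exact hq
      · rwa [Function.update_of_ne htq] at ht
    · have := hsub (Finset.mem_filter.2 ⟨Finset.mem_univ q, hq⟩)
      simp at this
  suffices ∀ N I, c I = N → v I = 0 by
    funext I; exact this _ I rfl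
  intro N
  induction N using Nat.strong_induction_on with
  | _ N ih =>
    intro I hI
    have ih' : ∀ I', c I' < c I → v I' = 0 := fun I' h' => ih _ (hI ▸ h') I' rfl
    -- The equation is read at the index `(j, I)`: each transposition moving `j` into the array
    -- replaces an index by `j`, hence never raises the count `c`.
    have h0 := congrFun h (Fin.cons j I)
    rw [symM_mulVec_cons f hft] at h0
    have hj : f (Fin.cons j I) = s j * v I := by
      simp only [hf, Fin.cons_zero, Fin.tail_cons]
      rw [add_eq_left]
      refine Finset.sum_eq_zero fun q _ => Finset.sum_eq_zero fun l _ => ?_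
      rw [hμ _ _ _ (fun h => h.1 rfl), zero_mul]
    have hq : ∀ q, f (Fin.cons (I q) (Function.update I q j)) =
        if I q = j then s j * v I else 0 := by
      intro q
      by_cases hqj : I q = j
      · rw [if_pos hqj, ← hj]
        congr 1
        rw [hqj]
        congr 1
        conv_lhs => rw [← hqj]
        exact Function.update_eq_self q I
      · rw [if_neg hqj]
        simp only [hf, Fin.cons_zero, Fin.tail_cons]
        rw [ih' _ (hupd I q hqj), mul_zero, zero_add]
        refine Finset.sum_eq_zero fun r _ => Finset.sum_eq_zero fun l _ => ?_
        -- A nonzero `μ` term replaces a further index different from `j` by `j`, so the count drops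
        -- a second time.
        by_cases hc : I q ≠ j ∧ Function.update I q j r ≠ j ∧ l = j
        · obtain ⟨-, h2, rfl⟩ := hc
          rw [ih' _ ((hupd _ r h2).trans (hupd I q hqj)), mul_zero]
        · rw [hμ _ _ _ hc, zero_mul]
    rw [hj, Finset.sum_congr rfl fun q _ => hq q, Pi.zero_apply, mul_eq_zero] at h0
    rcases h0 with h0 | h0
    · exact absurd h0 (inv_ne_zero (Nat.cast_ne_zero.2 m.succ_ne_zero))
    -- What is left is `(1 + #{q | I q = j}) * (s j * v I) = 0`, with a nonzero integer factor.
    · rw [← Finset.sum_filter, Finset.sum_const, nsmul_eq_mul, ← one_add_mul, mul_eq_zero] at h0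
      rcases h0 with h0 | h0
      · exact absurd h0 (by rw [add_comm]; exact Nat.cast_add_one_ne_zero _)
      · exact (mul_eq_zero.1 h0).resolve_left hs

/-- The Kronecker powers of the complexification of a positive definite real matrix are definite. -/
theorem eq_zero_of_kpow_form_eq_zero {m : ℕ} {A : Matrix (Fin n) (Fin n) ℝ} (hA : A.PosDef)
    (v : (Fin m → Fin n) → ℂ) (hv : v ⬝ᵥ star (kpow m (A.map ((↑) : ℝ → ℂ)) *ᵥ v) = 0) :
    v = 0 := by
  -- With `A = Cᵀ C` the form is the squared norm of `kpow m C *ᵥ v`, and `kpow m C` is invertible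
  -- because `det A ≠ 0`.
  open scoped MatrixOrder in
  obtain ⟨C, hC⟩ := CStarAlgebra.nonneg_iff_eq_star_mul_self.mp hA.posSemidef.nonneg
  rw [Matrix.star_eq_conjTranspose] at hC
  have hdet : IsUnit (C.map ((↑) : ℝ → ℂ)).det := by
    have h1 : A.det ≠ 0 := hA.det_pos.ne'
    rw [hC, Matrix.det_mul] at h1
    have h2 : (C.map ((↑) : ℝ → ℂ)).det = ((C.det : ℝ) : ℂ) :=
      (RingHom.map_det Complex.ofRealHom C).symm
    rw [h2]
    exact isUnit_iff_ne_zero.2 (Complex.ofReal_ne_zero.2 (right_ne_zero_of_mul h1))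
  have hAC : A.map ((↑) : ℝ → ℂ) = (C.map ((↑) : ℝ → ℂ))ᴴ * C.map ((↑) : ℝ → ℂ) := by
    ext i j
    simp [hC, Matrix.mul_apply]
  have h1 : star v ⬝ᵥ (kpow m (A.map ((↑) : ℝ → ℂ)) *ᵥ v) = 0 := by
    rw [star_dotProduct, dotProduct_comm, hv, star_zero]
  rw [hAC, kpow_mul, ← kpow_conjTranspose, ← Matrix.mulVec_mulVec, dotProduct_mulVec,
    Matrix.vecMul_conjTranspose, star_star] at h1
  open scoped ComplexOrder in
  have h1 := dotProduct_star_self_eq_zero.1 h1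
  rw [← Matrix.one_mulVec v, ← kpow_inv_mul m _ hdet, ← Matrix.mulVec_mulVec, h1,
    Matrix.mulVec_zero]

end Arrays

/-! ### First and second order operators in a frame of rescaled coordinate fields -/

section FrameCalculus

open Matrix

variable {n : ℕ} {F : Type*} [NormedAddCommGroup F] [NormedSpace ℝ F]
  {ι κ μ : Type*} [Fintype ι] [Fintype κ] [Fintype μ]


/-- The derivative along the `i`-th field of the frame `ϖᵢ ∂ᵢ`. -/
def dd (ϖ : Fin n → Eu n → ℝ) (i : Fin n) (f : Eu n → F) (z : Eu n) : F :=
  ϖ i z • fderiv ℝ f z (stdVec i)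

/-- The derivative of an array-valued function along the `i`-th field of the frame `ϖᵢ ∂ᵢ`. -/
def ddV (ϖ : Fin n → Eu n → ℝ) (i : Fin n) (f : Eu n → ι → ℂ) (z : Eu n) : ι → ℂ :=
  fun I => dd ϖ i (fun y => f y I) z

/-- The derivative of a matrix-valued function along the `i`-th field of the frame `ϖᵢ ∂ᵢ`. -/
def ddM (ϖ : Fin n → Eu n → ℝ) (i : Fin n) (B : Eu n → Matrix κ ι ℂ) (z : Eu n) :
    Matrix κ ι ℂ :=
  Matrix.of fun K I => dd ϖ i (fun y => B y K I) z

/-- Smoothness of an array-valued function. -/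
def SmoothArr (O : Set (Eu n)) (f : Eu n → ι → ℂ) : Prop :=
  ∀ I, ContDiffOn ℝ ∞ (fun z => f z I) O

/-- Entrywise smoothness of a matrix-valued function. -/
def SmoothMat (O : Set (Eu n)) (B : Eu n → Matrix κ ι ℂ) : Prop :=
  ∀ K I, ContDiffOn ℝ ∞ (fun z => B z K I) O

variable {ϖ : Fin n → Eu n → ℝ} {O : Set (Eu n)}

theorem differentiableAt_of_contDiffOn {f : Eu n → F} (hO : IsOpen O)
    (hf : ContDiffOn ℝ ∞ f O) {z : Eu n} (hz : z ∈ O) : DifferentiableAt ℝ f z :=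
  (hf.contDiffAt (hO.mem_nhds hz)).differentiableAt (by simp)

theorem contDiffOn_fderiv_apply {f : Eu n → F} (hO : IsOpen O)
    (hf : ContDiffOn ℝ ∞ f O) (v : Eu n) : ContDiffOn ℝ ∞ (fun z => fderiv ℝ f z v) O :=
  (hf.fderiv_of_isOpen hO (m := ∞) (by simp)).clm_apply contDiffOn_const

theorem contDiffOn_dd {f : Eu n → F} (hO : IsOpen O) (hϖ : ∀ i, ContDiffOn ℝ ∞ (ϖ i) O)
    (hf : ContDiffOn ℝ ∞ f O) (i : Fin n) : ContDiffOn ℝ ∞ (dd ϖ i f) O :=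
  (hϖ i).smul (contDiffOn_fderiv_apply hO hf _)

theorem dd_congr {f g : Eu n → F} (hO : IsOpen O) (h : ∀ z ∈ O, f z = g z) {z : Eu n}
    (hz : z ∈ O) (i : Fin n) : dd ϖ i f z = dd ϖ i g z := by
  have : f =ᶠ[nhds z] g := Filter.eventually_of_mem (hO.mem_nhds hz) h
  rw [dd, dd, this.fderiv_eq]

theorem dd_add {f g : Eu n → F} {z : Eu n} (hf : DifferentiableAt ℝ f z)
    (hg : DifferentiableAt ℝ g z) (i : Fin n) :
    dd ϖ i (fun y => f y + g y) z = dd ϖ i f z + dd ϖ i g z := by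
  simp [dd, fderiv_fun_add hf hg]

theorem dd_mul {f g : Eu n → ℂ} {z : Eu n} (hf : DifferentiableAt ℝ f z)
    (hg : DifferentiableAt ℝ g z) (i : Fin n) :
    dd ϖ i (fun y => f y * g y) z = dd ϖ i f z * g z + f z * dd ϖ i g z := by
  simp only [dd, fderiv_fun_mul hf hg, _root_.add_apply, _root_.smul_apply,
    smul_eq_mul, Complex.real_smul]
  ring

theorem dd_smul {f : Eu n → ℝ} {g : Eu n → F} {z : Eu n} (hf : DifferentiableAt ℝ f z)
    (hg : DifferentiableAt ℝ g z) (i : Fin n) :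
    dd ϖ i (fun y => f y • g y) z = dd ϖ i f z • g z + f z • dd ϖ i g z := by
  simp only [dd, fderiv_fun_smul hf hg, _root_.add_apply, _root_.smul_apply,
    ContinuousLinearMap.smulRight_apply, smul_eq_mul]
  module

theorem dd_sum {α : Type*} (s : Finset α) {f : α → Eu n → F} {z : Eu n}
    (hf : ∀ a ∈ s, DifferentiableAt ℝ (f a) z) (i : Fin n) :
    dd ϖ i (fun y => ∑ a ∈ s, f a y) z = ∑ a ∈ s, dd ϖ i (f a) z := by
  simp [dd, fderiv_fun_sum hf, _root_.sum_apply, Finset.smul_sum]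

theorem dd_star {f : Eu n → ℂ} {z : Eu n} (i : Fin n) :
    dd ϖ i (fun y => star (f y)) z = star (dd ϖ i f z) := by
  simp only [dd, fderiv_star]
  simp

theorem SmoothArr.mono {f : Eu n → ι → ℂ} {O' : Set (Eu n)} (hf : SmoothArr O f)
    (h : O' ⊆ O) : SmoothArr O' f := fun I => (hf I).mono h

theorem SmoothMat.mono {B : Eu n → Matrix κ ι ℂ} {O' : Set (Eu n)} (hB : SmoothMat O B)
    (h : O' ⊆ O) : SmoothMat O' B := fun K I => (hB K I).mono h

theorem SmoothArr.add {f g : Eu n → ι → ℂ} (hf : SmoothArr O f) (hg : SmoothArr O g) :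
    SmoothArr O fun z => f z + g z := fun I => (hf I).add (hg I)

theorem SmoothArr.sum {α : Type*} {s : Finset α} {f : α → Eu n → ι → ℂ}
    (hf : ∀ a ∈ s, SmoothArr O (f a)) : SmoothArr O fun z => ∑ a ∈ s, f a z := fun I => by
  simp only [Finset.sum_apply]
  exact ContDiffOn.sum fun a ha => hf a ha I

theorem SmoothMat.add {B C : Eu n → Matrix κ ι ℂ} (hB : SmoothMat O B) (hC : SmoothMat O C) :
    SmoothMat O fun z => B z + C z := fun K I => (hB K I).add (hC K I)

theorem SmoothMat.sub {B C : Eu n → Matrix κ ι ℂ} (hB : SmoothMat O B) (hC : SmoothMat O C) :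
    SmoothMat O fun z => B z - C z := fun K I => (hB K I).sub (hC K I)

theorem SmoothMat.neg {B : Eu n → Matrix κ ι ℂ} (hB : SmoothMat O B) :
    SmoothMat O fun z => - B z := fun K I => (hB K I).neg

theorem SmoothMat.sum {α : Type*} {s : Finset α} {B : α → Eu n → Matrix κ ι ℂ}
    (hB : ∀ a ∈ s, SmoothMat O (B a)) : SmoothMat O fun z => ∑ a ∈ s, B a z := fun K I => by
  simp only [Matrix.sum_apply]
  exact ContDiffOn.sum fun a ha => hB a ha K I

theorem SmoothMat.mul {B : Eu n → Matrix μ κ ℂ} {C : Eu n → Matrix κ ι ℂ}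
    (hB : SmoothMat O B) (hC : SmoothMat O C) : SmoothMat O fun z => B z * C z := fun K I => by
  simp only [Matrix.mul_apply]
  exact ContDiffOn.sum fun J _ => (hB K J).mul (hC J I)

theorem SmoothMat.smul {r : Eu n → ℂ} {B : Eu n → Matrix κ ι ℂ} (hr : ContDiffOn ℝ ∞ r O)
    (hB : SmoothMat O B) : SmoothMat O fun z => r z • B z := fun K I => hr.mul (hB K I)

theorem SmoothMat.const (B : Matrix κ ι ℂ) : SmoothMat O fun _ => B :=
  fun _ _ => contDiffOn_const

theorem SmoothMat.conjTranspose {B : Eu n → Matrix κ ι ℂ} (hB : SmoothMat O B) :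
    SmoothMat O fun z => (B z)ᴴ := fun K I =>
  (Complex.conjCLE.contDiff (n := ∞)).comp_contDiffOn (hB I K)

theorem SmoothMat.kpow {A : Eu n → Matrix (Fin n) (Fin n) ℂ} (hA : SmoothMat O A) (m : ℕ) :
    SmoothMat O fun z => kpow m (A z) := fun K I => by
  simp only [Scat.kpow, Matrix.of_apply]
  exact contDiffOn_prod fun s _ => hA (K s) (I s)

theorem SmoothMat.mulVec {B : Eu n → Matrix κ ι ℂ} {f : Eu n → ι → ℂ}
    (hB : SmoothMat O B) (hf : SmoothArr O f) : SmoothArr O fun z => B z *ᵥ f z := fun K => by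
  simp only [Matrix.mulVec, dotProduct]
  exact ContDiffOn.sum fun J _ => (hB K J).mul (hf J)

theorem SmoothArr.ddV {f : Eu n → ι → ℂ} (hO : IsOpen O) (hϖ : ∀ i, ContDiffOn ℝ ∞ (ϖ i) O)
    (hf : SmoothArr O f) (i : Fin n) : SmoothArr O (ddV ϖ i f) := fun I =>
  contDiffOn_dd hO hϖ (hf I) i

theorem SmoothMat.ddM {B : Eu n → Matrix κ ι ℂ} (hO : IsOpen O)
    (hϖ : ∀ i, ContDiffOn ℝ ∞ (ϖ i) O) (hB : SmoothMat O B) (i : Fin n) :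
    SmoothMat O (ddM ϖ i B) := fun K I => contDiffOn_dd hO hϖ (hB K I) i

theorem SmoothArr.differentiableAt {f : Eu n → ι → ℂ} (hO : IsOpen O) (hf : SmoothArr O f)
    {z : Eu n} (hz : z ∈ O) (I : ι) : DifferentiableAt ℝ (fun y => f y I) z :=
  differentiableAt_of_contDiffOn hO (hf I) hz

theorem SmoothMat.differentiableAt {B : Eu n → Matrix κ ι ℂ} (hO : IsOpen O)
    (hB : SmoothMat O B) {z : Eu n} (hz : z ∈ O) (K : κ) (I : ι) :
    DifferentiableAt ℝ (fun y => B y K I) z :=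
  differentiableAt_of_contDiffOn hO (hB K I) hz

theorem ddV_mulVec {B : Eu n → Matrix κ ι ℂ} {f : Eu n → ι → ℂ} (hO : IsOpen O)
    (hB : SmoothMat O B) (hf : SmoothArr O f) {z : Eu n} (hz : z ∈ O) (i : Fin n) :
    ddV ϖ i (fun y => B y *ᵥ f y) z = ddM ϖ i B z *ᵥ f z + B z *ᵥ ddV ϖ i f z := by
  ext K
  simp only [ddV, ddM, Matrix.mulVec, dotProduct, Pi.add_apply, Matrix.of_apply]
  rw [dd_sum, ← Finset.sum_add_distrib]
  · exact Finset.sum_congr rfl fun I _ =>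
      dd_mul (hB.differentiableAt hO hz K I) (hf.differentiableAt hO hz I) i
  · exact fun I _ => (hB.differentiableAt hO hz K I).mul (hf.differentiableAt hO hz I)

theorem ddV_add {f g : Eu n → ι → ℂ} (hO : IsOpen O) (hf : SmoothArr O f) (hg : SmoothArr O g)
    {z : Eu n} (hz : z ∈ O) (i : Fin n) :
    ddV ϖ i (fun y => f y + g y) z = ddV ϖ i f z + ddV ϖ i g z := by
  ext I
  exact dd_add (hf.differentiableAt hO hz I) (hg.differentiableAt hO hz I) i

theorem ddV_sum {α : Type*} {s : Finset α} {f : α → Eu n → ι → ℂ} (hO : IsOpen O)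
    (hf : ∀ a ∈ s, SmoothArr O (f a)) {z : Eu n} (hz : z ∈ O) (i : Fin n) :
    ddV ϖ i (fun y => ∑ a ∈ s, f a y) z = ∑ a ∈ s, ddV ϖ i (f a) z := by
  ext I
  simp only [ddV, Finset.sum_apply]
  exact dd_sum s (fun a ha => (hf a ha).differentiableAt hO hz I) i

theorem ddV_congr {f g : Eu n → ι → ℂ} (hO : IsOpen O) (h : ∀ z ∈ O, f z = g z) {z : Eu n}
    (hz : z ∈ O) (i : Fin n) : ddV ϖ i f z = ddV ϖ i g z := by
  ext I
  exact dd_congr hO (fun y hy => congrFun (h y hy) I) hz i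

/-- Coefficients of a first order operator `∑ bᵢ (ϖᵢ ∂ᵢ) + c`. -/
structure FOp (n : ℕ) (κ ι : Type*) where
  /-- The coefficients of first order. -/
  b : Fin n → Eu n → Matrix κ ι ℂ
  /-- The coefficient of order zero. -/
  c : Eu n → Matrix κ ι ℂ

/-- Coefficients of a second order operator `∑ aᵢⱼ (ϖᵢ ∂ᵢ)(ϖⱼ ∂ⱼ) + ∑ aⱼ (ϖⱼ ∂ⱼ) + a`. -/
structure SOp (n : ℕ) (κ ι : Type*) where
  /-- The coefficients of second order. -/
  a2 : Fin n → Fin n → Eu n → Matrix κ ι ℂ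
  /-- The coefficients of first order. -/
  a1 : Fin n → Eu n → Matrix κ ι ℂ
  /-- The coefficient of order zero. -/
  a0 : Eu n → Matrix κ ι ℂ

/-- Smoothness of the coefficients. -/
structure FOp.Smooth (O : Set (Eu n)) (P : FOp n κ ι) : Prop where
  b : ∀ i, SmoothMat O (P.b i)
  c : SmoothMat O P.c

/-- Smoothness of the coefficients. -/
structure SOp.Smooth (O : Set (Eu n)) (P : SOp n κ ι) : Prop where
  a2 : ∀ i j, SmoothMat O (P.a2 i j)
  a1 : ∀ i, SmoothMat O (P.a1 i)
  a0 : SmoothMat O P.a0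

/-- The action of a first order operator. -/
def FOp.app (ϖ : Fin n → Eu n → ℝ) (P : FOp n κ ι) (f : Eu n → ι → ℂ) (z : Eu n) : κ → ℂ :=
  ∑ i, P.b i z *ᵥ ddV ϖ i f z + P.c z *ᵥ f z

/-- The action of a second order operator. -/
def SOp.app (ϖ : Fin n → Eu n → ℝ) (P : SOp n κ ι) (f : Eu n → ι → ℂ) (z : Eu n) : κ → ℂ :=
  ∑ i, ∑ j, P.a2 i j z *ᵥ ddV ϖ i (ddV ϖ j f) z + ∑ j, P.a1 j z *ᵥ ddV ϖ j f z +
    P.a0 z *ᵥ f z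

/-- Composition of first order operators. -/
def FOp.comp (ϖ : Fin n → Eu n → ℝ) (P : FOp n μ κ) (Q : FOp n κ ι) : SOp n μ ι where
  a2 i j z := P.b i z * Q.b j z
  a1 j z := ∑ i, P.b i z * ddM ϖ i (Q.b j) z + (P.b j z * Q.c z + P.c z * Q.b j z)
  a0 z := ∑ i, P.b i z * ddM ϖ i Q.c z + P.c z * Q.c z

/-- Composition of a first order operator with a constant matrix. -/
def FOp.lmul (S : Matrix μ κ ℂ) (P : FOp n κ ι) : FOp n μ ι where
  b i z := S * P.b i z
  c z := S * P.c z

theorem FOp.Smooth.app {P : FOp n κ ι} {f : Eu n → ι → ℂ} (hO : IsOpen O)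
    (hϖ : ∀ i, ContDiffOn ℝ ∞ (ϖ i) O) (hP : P.Smooth O) (hf : SmoothArr O f) :
    SmoothArr O (P.app ϖ f) :=
  (SmoothArr.sum fun i _ => (hP.b i).mulVec (hf.ddV hO hϖ i)).add (hP.c.mulVec hf)

theorem FOp.Smooth.comp {P : FOp n μ κ} {Q : FOp n κ ι} (hO : IsOpen O)
    (hϖ : ∀ i, ContDiffOn ℝ ∞ (ϖ i) O) (hP : P.Smooth O) (hQ : Q.Smooth O) :
    (P.comp ϖ Q).Smooth O where
  a2 i j := (hP.b i).mul (hQ.b j)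
  a1 j := (SmoothMat.sum fun i _ => (hP.b i).mul ((hQ.b j).ddM hO hϖ i)).add
    (((hP.b j).mul hQ.c).add (hP.c.mul (hQ.b j)))
  a0 := (SmoothMat.sum fun i _ => (hP.b i).mul (hQ.c.ddM hO hϖ i)).add (hP.c.mul hQ.c)

theorem FOp.Smooth.lmul {P : FOp n κ ι} (S : Matrix μ κ ℂ) (hP : P.Smooth O) :
    (P.lmul S).Smooth O where
  b i := (SmoothMat.const S).mul (hP.b i)
  c := (SmoothMat.const S).mul hP.c

theorem FOp.lmul_app (S : Matrix μ κ ℂ) (P : FOp n κ ι) (f : Eu n → ι → ℂ) (z : Eu n) :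
    (P.lmul S).app ϖ f z = S *ᵥ P.app ϖ f z := by
  simp only [FOp.app, FOp.lmul, Matrix.mulVec_add, Matrix.mulVec_sum, Matrix.mulVec_mulVec]

theorem FOp.comp_app {P : FOp n μ κ} {Q : FOp n κ ι} {f : Eu n → ι → ℂ} (hO : IsOpen O)
    (hϖ : ∀ i, ContDiffOn ℝ ∞ (ϖ i) O) (hQ : Q.Smooth O) (hf : SmoothArr O f)
    {z : Eu n} (hz : z ∈ O) :
    P.app ϖ (Q.app ϖ f) z = (P.comp ϖ Q).app ϖ f z := by
  have h1 : ∀ i, ddV ϖ i (Q.app ϖ f) z =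
      ∑ j, (ddM ϖ i (Q.b j) z *ᵥ ddV ϖ j f z + Q.b j z *ᵥ ddV ϖ i (ddV ϖ j f) z) +
        (ddM ϖ i Q.c z *ᵥ f z + Q.c z *ᵥ ddV ϖ i f z) := by
    intro i
    have hs : ∀ j ∈ Finset.univ, SmoothArr O fun y => Q.b j y *ᵥ ddV ϖ j f y :=
      fun j _ => (hQ.b j).mulVec (hf.ddV hO hϖ j)
    rw [show Q.app ϖ f = fun y => (∑ j, Q.b j y *ᵥ ddV ϖ j f y) + Q.c y *ᵥ f y from rfl,
      ddV_add hO (SmoothArr.sum hs) (hQ.c.mulVec hf) hz, ddV_sum hO hs hz,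
      ddV_mulVec hO hQ.c hf hz]
    congr 1
    exact Finset.sum_congr rfl fun j _ => ddV_mulVec hO (hQ.b j) (hf.ddV hO hϖ j) hz i
  rw [FOp.app]
  simp only [h1]
  simp only [SOp.app, FOp.comp, FOp.app, Matrix.mulVec_add, Matrix.mulVec_sum, Matrix.add_mulVec,
    Matrix.sum_mulVec, Matrix.mulVec_mulVec, Finset.sum_add_distrib]
  rw [Finset.sum_comm (f := fun i j => (P.b i z * ddM ϖ i (Q.b j) z) *ᵥ ddV ϖ j f z)]
  abel

/-- The second derivatives of `f` cancel by symmetry. Since `e_i ϖ_k` is a multiple `θ_ik` of `ϖ_k`,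
the commutator is a combination of the frame fields whose coefficients need no division by `ϖ`. -/
theorem dd_dd_sub {f : Eu n → ℂ} {θ : Fin n → Fin n → Eu n → ℝ} (hO : IsOpen O)
    (hϖ : ∀ i, ContDiffOn ℝ ∞ (ϖ i) O) (hθ : ∀ i k, ∀ z ∈ O, dd ϖ i (ϖ k) z = θ i k z * ϖ k z)
    (hf : ContDiffOn ℝ ∞ f O) {z : Eu n} (hz : z ∈ O) (i j : Fin n) :
    dd ϖ i (dd ϖ j f) z - dd ϖ j (dd ϖ i f) z =
      θ i j z • dd ϖ j f z - θ j i z • dd ϖ i f z := by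
  have hd : ∀ k, DifferentiableAt ℝ (fun y => fderiv ℝ f y (stdVec k)) z := fun k =>
    differentiableAt_of_contDiffOn hO (contDiffOn_fderiv_apply hO hf _) hz
  have h1 : ∀ i j, dd ϖ i (dd ϖ j f) z = (θ i j z * ϖ j z) • fderiv ℝ f z (stdVec j) +
      ϖ j z • ϖ i z • fderiv ℝ (fderiv ℝ f) z (stdVec i) (stdVec j) := by
    intro i j
    have h2 := dd_smul (ϖ := ϖ) (differentiableAt_of_contDiffOn hO (hϖ j) hz) (hd j) i
    rw [show dd ϖ j f = fun y => ϖ j y • fderiv ℝ f y (stdVec j) from rfl, h2, hθ i j z hz]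
    congr 2
    have hf' : DifferentiableAt ℝ (fderiv ℝ f) z :=
      differentiableAt_of_contDiffOn hO (hf.fderiv_of_isOpen hO (m := ∞) (by simp)) hz
    rw [dd, fderiv_clm_apply hf' (differentiableAt_const _)]
    simp
  have hsymm : fderiv ℝ (fderiv ℝ f) z (stdVec i) (stdVec j) =
      fderiv ℝ (fderiv ℝ f) z (stdVec j) (stdVec i) :=
    ((hf.contDiffAt (hO.mem_nhds hz)).isSymmSndFDerivAt
      (by simpa using WithTop.coe_le_coe.2 (le_top : (2 : ℕ∞) ≤ ⊤))) _ _
  rw [h1, h1, hsymm]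
  simp only [dd]
  module

/-- A second order operator with antisymmetric second order coefficients is of first order. -/
theorem SOp.app_eq_of_antisymm {P : SOp n κ ι} {θ : Fin n → Fin n → Eu n → ℝ} (hO : IsOpen O)
    (hϖ : ∀ i, ContDiffOn ℝ ∞ (ϖ i) O) (hθ : ∀ i k, ∀ z ∈ O, dd ϖ i (ϖ k) z = θ i k z * ϖ k z)
    {f : Eu n → ι → ℂ} (hf : SmoothArr O f) {z : Eu n} (hz : z ∈ O)
    (hP : ∀ i j, P.a2 i j z = - P.a2 j i z) :
    P.app ϖ f z = FOp.app ϖ ⟨fun j z => ∑ i, (θ i j z : ℂ) • P.a2 i j z + P.a1 j z, P.a0⟩ f z := by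
  have hc : ∀ i j, ddV ϖ i (ddV ϖ j f) z - ddV ϖ j (ddV ϖ i f) z =
      (θ i j z : ℂ) • ddV ϖ j f z - (θ j i z : ℂ) • ddV ϖ i f z := by
    intro i j
    ext I
    have := dd_dd_sub hO hϖ hθ (hf I) hz i j
    simpa [ddV] using this
  -- Antisymmetry makes the second order sum equal to half a sum of commutators, and makes the two
  -- halves of each commutator contribute equally. The identities below amount to `2 • X = 2 • Z`
  -- with `Z` of first order.
  have key : ∑ i, ∑ j, P.a2 i j z *ᵥ ddV ϖ i (ddV ϖ j f) z =
      ∑ j, (∑ i, (θ i j z : ℂ) • P.a2 i j z) *ᵥ ddV ϖ j f z := by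
    have e1 : ∑ i, ∑ j, P.a2 i j z *ᵥ ddV ϖ i (ddV ϖ j f) z =
        -∑ i, ∑ j, P.a2 i j z *ᵥ ddV ϖ j (ddV ϖ i f) z := by
      rw [Finset.sum_comm, ← Finset.sum_neg_distrib]
      refine Finset.sum_congr rfl fun i _ => ?_
      rw [← Finset.sum_neg_distrib]
      refine Finset.sum_congr rfl fun j _ => ?_
      rw [hP j i, Matrix.neg_mulVec]
    have e2 : ∑ i, ∑ j, P.a2 i j z *ᵥ ((θ j i z : ℂ) • ddV ϖ i f z) =
        -∑ i, ∑ j, P.a2 i j z *ᵥ ((θ i j z : ℂ) • ddV ϖ j f z) := by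
      rw [Finset.sum_comm, ← Finset.sum_neg_distrib]
      refine Finset.sum_congr rfl fun i _ => ?_
      rw [← Finset.sum_neg_distrib]
      refine Finset.sum_congr rfl fun j _ => ?_
      rw [hP j i, Matrix.neg_mulVec]
    have e3 : ∑ i, ∑ j, P.a2 i j z *ᵥ (ddV ϖ i (ddV ϖ j f) z - ddV ϖ j (ddV ϖ i f) z) =
        ∑ i, ∑ j, P.a2 i j z *ᵥ
          ((θ i j z : ℂ) • ddV ϖ j f z - (θ j i z : ℂ) • ddV ϖ i f z) := by
      simp only [hc]
    simp only [Matrix.mulVec_sub, Finset.sum_sub_distrib] at e3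
    rw [e2] at e3
    have e4 : ∑ j, (∑ i, (θ i j z : ℂ) • P.a2 i j z) *ᵥ ddV ϖ j f z =
        ∑ i, ∑ j, P.a2 i j z *ᵥ ((θ i j z : ℂ) • ddV ϖ j f z) := by
      rw [Finset.sum_comm]
      refine Finset.sum_congr rfl fun j _ => ?_
      rw [Matrix.sum_mulVec]
      refine Finset.sum_congr rfl fun i _ => ?_
      rw [Matrix.smul_mulVec, Matrix.mulVec_smul]
    rw [e4]
    set X := ∑ i, ∑ j, P.a2 i j z *ᵥ ddV ϖ i (ddV ϖ j f) z
    set Y := ∑ i, ∑ j, P.a2 i j z *ᵥ ddV ϖ j (ddV ϖ i f) z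
    set Z := ∑ i, ∑ j, P.a2 i j z *ᵥ ((θ i j z : ℂ) • ddV ϖ j f z)
    have e5 : Y = -X := by rw [e1, neg_neg]
    rw [e5] at e3
    have e6 : (2 : ℂ) • X = (2 : ℂ) • Z := by
      rw [two_smul, two_smul]; simpa using e3
    exact smul_right_injective _ two_ne_zero e6
  rw [SOp.app, FOp.app, key]
  simp only [Matrix.add_mulVec, Finset.sum_add_distrib]

end FrameCalculus

/-! ### Formal adjoints in a coordinate domain by integration by parts -/

section LocalAdjoint

open Matrix MeasureTheory

variable {n : ℕ} {F : Type*} [NormedAddCommGroup F] [NormedSpace ℝ F]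
  {ι κ : Type*} [Fintype ι] [Fintype κ]

theorem contDiff_of_zero_off {O K : Set (Eu n)} (hO : IsOpen O) (hK : IsCompact K) (hKO : K ⊆ O)
    {f : Eu n → F} (hf : ContDiffOn ℝ ∞ f O) (h0 : ∀ z, z ∉ K → f z = 0) :
    ContDiff ℝ ∞ f := by
  rw [contDiff_iff_contDiffAt]
  intro z
  by_cases hz : z ∈ K
  · exact hf.contDiffAt (hO.mem_nhds (hKO hz))
  · have : f =ᶠ[nhds z] fun _ => 0 :=
      Filter.eventually_of_mem (hK.isClosed.isOpen_compl.mem_nhds hz) fun y hy => h0 y hy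
    exact contDiffAt_const.congr_of_eventuallyEq this

theorem fderiv_eq_zero_off {K : Set (Eu n)} (hK : IsClosed K) {f : Eu n → F}
    (h0 : ∀ z, z ∉ K → f z = 0) {z : Eu n} (hz : z ∉ K) : fderiv ℝ f z = 0 := by
  have : f =ᶠ[nhds z] fun _ => 0 :=
    Filter.eventually_of_mem (hK.isOpen_compl.mem_nhds hz) fun y hy => h0 y hy
  rw [this.fderiv_eq]; simp

theorem integrable_of_zero_off {O K : Set (Eu n)} (hO : IsOpen O) (hK : IsCompact K)
    (hKO : K ⊆ O) {f : Eu n → ℂ} (hf : ContDiffOn ℝ ∞ f O) (h0 : ∀ z, z ∉ K → f z = 0) :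
    Integrable f :=
  (contDiff_of_zero_off hO hK hKO hf h0).continuous.integrable_of_hasCompactSupport
    (HasCompactSupport.intro hK h0)

theorem integral_fderiv_apply_eq_zero {f : Eu n → ℂ} (hf : ContDiff ℝ ∞ f)
    (hc : HasCompactSupport f) (v : Eu n) : ∫ z, fderiv ℝ f z v = 0 := by
  have hi : Integrable f := hf.continuous.integrable_of_hasCompactSupport hc
  have hi' : Integrable fun z => fderiv ℝ f z v :=
    ((hf.continuous_fderiv (by simp)).clm_apply
      continuous_const).integrable_of_hasCompactSupport (hc.fderiv_apply (𝕜 := ℝ) v)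
  have := integral_mul_fderiv_eq_neg_fderiv_mul_of_integrable (f := fun _ : Eu n => (1 : ℂ))
    (g := f) (v := v) (μ := volume) (by simp) (by simpa using hi') (by simpa using hi)
    (fun _ _ => differentiableAt_const _) (fun _ _ => hf.differentiable (by simp) _)
  simpa using this

/-- The coefficients of the formal adjoint of a first order operator, for the fibre metrics `Hk` and
`Hm`, the latter with inverse `Hm'`, and a density with logarithmic divergences `d`. -/
def FOp.adj (ϖ : Fin n → Eu n → ℝ) (d : Fin n → Eu n → ℝ) (Hm' : Eu n → Matrix ι ι ℂ)
    (Hk : Eu n → Matrix κ κ ℂ) (P : FOp n κ ι) : FOp n ι κ where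
  b i z := -(Hm' z * ((P.b i z)ᴴ * Hk z))
  c z := Hm' z * ((P.c z)ᴴ * Hk z - ∑ i, ((d i z : ℂ) • ((P.b i z)ᴴ * Hk z) +
    ddM ϖ i (fun y => (P.b i y)ᴴ * Hk y) z))

theorem contDiffOn_ofReal {O : Set (Eu n)} {f : Eu n → ℝ} (hf : ContDiffOn ℝ ∞ f O) :
    ContDiffOn ℝ ∞ (fun z => (f z : ℂ)) O :=
  (Complex.ofRealCLM.contDiff (n := ∞)).comp_contDiffOn hf

theorem FOp.Smooth.adj {ϖ : Fin n → Eu n → ℝ} {d : Fin n → Eu n → ℝ} {O : Set (Eu n)}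
    {Hm' : Eu n → Matrix ι ι ℂ} {Hk : Eu n → Matrix κ κ ℂ} {P : FOp n κ ι} (hO : IsOpen O)
    (hϖ : ∀ i, ContDiffOn ℝ ∞ (ϖ i) O) (hd : ∀ i, ContDiffOn ℝ ∞ (d i) O)
    (hHm : SmoothMat O Hm') (hHk : SmoothMat O Hk) (hP : P.Smooth O) :
    (P.adj ϖ d Hm' Hk).Smooth O := by
  have hB : ∀ i, SmoothMat O fun y => (P.b i y)ᴴ * Hk y := fun i => (hP.b i).conjTranspose.mul hHk
  exact ⟨fun i => (hHm.mul (hB i)).neg, hHm.mul ((hP.c.conjTranspose.mul hHk).sub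
    (SmoothMat.sum fun i _ => ((hB i).smul (contDiffOn_ofReal (hd i))).add
      ((hB i).ddM hO hϖ i)))⟩

theorem SmoothArr.dotProduct_star {O : Set (Eu n)} {f g : Eu n → ι → ℂ} (hf : SmoothArr O f)
    (hg : SmoothArr O g) : ContDiffOn ℝ ∞ (fun z => f z ⬝ᵥ star (g z)) O := by
  simp only [dotProduct, Pi.star_apply]
  exact ContDiffOn.sum fun I _ => (hf I).mul
    ((Complex.conjCLE.contDiff (n := ∞)).comp_contDiffOn (hg I))

theorem dd_dotProduct_star {ϖ : Fin n → Eu n → ℝ} {O : Set (Eu n)} {f g : Eu n → ι → ℂ}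
    (hO : IsOpen O) (hf : SmoothArr O f) (hg : SmoothArr O g) {z : Eu n} (hz : z ∈ O)
    (i : Fin n) : dd ϖ i (fun y => f y ⬝ᵥ star (g y)) z =
      ddV ϖ i f z ⬝ᵥ star (g z) + f z ⬝ᵥ star (ddV ϖ i g z) := by
  simp only [dotProduct, Pi.star_apply]
  have hg' : ∀ I, DifferentiableAt ℝ (fun y => star (g y I)) z := fun I =>
    (hg.differentiableAt hO hz I).star
  rw [dd_sum, ← Finset.sum_add_distrib]
  · refine Finset.sum_congr rfl fun I _ => ?_
    rw [dd_mul (hf.differentiableAt hO hz I) (hg' I), dd_star]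
    rfl
  · exact fun I _ => (hf.differentiableAt hO hz I).mul (hg' I)

theorem mulVec_dotProduct_star (B : Matrix κ ι ℂ) (f : ι → ℂ) (g : κ → ℂ) :
    (B *ᵥ f) ⬝ᵥ star g = f ⬝ᵥ star (Bᴴ *ᵥ g) := by
  rw [Matrix.star_mulVec, Matrix.conjTranspose_conjTranspose, dotProduct_comm,
    Matrix.dotProduct_mulVec, dotProduct_comm]

/-- Integration by parts. -/
theorem FOp.integral_adj [DecidableEq ι] {ϖ : Fin n → Eu n → ℝ} {d : Fin n → Eu n → ℝ} {ρ : Eu n → ℝ}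
    {O K : Set (Eu n)} {Hm Hm' : Eu n → Matrix ι ι ℂ} {Hk : Eu n → Matrix κ κ ℂ} {P : FOp n κ ι}
    (hO : IsOpen O) (hϖ : ∀ i, ContDiffOn ℝ ∞ (ϖ i) O) (hdc : ∀ i, ContDiffOn ℝ ∞ (d i) O)
    (hρ : ContDiffOn ℝ ∞ ρ O)
    (hd : ∀ i, ∀ z ∈ O, fderiv ℝ (fun y => ϖ i y * ρ y) z (stdVec i) = d i z * ρ z)
    (hHm : ∀ z ∈ O, Hm z * Hm' z = 1) (hHms : SmoothMat O Hm) (hHms' : SmoothMat O Hm')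
    (hHk : SmoothMat O Hk) (hP : P.Smooth O) (hK : IsCompact K) (hKO : K ⊆ O)
    {f : Eu n → ι → ℂ} {w : Eu n → κ → ℂ} (hf : SmoothArr O f) (hw : SmoothArr O w)
    (h0 : ∀ z, z ∉ K → f z = 0) :
    ∫ z, (ρ z : ℂ) * (P.app ϖ f z ⬝ᵥ star (Hk z *ᵥ w z)) =
      ∫ z, (ρ z : ℂ) * (f z ⬝ᵥ star (Hm z *ᵥ (P.adj ϖ d Hm' Hk).app ϖ w z)) := by
  have hB : ∀ i, SmoothMat O fun y => (P.b i y)ᴴ * Hk y := fun i => (hP.b i).conjTranspose.mul hHk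
  have hBw : ∀ i, SmoothArr O fun y => ((P.b i y)ᴴ * Hk y) *ᵥ w y := fun i => (hB i).mulVec hw
  have hfd : ∀ i z, z ∉ K → ddV ϖ i f z = 0 := by
    intro i z hz
    ext I
    simp only [ddV, dd]
    rw [fderiv_eq_zero_off hK.isClosed (fun y hy => congrFun (h0 y hy) I) hz]
    simp
  have hPf : ∀ z, z ∉ K → P.app ϖ f z = 0 := by
    intro z hz
    simp [FOp.app, hfd _ z hz, h0 z hz]
  -- The flux field: `hpt` shows that the two integrands differ by its divergence, and it is
  -- compactly supported because `f` is.
  set X : Fin n → Eu n → ℂ := fun i y =>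
    (ϖ i y * ρ y) • (f y ⬝ᵥ star (((P.b i y)ᴴ * Hk y) *ᵥ w y)) with hX
  have hXs : ∀ i, ContDiffOn ℝ ∞ (X i) O := fun i =>
    ((hϖ i).mul hρ).smul (hf.dotProduct_star (hBw i))
  have hX0 : ∀ i z, z ∉ K → X i z = 0 := fun i z hz => by simp [hX, h0 z hz]
  have hi1 : Integrable fun z => (ρ z : ℂ) * (P.app ϖ f z ⬝ᵥ star (Hk z *ᵥ w z)) := by
    refine integrable_of_zero_off hO hK hKO ((contDiffOn_ofReal hρ).mul
      ((hP.app hO hϖ hf).dotProduct_star (hHk.mulVec hw))) fun z hz => ?_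
    simp [hPf z hz]
  have hi2 : Integrable fun z =>
      (ρ z : ℂ) * (f z ⬝ᵥ star (Hm z *ᵥ (P.adj ϖ d Hm' Hk).app ϖ w z)) := by
    refine integrable_of_zero_off hO hK hKO ((contDiffOn_ofReal hρ).mul
      (hf.dotProduct_star (hHms.mulVec ((FOp.Smooth.adj hO hϖ hdc hHms' hHk hP).app hO hϖ hw))))
      fun z hz => ?_
    simp [h0 z hz]
  have hpt : ∀ z, (ρ z : ℂ) * (P.app ϖ f z ⬝ᵥ star (Hk z *ᵥ w z)) -
      (ρ z : ℂ) * (f z ⬝ᵥ star (Hm z *ᵥ (P.adj ϖ d Hm' Hk).app ϖ w z)) =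
      ∑ i, fderiv ℝ (X i) z (stdVec i) := by
    intro z
    by_cases hzK : z ∈ K
    swap
    · simp [hPf z hzK, h0 z hzK, fderiv_eq_zero_off hK.isClosed (hX0 _) hzK]
    have hz := hKO hzK
    have hXd : ∀ i, fderiv ℝ (X i) z (stdVec i) = (ρ z : ℂ) *
        ((d i z : ℂ) * (f z ⬝ᵥ star (((P.b i z)ᴴ * Hk z) *ᵥ w z)) +
        (ddV ϖ i f z ⬝ᵥ star (((P.b i z)ᴴ * Hk z) *ᵥ w z) + f z ⬝ᵥ
          star (ddM ϖ i (fun y => (P.b i y)ᴴ * Hk y) z *ᵥ w z +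
            ((P.b i z)ᴴ * Hk z) *ᵥ ddV ϖ i w z))) := by
      intro i
      have h1 := dd_dotProduct_star (ϖ := ϖ) hO hf (hBw i) hz i
      rw [ddV_mulVec hO (hB i) hw hz] at h1
      rw [← h1, hX]
      rw [fderiv_fun_smul (differentiableAt_of_contDiffOn hO ((hϖ i).mul hρ) hz)
        (differentiableAt_of_contDiffOn hO (hf.dotProduct_star (hBw i)) hz)]
      simp only [_root_.add_apply, _root_.smul_apply, ContinuousLinearMap.smulRight_apply, dd]
      rw [hd i z hz]
      simp only [Complex.real_smul, Complex.ofReal_mul]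
      ring
    have hadj : Hm z *ᵥ (P.adj ϖ d Hm' Hk).app ϖ w z = ((P.c z)ᴴ * Hk z) *ᵥ w z -
        ∑ i, ((d i z : ℂ) • (((P.b i z)ᴴ * Hk z) *ᵥ w z) +
          (ddM ϖ i (fun y => (P.b i y)ᴴ * Hk y) z *ᵥ w z +
            ((P.b i z)ᴴ * Hk z) *ᵥ ddV ϖ i w z)) := by
      simp only [FOp.app, FOp.adj, Matrix.mulVec_add, Matrix.mulVec_sum, Matrix.mulVec_mulVec,
        Matrix.mul_neg, ← Matrix.mul_assoc, hHm z hz, Matrix.one_mul]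
      simp only [Matrix.sub_mulVec, Matrix.sum_mulVec, Matrix.add_mulVec, Matrix.smul_mulVec,
        Matrix.neg_mulVec, Finset.sum_add_distrib, Finset.sum_neg_distrib]
      abel
    have hPw : P.app ϖ f z ⬝ᵥ star (Hk z *ᵥ w z) =
        ∑ i, ddV ϖ i f z ⬝ᵥ star (((P.b i z)ᴴ * Hk z) *ᵥ w z) +
          f z ⬝ᵥ star (((P.c z)ᴴ * Hk z) *ᵥ w z) := by
      simp only [FOp.app, add_dotProduct, sum_dotProduct, mulVec_dotProduct_star,
        Matrix.mulVec_mulVec]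
    simp only [hXd]
    rw [hadj, hPw]
    simp only [star_sub, star_sum, star_add, star_smul, dotProduct_sub, dotProduct_sum,
      dotProduct_add, dotProduct_smul, Finset.sum_add_distrib, mul_add, mul_sub, Finset.mul_sum,
      RCLike.star_def, Complex.conj_ofReal, smul_eq_mul]
    ring
  have hsub : ∫ z, ((ρ z : ℂ) * (P.app ϖ f z ⬝ᵥ star (Hk z *ᵥ w z)) -
      (ρ z : ℂ) * (f z ⬝ᵥ star (Hm z *ᵥ (P.adj ϖ d Hm' Hk).app ϖ w z))) = 0 := by
    simp only [hpt]
    rw [integral_finsetSum]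
    · refine Finset.sum_eq_zero fun i _ => ?_
      exact integral_fderiv_apply_eq_zero (contDiff_of_zero_off hO hK hKO (hXs i) (hX0 i))
        (HasCompactSupport.intro hK (hX0 i)) _
    · intro i _
      refine integrable_of_zero_off hO hK hKO (contDiffOn_fderiv_apply hO (hXs i) _) fun z hz => ?_
      rw [fderiv_eq_zero_off hK.isClosed (hX0 i) hz]
      rfl
  rwa [integral_sub hi1 hi2, sub_eq_zero] at hsub

end LocalAdjoint

/-! ### Behaviour of the Christoffel symbols and the covariant derivative under coordinate changes
-/

section Covariance

variable {n : ℕ}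

/-- The pullback of a bilinear form. -/
def pullB (D : Eu n →L[ℝ] Eu n) (B : Eu n →L[ℝ] Eu n →L[ℝ] ℝ) : Eu n →L[ℝ] Eu n →L[ℝ] ℝ :=
  (D.precomp ℝ).comp (B.comp D)

theorem pullB_apply (D : Eu n →L[ℝ] Eu n) (B : Eu n →L[ℝ] Eu n →L[ℝ] ℝ) (v w : Eu n) :
    pullB D B v w = B (D v) (D w) := rfl

/-- A definite form is injective as a map into the dual space, which has the same dimension. It is
thus invertible, and `inverse` does not take its default value in the definition of `christoffel`.
-/
theorem apply_inverse_of_pos {B : Eu n →L[ℝ] Eu n →L[ℝ] ℝ} (hB : ∀ v, v ≠ 0 → 0 < B v v)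
    (ℓ : Eu n →L[ℝ] ℝ) : B (B.inverse ℓ) = ℓ := by
  have hinj : Function.Injective (B : Eu n →ₗ[ℝ] (Eu n →L[ℝ] ℝ)) := by
    rw [← LinearMap.ker_eq_bot, LinearMap.ker_eq_bot']
    intro v hv
    by_contra hne
    have h1 : B v v = 0 := by
      have : B v = 0 := hv
      rw [this]; rfl
    exact (hB v hne).ne' h1
  have hfin : Module.finrank ℝ (Eu n) = Module.finrank ℝ (Eu n →L[ℝ] ℝ) := by
    rw [← (LinearMap.toContinuousLinearMap (𝕜 := ℝ) (E := Eu n) (F' := ℝ)).finrank_eq]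
    exact Subspace.dual_finrank_eq.symm
  have hinv : B.IsInvertible :=
    ⟨(LinearEquiv.ofBijective (B : Eu n →ₗ[ℝ] (Eu n →L[ℝ] ℝ))
      ⟨hinj, (LinearMap.injective_iff_surjective_of_finrank_eq_finrank hfin).1
        hinj⟩).toContinuousLinearEquiv, by ext; rfl⟩
  exact hinv.self_apply_inverse ℓ

theorem christoffel_spec {B : Eu n → Eu n →L[ℝ] Eu n →L[ℝ] ℝ} {z : Eu n}
    (hB : ∀ v, v ≠ 0 → 0 < B z v v) (v w k : Eu n) :
    B z (christoffel B z v w) k = christoffelForm B z v w k := by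
  have : christoffel B z v w = (B z).inverse (christoffelForm B z v w) := rfl
  rw [this, apply_inverse_of_pos hB]

theorem eq_of_forall_form_eq {B : Eu n →L[ℝ] Eu n →L[ℝ] ℝ} (hB : ∀ v, v ≠ 0 → 0 < B v v)
    {v w : Eu n} (h : ∀ k, B v k = B w k) : v = w := by
  by_contra hne
  have h1 := hB (v - w) (sub_ne_zero.2 hne)
  rw [map_sub (B (v - w)), map_sub B, _root_.sub_apply, _root_.sub_apply, h v, h w] at h1
  simp only [sub_self] at h1
  exact lt_irrefl _ h1

theorem fderiv_apply₂ {B : Eu n → Eu n →L[ℝ] Eu n →L[ℝ] ℝ} {z : Eu n}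
    (hB : DifferentiableAt ℝ B z) (v w k : Eu n) :
    fderiv ℝ B z v w k = fderiv ℝ (fun y => B y w k) z v := by
  have h1 : HasFDerivAt (fun y => B y w) _ z := hB.hasFDerivAt.clm_apply (hasFDerivAt_const w z)
  rw [(h1.clm_apply (hasFDerivAt_const k z)).fderiv]
  simp

set_option maxSynthPendingDepth 3 in
theorem fderiv_pullB {B B' : Eu n → Eu n →L[ℝ] Eu n →L[ℝ] ℝ} {τ : Eu n → Eu n} {z : Eu n}
    (hτ : DifferentiableAt ℝ τ z) (hτ' : DifferentiableAt ℝ (fderiv ℝ τ) z)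
    (hB : DifferentiableAt ℝ B (τ z)) (hB' : DifferentiableAt ℝ B' z)
    (h : ∀ᶠ y in nhds z, B' y = pullB (fderiv ℝ τ y) (B (τ y))) (v w k : Eu n) :
    fderiv ℝ B' z v w k =
      fderiv ℝ B (τ z) (fderiv ℝ τ z v) (fderiv ℝ τ z w) (fderiv ℝ τ z k) +
      B (τ z) (fderiv ℝ (fderiv ℝ τ) z v w) (fderiv ℝ τ z k) +
      B (τ z) (fderiv ℝ τ z w) (fderiv ℝ (fderiv ℝ τ) z v k) := by
  rw [fderiv_apply₂ hB']
  have h1 : (fun y => B' y w k) =ᶠ[nhds z] fun y => B (τ y) (fderiv ℝ τ y w) (fderiv ℝ τ y k) :=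
    h.mono fun y hy => by simp only [hy, pullB_apply]
  rw [h1.fderiv_eq]
  have h2 : ∀ u, HasFDerivAt (fun y => fderiv ℝ τ y u) _ z := fun u =>
    hτ'.hasFDerivAt.clm_apply (hasFDerivAt_const u z)
  have h3 : HasFDerivAt (fun y => B (τ y)) ((fderiv ℝ B (τ z)).comp (fderiv ℝ τ z)) z := hB.hasFDerivAt.comp z hτ.hasFDerivAt
  rw [((h3.clm_apply (h2 w)).clm_apply (h2 k)).fderiv]
  simp
  ring

/-- Both sides are tested with `B` against vectors `Dτ k`, which exhaust the space. Of the six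
second derivative terms of `τ` in the Koszul combination, four cancel by symmetry of `D²τ` and `B`;
the other two combine to `B(D²τ(v, w), Dτ k)`. -/
theorem fderiv_christoffel {B B' : Eu n → Eu n →L[ℝ] Eu n →L[ℝ] ℝ} {τ : Eu n → Eu n} {z : Eu n}
    (hτ : ContDiffAt ℝ ∞ τ z) (hτi : Function.Surjective (fderiv ℝ τ z))
    (hB : DifferentiableAt ℝ B (τ z)) (hB' : DifferentiableAt ℝ B' z)
    (hsymm : ∀ v w, B (τ z) v w = B (τ z) w v) (hpos : ∀ v, v ≠ 0 → 0 < B (τ z) v v)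
    (hpos' : ∀ v, v ≠ 0 → 0 < B' z v v)
    (h : ∀ᶠ y in nhds z, B' y = pullB (fderiv ℝ τ y) (B (τ y))) (v w : Eu n) :
    fderiv ℝ τ z (christoffel B' z v w) =
      christoffel B (τ z) (fderiv ℝ τ z v) (fderiv ℝ τ z w) + fderiv ℝ (fderiv ℝ τ) z v w := by
  have hd : DifferentiableAt ℝ τ z := hτ.differentiableAt (by simp)
  have hd' : DifferentiableAt ℝ (fderiv ℝ τ) z :=
    (hτ.fderiv_right (m := ∞) (by simp)).differentiableAt (by simp)
  have hs : ∀ a b, fderiv ℝ (fderiv ℝ τ) z a b = fderiv ℝ (fderiv ℝ τ) z b a := fun a b =>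
    (hτ.isSymmSndFDerivAt (by simpa using WithTop.coe_le_coe.2 (le_top : (2 : ℕ∞) ≤ ⊤))) a b
  refine eq_of_forall_form_eq hpos fun k' => ?_
  obtain ⟨k, rfl⟩ := hτi k'
  have h0 : B (τ z) (fderiv ℝ τ z (christoffel B' z v w)) (fderiv ℝ τ z k) =
      B' z (christoffel B' z v w) k := by rw [h.self_of_nhds, pullB_apply]
  rw [h0, christoffel_spec hpos', map_add, _root_.add_apply, christoffel_spec hpos,
    christoffelForm_apply, christoffelForm_apply, fderiv_pullB hd hd' hB hB' h,
    fderiv_pullB hd hd' hB hB' h, fderiv_pullB hd hd' hB hB' h, hs w v, hs k v, hs k w,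
    hsymm (fderiv ℝ τ z w) (fderiv ℝ (fderiv ℝ τ) z v k),
    hsymm (fderiv ℝ τ z v) (fderiv ℝ (fderiv ℝ τ) z w k)]
  ring

/-- Covariance of the covariant derivative under changes of coordinates. -/
theorem covDerivCoord_pull {m : ℕ} {B B' : Eu n → Eu n →L[ℝ] Eu n →L[ℝ] ℝ} {τ : Eu n → Eu n}
    {z : Eu n} {U U' : Eu n → ContinuousMultilinearMap ℝ (fun _ : Fin m => Eu n) ℂ}
    (hτ : ContDiffAt ℝ ∞ τ z) (hτi : Function.Surjective (fderiv ℝ τ z))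
    (hB : DifferentiableAt ℝ B (τ z)) (hB' : DifferentiableAt ℝ B' z)
    (hsymm : ∀ v w, B (τ z) v w = B (τ z) w v) (hpos : ∀ v, v ≠ 0 → 0 < B (τ z) v v)
    (hpos' : ∀ v, v ≠ 0 → 0 < B' z v v)
    (h : ∀ᶠ y in nhds z, B' y = pullB (fderiv ℝ τ y) (B (τ y)))
    (hU : DifferentiableAt ℝ U (τ z))
    (hUU' : ∀ᶠ y in nhds z, U' y = (U (τ y)).compContinuousLinearMap fun _ => fderiv ℝ τ y) :
    covDerivCoord B' U' z =
      (covDerivCoord B U (τ z)).compContinuousLinearMap fun _ => fderiv ℝ τ z := by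
  have hd : DifferentiableAt ℝ τ z := hτ.differentiableAt (by simp)
  have hd' : DifferentiableAt ℝ (fderiv ℝ τ) z :=
    (hτ.fderiv_right (m := ∞) (by simp)).differentiableAt (by simp)
  have hUτ : HasFDerivAt (fun y => U (τ y)) _ z := hU.hasFDerivAt.comp z hd.hasFDerivAt
  ext v
  rw [ContinuousMultilinearMap.compContinuousLinearMap_apply, covDerivCoord_apply,
    covDerivCoord_apply]
  have hUU'' : U' =ᶠ[nhds z] fun y => (U (τ y)).compContinuousLinearMap fun _ => fderiv ℝ τ y :=
    hUU'
  rw [hUU''.fderiv_eq, (hUτ.continuousMultilinearMapCompContinuousLinearMap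
    fun _ => hd'.hasFDerivAt).fderiv]
  simp only [_root_.add_apply, ContinuousLinearMap.comp_apply,
    ContinuousMultilinearMap.fderivCompContinuousLinearMap_apply, hUU'.self_of_nhds,
    ContinuousMultilinearMap.compContinuousLinearMap_apply]
  have h1 : ∀ (i : Fin m) (a : Eu n),
      (fun j => fderiv ℝ τ z (Function.update (fun j : Fin m => v j.succ) i a j)) =
        Function.update (fun j : Fin m => fderiv ℝ τ z (v j.succ)) i (fderiv ℝ τ z a) := by
    intro i a
    ext1 j
    by_cases hj : j = i
    · subst hj; simp
    · simp [Function.update_of_ne hj]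
  -- Differentiating the pullback also differentiates the `m` copies of `Dτ`. Each one contributes
  -- `D²τ(v₀, vᵢ)` in slot `i`, and this is cancelled by the inhomogeneous term in the
  -- transformation law of the Christoffel symbols.
  have h2 : ∀ i : Fin m, (fun j => (Function.update (fun _ => fderiv ℝ τ z) i
      (ContinuousLinearMap.pi (fun _ => fderiv ℝ (fderiv ℝ τ) z) (v 0) i) j :
        Eu n →L[ℝ] Eu n) (v j.succ)) =
      Function.update (fun j : Fin m => fderiv ℝ τ z (v j.succ)) i
        (fderiv ℝ (fderiv ℝ τ) z (v 0) (v i.succ)) := by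
    intro i
    ext1 j
    by_cases hj : j = i
    · subst hj; simp
    · simp [Function.update_of_ne hj]
  simp only [h1, h2, fderiv_christoffel hτ hτi hB hB' hsymm hpos hpos' h,
    ContinuousMultilinearMap.map_update_add, Finset.sum_add_distrib]
  have h3 : (ContinuousMultilinearMap.compContinuousLinearMapL (F := ℂ)
      (fun _ : Fin m => fderiv ℝ τ z)) ((fderiv ℝ U (τ z)) (fderiv ℝ τ z (v 0)))
      (fun i => v i.succ) =
      (fderiv ℝ U (τ z)) (fderiv ℝ τ z (v 0)) fun i => fderiv ℝ τ z (v i.succ) := rfl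
  rw [h3]
  ring

/-- The components of a tensor in the frame `ϖᵢ ∂ᵢ`. -/
def frameComp {m : ℕ} (ϖ : Fin n → Eu n → ℝ)
    (U : Eu n → ContinuousMultilinearMap ℝ (fun _ : Fin m => Eu n) ℂ) (z : Eu n)
    (K : Fin m → Fin n) : ℂ :=
  U z fun s => ϖ (K s) z • stdVec (K s)

theorem eq_sum_stdVec (v : Eu n) : v = ∑ l, v l • (stdVec l : Eu n) := by
  ext i
  simp [stdVec, Finset.sum_apply, Pi.single_apply]

theorem frameComp_eq {m : ℕ} (ϖ : Fin n → Eu n → ℝ)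
    (U : Eu n → ContinuousMultilinearMap ℝ (fun _ : Fin m => Eu n) ℂ) (z : Eu n)
    (K : Fin m → Fin n) :
    frameComp ϖ U z K = (∏ s, ϖ (K s) z) • U z fun s => stdVec (K s) :=
  (U z).map_smul_univ _ _

theorem dd_prod {α : Type*} [DecidableEq α] {ϖ : Fin n → Eu n → ℝ} (i : Fin n) (s : Finset α)
    (f t : α → Eu n → ℝ) (z : Eu n) (hf : ∀ a, DifferentiableAt ℝ (f a) z)
    (h : ∀ a, dd ϖ i (f a) z = t a z * f a z) :
    dd ϖ i (fun y => ∏ a ∈ s, f a y) z = (∑ a ∈ s, t a z) * ∏ a ∈ s, f a z := by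
  induction s using Finset.induction_on with
  | empty => simp [dd]
  | insert a s ha ih =>
    simp only [Finset.prod_insert ha, Finset.sum_insert ha]
    have := dd_smul (ϖ := ϖ) (hf a) (HasFDerivAt.finsetProd fun b (_ : b ∈ s) => (hf b).hasFDerivAt).differentiableAt i
    simp only [smul_eq_mul] at this
    rw [this, ih, h]
    ring

/-- The covariant derivative in the frame `ϖᵢ ∂ᵢ`. -/
theorem frameComp_covDerivCoord {m : ℕ} {B : Eu n → Eu n →L[ℝ] Eu n →L[ℝ] ℝ}
    {U : Eu n → ContinuousMultilinearMap ℝ (fun _ : Fin m => Eu n) ℂ} {ϖ : Fin n → Eu n → ℝ}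
    {θ : Fin n → Fin n → Eu n → ℝ} {γ : Fin n → Fin n → Fin n → Eu n → ℝ} {z : Eu n}
    (hϖ : ∀ i, DifferentiableAt ℝ (ϖ i) z) (hθ : ∀ i k, dd ϖ i (ϖ k) z = θ i k z * ϖ k z)
    (hγ : ∀ i k l, ϖ i z * ϖ k z * christoffel B z (stdVec i) (stdVec k) l =
      (γ i k l z - if k = l then θ i k z else 0) * ϖ l z)
    (hU : DifferentiableAt ℝ U z) (K : Fin (m + 1) → Fin n) :
    frameComp ϖ (covDerivCoord B U) z K =
      dd ϖ (K 0) (fun y => frameComp ϖ U y (Fin.tail K)) z -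
      ∑ q, ∑ l, (γ (K 0) (Fin.tail K q) l z : ℂ) *
        frameComp ϖ U z (Function.update (Fin.tail K) q l) := by
  have hUd : DifferentiableAt ℝ (fun y => U y fun s => stdVec (Fin.tail K s)) z :=
    hU.continuousMultilinear_apply_const _
  have hp : DifferentiableAt ℝ (fun y => ∏ s, ϖ (Fin.tail K s) y) z :=
    (HasFDerivAt.finsetProd fun b _ => (hϖ _).hasFDerivAt).differentiableAt
  have h1 : dd ϖ (K 0) (fun y => frameComp ϖ U y (Fin.tail K)) z =
      (∑ q, θ (K 0) (Fin.tail K q) z) • frameComp ϖ U z (Fin.tail K) +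
      ϖ (K 0) z • (∏ s, ϖ (Fin.tail K s) z) •
        fderiv ℝ U z (stdVec (K 0)) (fun s => stdVec (Fin.tail K s)) := by
    simp only [frameComp_eq]
    rw [dd_smul hp hUd, dd_prod (K 0) Finset.univ (fun q => ϖ (Fin.tail K q))
      (fun q => θ (K 0) (Fin.tail K q)) z (fun q => hϖ _) (fun q => hθ _ _), dd,
      fderiv_continuousMultilinear_apply_const_apply hU]
    module
  have h2 : ∀ q, U z (Function.update (fun s => ϖ (Fin.tail K s) z • (stdVec (Fin.tail K s) : Eu n))
      q (christoffel B z (ϖ (K 0) z • stdVec (K 0)) (ϖ (Fin.tail K q) z • stdVec (Fin.tail K q)))) =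
      ∑ l, ((γ (K 0) (Fin.tail K q) l z - if Fin.tail K q = l then θ (K 0) (Fin.tail K q) z else 0 :
        ℝ) : ℂ) * frameComp ϖ U z (Function.update (Fin.tail K) q l) := by
    intro q
    have h3 : christoffel B z (ϖ (K 0) z • stdVec (K 0)) (ϖ (Fin.tail K q) z • stdVec (Fin.tail K q))
        = ∑ l, (γ (K 0) (Fin.tail K q) l z -
          if Fin.tail K q = l then θ (K 0) (Fin.tail K q) z else 0) • ϖ l z • (stdVec l : Eu n) := by
      rw [map_smul, map_smul, _root_.smul_apply, smul_smul,
        eq_sum_stdVec (christoffel B z (stdVec (K 0)) (stdVec (Fin.tail K q))), Finset.smul_sum]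
      refine Finset.sum_congr rfl fun l _ => ?_
      rw [smul_smul, smul_smul, ← hγ]
      congr 1; ring
    rw [h3]
    refine ((U z).toMultilinearMap.map_update_sum _ _ _ _).trans ?_
    refine Finset.sum_congr rfl fun l _ => ?_
    rw [MultilinearMap.map_update_smul, Complex.real_smul, frameComp]
    congr 1
    refine congrArg (U z) (funext fun s => ?_)
    by_cases hs : s = q
    · subst hs; simp
    · simp [Function.update_of_ne hs]
  have h4 : frameComp ϖ (covDerivCoord B U) z K =
      ϖ (K 0) z • (∏ s, ϖ (Fin.tail K s) z) •
        fderiv ℝ U z (stdVec (K 0)) (fun s => stdVec (Fin.tail K s)) -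
      ∑ q, U z (Function.update (fun s => ϖ (Fin.tail K s) z • (stdVec (Fin.tail K s) : Eu n))
      q (christoffel B z (ϖ (K 0) z • stdVec (K 0))
        (ϖ (Fin.tail K q) z • stdVec (Fin.tail K q)))) := by
    rw [frameComp, covDerivCoord_apply]
    congr 1
    rw [map_smul, _root_.smul_apply]
    congr 1
    exact (fderiv ℝ U z (stdVec (K 0))).map_smul_univ _ _
  -- The `θ` term split off here cancels against the logarithmic derivative of `∏ ϖ` found in `h1`.
  -- Only the connection coefficients `γ` of the frame remain.
  have h5 : ∀ q, ∑ l, ((γ (K 0) (Fin.tail K q) l z -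
      if Fin.tail K q = l then θ (K 0) (Fin.tail K q) z else 0 : ℝ) : ℂ) *
        frameComp ϖ U z (Function.update (Fin.tail K) q l) =
      ∑ l, (γ (K 0) (Fin.tail K q) l z : ℂ) * frameComp ϖ U z (Function.update (Fin.tail K) q l) -
      (θ (K 0) (Fin.tail K q) z : ℂ) * frameComp ϖ U z (Fin.tail K) := by
    intro q
    simp only [Complex.ofReal_sub, sub_mul, Finset.sum_sub_distrib]
    congr 1
    rw [Finset.sum_eq_single (Fin.tail K q)]
    · simp
    · intro l _ hl
      simp [Ne.symm hl]
    · simp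
  rw [h4, h1]
  simp only [h2, h5, Finset.sum_sub_distrib, Complex.real_smul, Complex.ofReal_sum, Finset.sum_mul]
  ring

end Covariance

/-! ### Components of tensors and fibre inner products under linear changes of basis -/

section BasisChange

open Matrix

variable {n : ℕ}

/-- The matrix of an endomorphism of `ℝⁿ`. -/
def matOf (D : Eu n →L[ℝ] Eu n) : Matrix (Fin n) (Fin n) ℝ := Matrix.of fun a i => D (stdVec i) a

theorem det_matOf (D : Eu n →L[ℝ] Eu n) : (matOf D).det = D.det := by
  have : matOf D = LinearMap.toMatrix (EuclideanSpace.basisFun (Fin n) ℝ).toBasis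
      (EuclideanSpace.basisFun (Fin n) ℝ).toBasis (D : Eu n →ₗ[ℝ] Eu n) := by
    ext a i
    simp [matOf, LinearMap.toMatrix_apply, stdVec]
  rw [this, LinearMap.det_toMatrix]

/-- The Gram matrix of a bilinear form on `ℝⁿ`. -/
def gramOf (B : Eu n →L[ℝ] Eu n →L[ℝ] ℝ) : Matrix (Fin n) (Fin n) ℝ :=
  Matrix.of fun i j => B (stdVec i) (stdVec j)

theorem apply_stdVec_eq_sum (D : Eu n →L[ℝ] Eu n) (i : Fin n) :
    D (stdVec i) = ∑ a, matOf D a i • (stdVec a : Eu n) :=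
  eq_sum_stdVec _

theorem gramOf_pullB (D : Eu n →L[ℝ] Eu n) (B : Eu n →L[ℝ] Eu n →L[ℝ] ℝ) :
    gramOf (pullB D B) = (matOf D)ᵀ * gramOf B * matOf D := by
  ext i j
  simp only [gramOf, Matrix.of_apply, pullB_apply, Matrix.mul_apply, Matrix.transpose_apply]
  rw [apply_stdVec_eq_sum D i, apply_stdVec_eq_sum D j]
  simp only [map_sum, map_smul, _root_.sum_apply, _root_.smul_apply, smul_eq_mul,
    Finset.sum_mul, Finset.mul_sum]
  refine Finset.sum_congr rfl fun a _ => Finset.sum_congr rfl fun b _ => ?_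
  ring

/-- The components of a tensor on `ℝⁿ`. -/
def stdComp {m : ℕ} (T : ContinuousMultilinearMap ℝ (fun _ : Fin m => Eu n) ℂ)
    (I : Fin m → Fin n) : ℂ :=
  T fun s => stdVec (I s)

/-- The complexification of a real matrix. -/
abbrev cplx {α β : Type*} (A : Matrix α β ℝ) : Matrix α β ℂ := A.map ((↑) : ℝ → ℂ)

theorem cplx_mul (A B : Matrix (Fin n) (Fin n) ℝ) : cplx (A * B) = cplx A * cplx B := by
  ext i j
  simp [Matrix.mul_apply]

theorem cplx_one : cplx (1 : Matrix (Fin n) (Fin n) ℝ) = 1 := by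
  ext i j
  by_cases h : i = j <;> simp [Matrix.one_apply, h]

theorem cplx_conjTranspose (A : Matrix (Fin n) (Fin n) ℝ) : (cplx A)ᴴ = cplx Aᵀ := by
  ext i j
  simp

theorem stdComp_compContinuousLinearMap {m : ℕ}
    (T : ContinuousMultilinearMap ℝ (fun _ : Fin m => Eu n) ℂ) (D : Eu n →L[ℝ] Eu n) :
    stdComp (T.compContinuousLinearMap fun _ => D) = kpow m (cplx (matOf D)ᵀ) *ᵥ stdComp T := by
  ext I
  simp only [stdComp, ContinuousMultilinearMap.compContinuousLinearMap_apply,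
    apply_stdVec_eq_sum D, Matrix.mulVec, dotProduct]
  refine (T.toMultilinearMap.map_sum _).trans ?_
  refine Finset.sum_congr rfl fun r _ => ?_
  refine (T.toMultilinearMap.map_smul_univ _ _).trans ?_
  rw [Complex.real_smul]
  congr 1
  simp [kpow]

/-- The Hermitian form on arrays of components, for the inverse Gram matrix `A`. -/
def arrInner {m : ℕ} (A : Matrix (Fin n) (Fin n) ℝ) (S T : (Fin m → Fin n) → ℂ) : ℂ :=
  S ⬝ᵥ star (kpow m (cplx A) *ᵥ T)

theorem arrInner_mulVec {m : ℕ} (A P : Matrix (Fin n) (Fin n) ℝ) (S T : (Fin m → Fin n) → ℂ) :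
    arrInner A (kpow m (cplx Pᵀ) *ᵥ S) (kpow m (cplx Pᵀ) *ᵥ T) = arrInner (P * A * Pᵀ) S T := by
  rw [arrInner, mulVec_dotProduct_star, kpow_conjTranspose, cplx_conjTranspose,
    Matrix.transpose_transpose, Matrix.mulVec_mulVec, Matrix.mulVec_mulVec, ← kpow_mul, ← kpow_mul,
    ← cplx_mul, ← cplx_mul]
  rfl

theorem arrInner_stdComp_pull {m : ℕ} {D : Eu n →L[ℝ] Eu n} (hD : D.det ≠ 0)
    (B : Eu n →L[ℝ] Eu n →L[ℝ] ℝ)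
    (S T : ContinuousMultilinearMap ℝ (fun _ : Fin m => Eu n) ℂ) :
    arrInner (gramOf (pullB D B))⁻¹ (stdComp (S.compContinuousLinearMap fun _ => D))
      (stdComp (T.compContinuousLinearMap fun _ => D)) =
      arrInner (gramOf B)⁻¹ (stdComp S) (stdComp T) := by
  rw [stdComp_compContinuousLinearMap, stdComp_compContinuousLinearMap, arrInner_mulVec,
    gramOf_pullB]
  congr 1
  have hP : IsUnit (matOf D).det := by rw [det_matOf]; exact isUnit_iff_ne_zero.2 hD
  have hPt : IsUnit (matOf D)ᵀ.det := by rwa [Matrix.det_transpose]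
  rw [Matrix.mul_inv_rev, Matrix.mul_inv_rev, ← Matrix.mul_assoc, Matrix.mul_nonsing_inv _ hP,
    Matrix.one_mul, Matrix.mul_assoc, Matrix.nonsing_inv_mul _ hPt, Matrix.mul_one]

theorem posDef_gramOf {B : Eu n →L[ℝ] Eu n →L[ℝ] ℝ} (hs : ∀ v w, B v w = B w v)
    (hB : ∀ v, v ≠ 0 → 0 < B v v) : (gramOf B).PosDef := by
  refine Matrix.PosDef.of_dotProduct_mulVec_pos ?_ ?_
  · ext i j
    simp [gramOf, hs]
  · intro v hv
    have h1 : B (WithLp.toLp 2 v) (WithLp.toLp 2 v) = star v ⬝ᵥ (gramOf B *ᵥ v) := by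
      rw [eq_sum_stdVec (WithLp.toLp 2 v)]
      simp only [map_sum, map_smul, _root_.sum_apply, _root_.smul_apply, smul_eq_mul,
        dotProduct, Matrix.mulVec, gramOf, Matrix.of_apply, Pi.star_apply, star_trivial,
        Finset.mul_sum]
      rw [Finset.sum_comm]
      refine Finset.sum_congr rfl fun a _ => Finset.sum_congr rfl fun b _ => ?_
      ring
    rw [← h1]
    refine hB _ fun h => hv ?_
    have := congrArg WithLp.ofLp h
    simpa using this

/-- The basis of the space of tensors on `ℝⁿ`. -/
def basisTensor {m : ℕ} (I : Fin m → Fin n) :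
    ContinuousMultilinearMap ℝ (fun _ : Fin m => Eu n) ℂ :=
  (ContinuousMultilinearMap.mkPiAlgebra ℝ (Fin m) ℂ).compContinuousLinearMap fun s =>
    Complex.ofRealCLM.comp (EuclideanSpace.proj (I s) : Eu n →L[ℝ] ℝ)

theorem basisTensor_stdVec {m : ℕ} (I J : Fin m → Fin n) :
    basisTensor I (fun s => stdVec (J s)) = if I = J then 1 else 0 := by
  simp only [basisTensor, ContinuousMultilinearMap.compContinuousLinearMap_apply,
    ContinuousMultilinearMap.mkPiAlgebra_apply]
  by_cases h : I = J
  · subst h; simp [stdVec]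
  · rw [if_neg h]
    obtain ⟨s, hs⟩ := Function.ne_iff.1 h
    refine Finset.prod_eq_zero (Finset.mem_univ s) ?_
    simp [stdVec, hs]

theorem ext_stdComp {m : ℕ} {S T : ContinuousMultilinearMap ℝ (fun _ : Fin m => Eu n) ℂ}
    (h : ∀ I, stdComp S I = stdComp T I) : S = T := by
  refine ContinuousMultilinearMap.toMultilinearMap_injective ?_
  refine Module.Basis.ext_multilinear (fun _ => (EuclideanSpace.basisFun (Fin n) ℝ).toBasis)
    fun I => ?_
  simpa [stdComp, stdVec] using h I

/-- The tensor on `ℝⁿ` with given components. -/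
def ofComp {m : ℕ} (a : (Fin m → Fin n) → ℂ) :
    ContinuousMultilinearMap ℝ (fun _ : Fin m => Eu n) ℂ :=
  ∑ I, a I • basisTensor I

theorem stdComp_ofComp {m : ℕ} (a : (Fin m → Fin n) → ℂ) : stdComp (ofComp a) = a := by
  ext J
  simp [stdComp, ofComp, _root_.sum_apply, basisTensor_stdVec]

theorem ofComp_stdComp {m : ℕ} (T : ContinuousMultilinearMap ℝ (fun _ : Fin m => Eu n) ℂ) :
    ofComp (stdComp T) = T :=
  ext_stdComp fun I => congrFun (stdComp_ofComp _) I

theorem contDiffOn_of_stdComp {m : ℕ} {O : Set (Eu n)}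
    {U : Eu n → ContinuousMultilinearMap ℝ (fun _ : Fin m => Eu n) ℂ}
    (h : SmoothArr O fun z => stdComp (U z)) : ContDiffOn ℝ ∞ U O := by
  have : U = fun z => ∑ I, stdComp (U z) I • basisTensor I := by
    ext1 z; exact (ofComp_stdComp (U z)).symm
  rw [this]
  exact ContDiffOn.sum fun I _ => (h I).smul contDiffOn_const

theorem smoothArr_stdComp {m : ℕ} {O : Set (Eu n)}
    {U : Eu n → ContinuousMultilinearMap ℝ (fun _ : Fin m => Eu n) ℂ}
    (h : ContDiffOn ℝ ∞ U O) : SmoothArr O fun z => stdComp (U z) := fun I =>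
  ((ContinuousMultilinearMap.apply ℝ (fun _ : Fin m => Eu n) ℂ
    fun s => stdVec (I s)).contDiff (n := ∞)).comp_contDiffOn h

end BasisChange

/-! ### Tensor fields in arbitrary charts of the maximal atlas -/

section Transition

variable {n : ℕ} {M : Type*} [TopologicalSpace M] [ChartedSpace (Eu n) M]

/-- A tensor at `p` pulled back to `ℝⁿ`. -/
def tAt {m : ℕ} (u : TField n M m) (p : M) (D : Eu n →L[ℝ] Eu n) :
    ContinuousMultilinearMap ℝ (fun _ : Fin m => Eu n) ℂ :=
  ContinuousMultilinearMap.compContinuousLinearMap (M₁ := fun _ : Fin m => Eu n)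
    (M₁' := fun _ : Fin m => Eu n) (u p) fun _ => D

/-- A bilinear form at `p` pulled back to `ℝⁿ`. -/
def bAt (G : BField n M) (p : M) (D : Eu n →L[ℝ] Eu n) : Eu n →L[ℝ] Eu n →L[ℝ] ℝ :=
  pullB D (G p)

/-- The derivative of the inverse of a chart. -/
def dSymm (φ : OpenPartialHomeomorph M (Eu n)) (z : Eu n) : Eu n →L[ℝ] Eu n :=
  mfderiv (J n) (J n) φ.symm z

/-- The derivative of a chart. -/
def dMap (φ : OpenPartialHomeomorph M (Eu n)) (p : M) : Eu n →L[ℝ] Eu n :=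
  mfderiv (J n) (J n) φ p

/-- A tensor field in the chart `φ`. -/
def tPull {m : ℕ} (u : TField n M m) (φ : OpenPartialHomeomorph M (Eu n)) (z : Eu n) :
    ContinuousMultilinearMap ℝ (fun _ : Fin m => Eu n) ℂ :=
  tAt u (φ.symm z) (dSymm φ z)

/-- A field of bilinear forms in the chart `φ`. -/
def bPull (G : BField n M) (φ : OpenPartialHomeomorph M (Eu n)) (z : Eu n) :
    Eu n →L[ℝ] Eu n →L[ℝ] ℝ :=
  bAt G (φ.symm z) (dSymm φ z)

theorem tAt_comp {m : ℕ} (u : TField n M m) (p : M) (D D' : Eu n →L[ℝ] Eu n) :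
    tAt u p (D.comp D') = (tAt u p D).compContinuousLinearMap fun _ => D' :=
  rfl

theorem bAt_comp (G : BField n M) (p : M) (D D' : Eu n →L[ℝ] Eu n) :
    bAt G p (D.comp D') = pullB D' (bAt G p D) :=
  rfl

variable [IsManifold (J n) ∞ M] {φ φ₁ φ₂ : OpenPartialHomeomorph M (Eu n)}

theorem mdifferentiableAt_symm (h : φ ∈ IsManifold.maximalAtlas (J n) ∞ M) {z : Eu n}
    (hz : z ∈ φ.target) : MDifferentiableAt (J n) (J n) φ.symm z :=
  (contMDiffAt_symm_of_mem_maximalAtlas h hz).mdifferentiableAt (by simp)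

theorem mdifferentiableAt_map (h : φ ∈ IsManifold.maximalAtlas (J n) ∞ M) {p : M}
    (hp : p ∈ φ.source) : MDifferentiableAt (J n) (J n) φ p :=
  (contMDiffAt_of_mem_maximalAtlas h hp).mdifferentiableAt (by simp)

theorem dMap_comp_dSymm (h : φ ∈ IsManifold.maximalAtlas (J n) ∞ M) {z : Eu n}
    (hz : z ∈ φ.target) : (dMap φ (φ.symm z)).comp (dSymm φ z) = ContinuousLinearMap.id ℝ (Eu n) := by
  have h1 := mfderiv_comp z (mdifferentiableAt_map h (φ.map_target hz)) (mdifferentiableAt_symm h hz)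
  have h2 : (φ ∘ φ.symm) =ᶠ[nhds z] id :=
    Filter.eventually_of_mem (φ.open_target.mem_nhds hz) fun y hy => φ.right_inv hy
  rw [h2.mfderiv_eq] at h1
  exact h1.symm.trans mfderiv_id

theorem dSymm_comp_dMap (h : φ ∈ IsManifold.maximalAtlas (J n) ∞ M) {p : M}
    (hp : p ∈ φ.source) : (dSymm φ (φ p)).comp (dMap φ p) = ContinuousLinearMap.id ℝ (Eu n) := by
  have h1 := mfderiv_comp p (mdifferentiableAt_symm h (φ.map_source hp)) (mdifferentiableAt_map h hp)
  have h2 : (φ.symm ∘ φ) =ᶠ[nhds p] id :=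
    Filter.eventually_of_mem (φ.open_source.mem_nhds hp) fun y hy => φ.left_inv hy
  rw [h2.mfderiv_eq] at h1
  exact h1.symm.trans mfderiv_id

theorem contDiffOn_transition (h₁ : φ₁ ∈ IsManifold.maximalAtlas (J n) ∞ M)
    (h₂ : φ₂ ∈ IsManifold.maximalAtlas (J n) ∞ M) :
    ContDiffOn ℝ ∞ (φ₂ ∘ φ₁.symm) (φ₁.symm.trans φ₂).source := by
  rw [← contMDiffOn_iff_contDiffOn]
  refine (contMDiffOn_of_mem_maximalAtlas h₂).comp
    ((contMDiffOn_symm_of_mem_maximalAtlas h₁).mono ?_) ?_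
  · intro z hz; exact hz.1
  · intro z hz; exact hz.2

theorem dSymm_transition (h₁ : φ₁ ∈ IsManifold.maximalAtlas (J n) ∞ M)
    (h₂ : φ₂ ∈ IsManifold.maximalAtlas (J n) ∞ M) {z : Eu n}
    (hz : z ∈ (φ₁.symm.trans φ₂).source) :
    dSymm φ₁ z = (dSymm φ₂ (φ₂ (φ₁.symm z))).comp (fderiv ℝ (φ₂ ∘ φ₁.symm) z) := by
  have ho := (φ₁.symm.trans φ₂).open_source
  have hτ : MDifferentiableAt (J n) (J n) (φ₂ ∘ φ₁.symm) z :=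
    (((contDiffOn_transition h₁ h₂).contDiffAt (ho.mem_nhds hz)).differentiableAt
      (by simp)).mdifferentiableAt
  have h1 : MDifferentiableAt (J n) (J n) φ₂.symm ((φ₂ ∘ φ₁.symm) z) :=
    mdifferentiableAt_symm h₂ (φ₂.map_source hz.2)
  have h2 := mfderiv_comp z h1 hτ
  have h3 : (φ₂.symm ∘ (φ₂ ∘ φ₁.symm)) =ᶠ[nhds z] φ₁.symm :=
    Filter.eventually_of_mem (ho.mem_nhds hz) fun y hy => φ₂.left_inv hy.2
  rw [h3.mfderiv_eq, mfderiv_eq_fderiv] at h2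
  exact h2

theorem tPull_transition {m : ℕ} (u : TField n M m)
    (h₁ : φ₁ ∈ IsManifold.maximalAtlas (J n) ∞ M)
    (h₂ : φ₂ ∈ IsManifold.maximalAtlas (J n) ∞ M) {z : Eu n}
    (hz : z ∈ (φ₁.symm.trans φ₂).source) :
    tPull u φ₁ z = (tPull u φ₂ (φ₂ (φ₁.symm z))).compContinuousLinearMap
      fun _ => fderiv ℝ (φ₂ ∘ φ₁.symm) z := by
  have hz2 : φ₁.symm z ∈ φ₂.source := hz.2
  rw [tPull, tPull, ← tAt_comp, dSymm_transition h₁ h₂ hz, φ₂.left_inv hz2]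

theorem bPull_transition (G : BField n M)
    (h₁ : φ₁ ∈ IsManifold.maximalAtlas (J n) ∞ M)
    (h₂ : φ₂ ∈ IsManifold.maximalAtlas (J n) ∞ M) {z : Eu n}
    (hz : z ∈ (φ₁.symm.trans φ₂).source) :
    bPull G φ₁ z = pullB (fderiv ℝ (φ₂ ∘ φ₁.symm) z) (bPull G φ₂ (φ₂ (φ₁.symm z))) := by
  have hz2 : φ₁.symm z ∈ φ₂.source := hz.2
  rw [bPull, bPull, ← bAt_comp, dSymm_transition h₁ h₂ hz, φ₂.left_inv hz2]

theorem surjective_fderiv_transition (h₁ : φ₁ ∈ IsManifold.maximalAtlas (J n) ∞ M)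
    (h₂ : φ₂ ∈ IsManifold.maximalAtlas (J n) ∞ M) {z : Eu n}
    (hz : z ∈ (φ₁.symm.trans φ₂).source) :
    Function.Surjective (fderiv ℝ (φ₂ ∘ φ₁.symm) z) := by
  intro v
  have hz2 : φ₁.symm z ∈ φ₂.source := hz.2
  have h2 := dMap_comp_dSymm h₂ (φ₂.map_source hz2)
  have h3 : ∀ w, dSymm φ₁ z (dMap φ₁ (φ₁.symm z) w) = w := by
    intro w
    have := dSymm_comp_dMap h₁ (φ₁.map_target hz.1)
    rw [φ₁.right_inv hz.1] at this
    exact congrArg (fun L : Eu n →L[ℝ] Eu n => L w) this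
  refine ⟨dMap φ₁ (φ₁.symm z) (dSymm φ₂ (φ₂ (φ₁.symm z)) v), ?_⟩
  have h4 := h3 (dSymm φ₂ (φ₂ (φ₁.symm z)) v)
  rw [dSymm_transition h₁ h₂ hz, ContinuousLinearMap.comp_apply] at h4
  have h5 := congrArg (dMap φ₂ (φ₂.symm (φ₂ (φ₁.symm z)))) h4
  rw [← ContinuousLinearMap.comp_apply, ← ContinuousLinearMap.comp_apply, h2] at h5
  exact h5.trans (congrArg (fun L : Eu n →L[ℝ] Eu n => L v) h2)

theorem ContDiffAt.tensor_pull {m : ℕ}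
    {U : Eu n → ContinuousMultilinearMap ℝ (fun _ : Fin m => Eu n) ℂ} {D : Eu n → Eu n →L[ℝ] Eu n}
    {z : Eu n} (hU : ContDiffAt ℝ ∞ U z) (hD : ContDiffAt ℝ ∞ D z) :
    ContDiffAt ℝ ∞ (fun y => (U y).compContinuousLinearMap fun _ => D y) z := by
  have h1 : ContDiffAt ℝ ∞ (fun y =>
      ContinuousMultilinearMap.compContinuousLinearMapContinuousMultilinear ℝ
        (fun _ : Fin m => Eu n) (fun _ : Fin m => Eu n) ℂ fun _ => D y) z :=
    (ContinuousMultilinearMap.contDiff _).contDiffAt.comp z (contDiffAt_pi.2 fun _ => hD)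
  exact h1.clm_apply hU

/-- The part of the target of a chart where `x > 0`. -/
def posTarget (x : M → ℝ) (φ : OpenPartialHomeomorph M (Eu n)) : Set (Eu n) :=
  φ.target ∩ {z | 0 < x (φ.symm z)}

theorem isOpen_posTarget {x : M → ℝ} (hx : Continuous x) (φ : OpenPartialHomeomorph M (Eu n)) :
    IsOpen (posTarget x φ) :=
  φ.symm.continuousOn.isOpen_inter_preimage φ.open_target (isOpen_lt continuous_const hx)

/-- Membership in `TensorSections` only controls, for each point, the preferred chart there and near
that point. The transition map transfers this to any chart of the atlas. -/
theorem contDiffOn_tPull {m : ℕ} {x : M → ℝ} {u : TField n M m} (hu : u ∈ TensorSections x m)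
    (h : φ ∈ IsManifold.maximalAtlas (J n) ∞ M) : ContDiffOn ℝ ∞ (tPull u φ) (posTarget x φ) := by
  intro z hz
  refine ContDiffAt.contDiffWithinAt ?_
  set p := φ.symm z with hp
  set φ₂ := chartAt (Eu n) p with hφ₂
  have h₂ : φ₂ ∈ IsManifold.maximalAtlas (J n) ∞ M := IsManifold.chart_mem_maximalAtlas p
  have hz' : z ∈ (φ.symm.trans φ₂).source := ⟨hz.1, mem_chart_source _ p⟩
  have ho := (φ.symm.trans φ₂).open_source
  have hτ : ContDiffAt ℝ ∞ (φ₂ ∘ φ.symm) z :=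
    (contDiffOn_transition h h₂).contDiffAt (ho.mem_nhds hz')
  have h1 : ContDiffAt ℝ ∞ (tPull u φ₂) ((φ₂ ∘ φ.symm) z) := hu p hz.2
  have h3 : tPull u φ =ᶠ[nhds z] fun y => (tPull u φ₂ (φ₂ (φ.symm y))).compContinuousLinearMap
      fun _ => fderiv ℝ (φ₂ ∘ φ.symm) y :=
    Filter.eventually_of_mem (ho.mem_nhds hz') fun y hy => tPull_transition u h h₂ hy
  refine ContDiffAt.congr_of_eventuallyEq ?_ h3
  exact ContDiffAt.tensor_pull (h1.comp z hτ) (hτ.fderiv_right (m := ∞) (by simp))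

end Transition

/-! ### Metrics and covariant derivatives in charts -/

section ChartFields

open Bundle

variable {n : ℕ} {M : Type*} [TopologicalSpace M] [ChartedSpace (Eu n) M]
  [IsManifold (J n) ∞ M] {φ φ₁ φ₂ : OpenPartialHomeomorph M (Eu n)}

theorem contMDiffOn_dSymm (h : φ ∈ IsManifold.maximalAtlas (J n) ∞ M) {O : Set (Eu n)}
    (hO : O ⊆ φ.target) {v : Eu n → Eu n} (hv : ContDiffOn ℝ ∞ v O) :
    ContMDiffOn (J n) (J n).tangent ∞
      (fun z => (⟨φ.symm z, dSymm φ z (v z)⟩ : TangentBundle (J n) M)) O := by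
  have h1 := (contMDiffOn_symm_of_mem_maximalAtlas h).contMDiffOn_tangentMapWithin (m := ∞)
    (by simp) φ.open_target.uniqueMDiffOn
  have h2 : ContMDiffOn (J n) (J n).tangent ∞
      (fun z : Eu n => (⟨z, v z⟩ : TangentBundle (J n) (Eu n))) O := by
    intro z hz
    rw [contMDiffWithinAt_totalSpace]
    refine ⟨contMDiffWithinAt_id, ?_⟩
    simp only [mfld_simps]
    exact (contMDiffOn_iff_contDiffOn.2 hv) z hz
  refine (h1.comp h2 fun z hz => hO hz).congr fun z hz => ?_
  simp only [Function.comp_apply, tangentMapWithin]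
  rw [mfderivWithin_eq_mfderiv (φ.open_target.uniqueMDiffOn z (hO hz))
    (mdifferentiableAt_symm h (hO hz))]
  rfl

/-- Smoothness of a bundle section is tested by evaluating it on pairs of coordinate fields, which
are smooth sections of the tangent bundle along the inverse chart. -/
theorem contDiffOn_bPull {G : BField n M}
    (hG : ContMDiff (J n) ((J n).prod (modelWithCornersSelf ℝ (Eu n →L[ℝ] Eu n →L[ℝ] ℝ))) ∞
    (fun p => Bundle.TotalSpace.mk' (Eu n →L[ℝ] Eu n →L[ℝ] ℝ) (E := fun p : M =>
      TangentSpace (J n) p →L[ℝ] TangentSpace (J n) p →L[ℝ] ℝ) p (G p)))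
    (h : φ ∈ IsManifold.maximalAtlas (J n) ∞ M) : ContDiffOn ℝ ∞ (bPull G φ) φ.target := by
  rw [contDiffOn_clm_apply]
  intro v
  rw [contDiffOn_clm_apply]
  intro w
  have h1 : ContMDiffOn (J n) ((J n).prod (modelWithCornersSelf ℝ ℝ)) ∞
      (fun z => TotalSpace.mk' ℝ (E := Bundle.Trivial M ℝ) (φ.symm z)
        (G (φ.symm z) (dSymm φ z v) (dSymm φ z w))) φ.target := by
    apply ContMDiffOn.clm_bundle_apply₂ (F₁ := Eu n) (F₂ := Eu n)
    · exact hG.comp_contMDiffOn (contMDiffOn_symm_of_mem_maximalAtlas h)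
    · exact contMDiffOn_dSymm h subset_rfl contDiffOn_const
    · exact contMDiffOn_dSymm h subset_rfl contDiffOn_const
  have h2 : ContMDiffOn (J n) (modelWithCornersSelf ℝ ℝ) ∞
      (fun z => (G (φ.symm z) (dSymm φ z v) (dSymm φ z w) : ℝ)) φ.target := by
    intro z hz
    have := h1 z hz
    rw [contMDiffWithinAt_totalSpace] at this
    exact this.2
  exact contMDiffOn_iff_contDiffOn.1 h2

/-- A real function in the chart `φ`. -/
abbrev fPull (x : M → ℝ) (φ : OpenPartialHomeomorph M (Eu n)) (z : Eu n) : ℝ := x (φ.symm z)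

theorem contDiffOn_fPull {x : M → ℝ} (hx : ContMDiff (J n) (modelWithCornersSelf ℝ ℝ) ∞ x)
    (h : φ ∈ IsManifold.maximalAtlas (J n) ∞ M) : ContDiffOn ℝ ∞ (fPull x φ) φ.target :=
  contMDiffOn_iff_contDiffOn.1 (hx.comp_contMDiffOn (contMDiffOn_symm_of_mem_maximalAtlas h))

theorem fderiv_fPull {x : M → ℝ} (hx : ContMDiff (J n) (modelWithCornersSelf ℝ ℝ) ∞ x)
    (h : φ ∈ IsManifold.maximalAtlas (J n) ∞ M) {z : Eu n} (hz : z ∈ φ.target) (v : Eu n) :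
    fderiv ℝ (fPull x φ) z v = dFun x (φ.symm z) (dSymm φ z v) := by
  have h1 := mfderiv_comp z (hx.mdifferentiableAt (by simp)) (mdifferentiableAt_symm h hz)
  rw [mfderiv_eq_fderiv] at h1
  exact congrArg (fun L : Eu n →L[ℝ] ℝ => L v) h1

theorem bPull_scMetric {x : M → ℝ} (hx : ContMDiff (J n) (modelWithCornersSelf ℝ ℝ) ∞ x)
    (k : BField n M) (h : φ ∈ IsManifold.maximalAtlas (J n) ∞ M) {z : Eu n} (hz : z ∈ φ.target)
    (v w : Eu n) : bPull (scMetric x k) φ z v w =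
      (fPull x φ z ^ 4)⁻¹ * (fderiv ℝ (fPull x φ) z v * fderiv ℝ (fPull x φ) z w) +
        (fPull x φ z ^ 2)⁻¹ * bPull k φ z v w := by
  rw [fderiv_fPull hx h hz, fderiv_fPull hx h hz]
  rfl

/-- `G` is a smooth Riemannian metric on `{x > 0}`. -/
structure IsMetricOn (x : M → ℝ) (G : BField n M) : Prop where
  symm : ∀ p, 0 < x p → ∀ v w, G p v w = G p w v
  pos : ∀ p, 0 < x p → ∀ v, v ≠ 0 → 0 < G p v v
  smooth : ∀ φ ∈ IsManifold.maximalAtlas (J n) ∞ M, ContDiffOn ℝ ∞ (bPull G φ) (posTarget x φ)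

theorem isMetricOn_inner (x : M → ℝ)
    (g : ContMDiffRiemannianMetric (J n) ∞ (Eu n) (fun p : M => TangentSpace (J n) p)) :
    IsMetricOn x g.inner where
  symm p _ := g.symm p
  pos p _ := g.pos p
  smooth _ h := (contDiffOn_bPull g.contMDiff h).mono Set.inter_subset_left

theorem isMetricOn_scMetric {x : M → ℝ} (hx : ContMDiff (J n) (modelWithCornersSelf ℝ ℝ) ∞ x)
    {k : BField n M} (hk : IsSmoothSymForm k) (hsc : IsScMetric x k) :
    IsMetricOn x (scMetric x k) where
  symm p _ v w := by
    change (x p ^ 4)⁻¹ * (dFun x p v * dFun x p w) + (x p ^ 2)⁻¹ * k p v w =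
      (x p ^ 4)⁻¹ * (dFun x p w * dFun x p v) + (x p ^ 2)⁻¹ * k p w v
    rw [hk.1 p v w, mul_comm (dFun x p v)]
  pos := hsc.1
  smooth φ h := by
    rw [contDiffOn_clm_apply]
    intro v
    rw [contDiffOn_clm_apply]
    intro w
    have hX := contDiffOn_fPull hx h
    have hd : ∀ v, ContDiffOn ℝ ∞ (fun z => fderiv ℝ (fPull x φ) z v) (posTarget x φ) := fun v =>
      (contDiffOn_fderiv_apply φ.open_target hX v).mono Set.inter_subset_left
    have hX' := hX.mono (Set.inter_subset_left : posTarget x φ ⊆ φ.target)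
    have hne : ∀ z ∈ posTarget x φ, fPull x φ z ≠ 0 := fun z hz => (hz.2 : 0 < x (φ.symm z)).ne'
    have hb := (((contDiffOn_bPull hk.2 h).clm_apply (contDiffOn_const (c := v))).clm_apply
      (contDiffOn_const (c := w))).mono (Set.inter_subset_left : posTarget x φ ⊆ φ.target)
    refine ((((hX'.pow 4).inv fun z hz => pow_ne_zero _ (hne z hz)).mul
      ((hd v).mul (hd w))).add (((hX'.pow 2).inv fun z hz => pow_ne_zero _ (hne z hz)).mul
      hb)).congr fun z hz => bPull_scMetric hx k h hz.1 v w

theorem dSymm_ne_zero (h : φ ∈ IsManifold.maximalAtlas (J n) ∞ M) {z : Eu n}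
    (hz : z ∈ φ.target) {v : Eu n} (hv : v ≠ 0) : dSymm φ z v ≠ 0 := by
  intro h0
  have := congrArg (fun L : Eu n →L[ℝ] Eu n => L v) (dMap_comp_dSymm h hz)
  simp only [ContinuousLinearMap.comp_apply, h0, map_zero] at this
  exact hv this.symm

theorem IsMetricOn.bPull_symm {x : M → ℝ} {G : BField n M} (hG : IsMetricOn x G) {z : Eu n}
    (hz : z ∈ posTarget x φ) (v w : Eu n) : bPull G φ z v w = bPull G φ z w v :=
  hG.symm _ hz.2 _ _

theorem IsMetricOn.bPull_pos {x : M → ℝ} {G : BField n M} (hG : IsMetricOn x G)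
    (h : φ ∈ IsManifold.maximalAtlas (J n) ∞ M) {z : Eu n}
    (hz : z ∈ posTarget x φ) (v : Eu n) (hv : v ≠ 0) : 0 < bPull G φ z v v :=
  hG.pos _ hz.2 _ (dSymm_ne_zero h hz.1 hv)

/-- The covariant derivative in an arbitrary chart. -/
theorem tPull_covDeriv {m : ℕ} {x : M → ℝ} (hx : Continuous x) {G : BField n M}
    (hG : IsMetricOn x G) {u : TField n M m} (hu : u ∈ TensorSections x m)
    (h : φ ∈ IsManifold.maximalAtlas (J n) ∞ M) {z : Eu n} (hz : z ∈ posTarget x φ) :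
    tPull (covDeriv G u) φ z = covDerivCoord (bPull G φ) (tPull u φ) z := by
  set p := φ.symm z with hp
  set φ₂ := chartAt (Eu n) p with hφ₂
  have h₂ : φ₂ ∈ IsManifold.maximalAtlas (J n) ∞ M := IsManifold.chart_mem_maximalAtlas p
  have hz' : z ∈ (φ.symm.trans φ₂).source := ⟨hz.1, mem_chart_source _ p⟩
  have ho := (φ.symm.trans φ₂).open_source
  have hτ : ContDiffAt ℝ ∞ (φ₂ ∘ φ.symm) z :=
    (contDiffOn_transition h h₂).contDiffAt (ho.mem_nhds hz')
  have hw : (φ₂ ∘ φ.symm) z ∈ posTarget x φ₂ := by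
    refine ⟨φ₂.map_source (mem_chart_source _ p), ?_⟩
    change 0 < x (φ₂.symm (φ₂ p))
    rw [φ₂.left_inv (mem_chart_source _ p)]
    exact hz.2
  -- At `p` the covariant derivative is defined through the preferred chart at `p`, which changes
  -- with the point. Covariance replaces it by the fixed chart `φ`.
  rw [covDerivCoord_pull hτ (surjective_fderiv_transition h h₂ hz')
    (differentiableAt_of_contDiffOn (isOpen_posTarget hx φ₂) (hG.smooth φ₂ h₂) hw)
    (differentiableAt_of_contDiffOn (isOpen_posTarget hx φ) (hG.smooth φ h) hz)
    (fun v w => hG.bPull_symm hw v w) (fun v hv => hG.bPull_pos h₂ hw v hv)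
    (fun v hv => hG.bPull_pos h hz v hv)
    (Filter.eventually_of_mem (ho.mem_nhds hz') fun y hy => bPull_transition G h h₂ hy)
    (differentiableAt_of_contDiffOn (isOpen_posTarget hx φ₂) (contDiffOn_tPull hu h₂) hw)
    (Filter.eventually_of_mem (ho.mem_nhds hz') fun y hy => tPull_transition u h h₂ hy)]
  have h1 : fderiv ℝ (φ₂ ∘ φ.symm) z = (dMap φ₂ p).comp (dSymm φ z) := by
    have := mfderiv_comp z (mdifferentiableAt_map h₂ (mem_chart_source _ p))
      (mdifferentiableAt_symm h hz.1)
    rw [mfderiv_eq_fderiv] at this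
    exact this
  rw [h1]
  rfl

end ChartFields

/-! ### Charts with a scattering frame, and the Gram matrix of the scattering metric -/

section FrameCharts

open Matrix

variable {n : ℕ} {M : Type*} [TopologicalSpace M] [ChartedSpace (Eu n) M]

/-- The Gram matrix of a scattering metric in a scattering frame `ϖᵢ∂ᵢ`, with `ϖᵢ = x νᵢ` and
`ϖᵢ ∂ᵢ x = - τᵢ x²`. -/
def scGram (h : BField n M) (φ : OpenPartialHomeomorph M (Eu n)) (τ ν : Fin n → Eu n → ℝ)
    (z : Eu n) : Matrix (Fin n) (Fin n) ℝ :=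
  Matrix.of fun i k => τ i z * τ k z + ν i z * ν k z * bPull h φ z (stdVec i) (stdVec k)

/-- A chart with a frame `ϖᵢ∂ᵢ` of the scattering tangent bundle over the part `O` of its target. -/
structure FrameChart (n : ℕ) {M : Type*} [TopologicalSpace M] [ChartedSpace (Eu n) M]
    [IsManifold (J n) ∞ M] (x : M → ℝ) (h : BField n M) where
  /-- The chart. -/
  φ : OpenPartialHomeomorph M (Eu n)
  /-- The domain of the frame. -/
  O : Set (Eu n)
  /-- The coefficients of the frame. -/
  ϖ : Fin n → Eu n → ℝ
  /-- The coefficients of the frame, divided by `x`. -/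
  ν : Fin n → Eu n → ℝ
  /-- The derivatives of `log x` along the frame, divided by `x`. -/
  b : Fin n → Eu n → ℝ
  /-- The derivatives of `1 / x` along the frame. -/
  τ : Fin n → Eu n → ℝ
  /-- The logarithmic derivatives of the coefficients along the frame. -/
  θ : Fin n → Fin n → Eu n → ℝ
  /-- The quotients `ϖᵢ ϖₖ / ϖₗ`. -/
  q : Fin n → Fin n → Fin n → Eu n → ℝ
  mem : φ ∈ IsManifold.maximalAtlas (J n) ∞ M
  isOpen : IsOpen O
  subset : O ⊆ φ.target
  smooth_ϖ : ∀ i, ContDiffOn ℝ ∞ (ϖ i) O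
  smooth_ν : ∀ i, ContDiffOn ℝ ∞ (ν i) O
  smooth_b : ∀ i, ContDiffOn ℝ ∞ (b i) O
  smooth_τ : ∀ i, ContDiffOn ℝ ∞ (τ i) O
  smooth_θ : ∀ i k, ContDiffOn ℝ ∞ (θ i k) O
  smooth_q : ∀ i k l, ContDiffOn ℝ ∞ (q i k l) O
  dd_ϖ : ∀ i k, ∀ z ∈ O, dd ϖ i (ϖ k) z = θ i k z * ϖ k z
  mul_ϖ : ∀ i k l, ∀ z ∈ O, ϖ i z * ϖ k z = q i k l z * ϖ l z
  dd_x : ∀ i, ∀ z ∈ O, dd ϖ i (fPull x φ) z = -(τ i z * fPull x φ z ^ 2)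
  x_mul_ν : ∀ i, ∀ z ∈ O, fPull x φ z * ν i z = ϖ i z
  ν_mul : ∀ i, ∀ z ∈ O, ν i z * fderiv ℝ (fPull x φ) z (stdVec i) = fPull x φ z * b i z
  ϖ_ne_zero : ∀ i, ∀ z ∈ O, fPull x φ z ≠ 0 → ϖ i z ≠ 0
  -- Here `j` is the normal direction. The last clause is the source of triangularity: Christoffel
  -- symbols of a metric smooth up to the boundary enter the frame with the factor `q`, so on the
  -- boundary they survive only with two tangential lower indices and a normal upper one.
  bdry : ∀ z ∈ O, fPull x φ z = 0 → ∃ j, (∀ i, i ≠ j → ν i z ≠ 0 ∧ τ i z = 0 ∧ b i z = 0) ∧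
    ν j z = 0 ∧ τ j z ≠ 0 ∧ b j z ≠ 0 ∧ (∀ i k, θ i k z = 0) ∧
      ∀ i k l, q i k l z ≠ 0 → i ≠ j ∧ k ≠ j ∧ l = j
  -- `O` may contain points with `x < 0`, where no positivity is assumed; nondegeneracy there has to
  -- be arranged by the choice of `O`.
  det_ne_zero : ∀ z ∈ O, (scGram h φ τ ν z).det ≠ 0

/-- Multiplication of the coordinates by given factors. -/
def diagL (r : Fin n → ℝ) : Eu n →L[ℝ] Eu n :=
  ∑ i, r i • (EuclideanSpace.proj i : Eu n →L[ℝ] ℝ).smulRight (stdVec i)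

theorem diagL_apply (r : Fin n → ℝ) (v : Eu n) (i : Fin n) : diagL r v i = r i * v i := by
  simp [diagL, _root_.sum_apply, stdVec, Pi.single_apply]

theorem diagL_stdVec (r : Fin n → ℝ) (i : Fin n) : diagL r (stdVec i) = r i • stdVec i := by
  ext k
  by_cases h : k = i
  · subst h; simp [diagL_apply]
  · simp [diagL_apply, stdVec, h]

theorem diagL_comp_diagL {r s : Fin n → ℝ} (h : ∀ i, r i * s i = 1) :
    (diagL r).comp (diagL s) = ContinuousLinearMap.id ℝ (Eu n) := by
  ext v i
  simp only [ContinuousLinearMap.comp_apply, diagL_apply, ← mul_assoc, h, one_mul,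
    ContinuousLinearMap.id_apply]

theorem stdComp_compContinuousLinearMap_diagL {m : ℕ} (ϖ : Fin n → Eu n → ℝ)
    (U : Eu n → ContinuousMultilinearMap ℝ (fun _ : Fin m => Eu n) ℂ) (z : Eu n) :
    stdComp ((U z).compContinuousLinearMap fun _ => diagL fun i => ϖ i z) = frameComp ϖ U z := by
  ext K
  simp [stdComp, frameComp, diagL_stdVec]

variable [IsManifold (J n) ∞ M] {x : M → ℝ} {h : BField n M}

/-- The assumptions on a boundary defining function `x` and a form `h` which define a scattering
metric. -/
structure ScSetup (x : M → ℝ) (h : BField n M) : Prop where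
  smooth : ContMDiff (J n) (modelWithCornersSelf ℝ ℝ) ∞ x
  dx : ∀ p, x p = 0 → dFun (n := n) x p ≠ 0
  form : IsSmoothSymForm h
  sc : IsScMetric x h

theorem ScSetup.isMetricOn (hS : ScSetup x h) : IsMetricOn x (scMetric x h) :=
  isMetricOn_scMetric hS.smooth hS.form hS.sc

theorem symmetrize_apply {m : ℕ} {p : M} (T : Cov n m p) (v : Fin m → TangentSpace (J n) p) :
    symmetrize T v = ((m.factorial : ℝ)⁻¹ : ℝ) * ∑ σ : Equiv.Perm (Fin m), T fun s => v (σ s) := by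
  rw [symmetrize, _root_.smul_apply, _root_.sum_apply, Complex.real_smul]
  rfl

/-- Positivity of the Gram matrix at the boundary. -/
theorem posDef_scGram (hS : ScSetup x h) {φ : OpenPartialHomeomorph M (Eu n)}
    (hφ : φ ∈ IsManifold.maximalAtlas (J n) ∞ M) {τ ν : Fin n → Eu n → ℝ} {z : Eu n}
    (hz : z ∈ φ.target) (h0 : fPull x φ z = 0) {j : Fin n} (hτj : τ j z ≠ 0)
    (hj : ∀ i, i ≠ j → ν i z ≠ 0)
    (hb : ∀ i, ν i z * fderiv ℝ (fPull x φ) z (stdVec i) = 0) : (scGram h φ τ ν z).PosDef := by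
  refine Matrix.PosDef.of_dotProduct_mulVec_pos ?_ ?_
  · ext i k
    have : bPull h φ z (stdVec i) (stdVec k) = bPull h φ z (stdVec k) (stdVec i) :=
      hS.form.1 _ _ _
    simp only [scGram, Matrix.conjTranspose_apply, Matrix.of_apply, star_trivial, this]
    ring
  · intro v hv
    -- The quadratic form is `(∑ vᵢ τᵢ)² + h(w, w)`, where `w` is tangent to the boundary. If `w ≠
    -- 0` the second term is positive. If `w = 0` only `v j` can be nonzero, and the square is
    -- positive because `τ j ≠ 0`.
    set w : Eu n := ∑ i, (v i * ν i z) • stdVec i with hw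
    have h1 : star v ⬝ᵥ (scGram h φ τ ν z *ᵥ v) = (∑ i, v i * τ i z) ^ 2 + bPull h φ z w w := by
      simp only [hw, map_sum, map_smul, _root_.sum_apply, _root_.smul_apply, smul_eq_mul,
        dotProduct, Matrix.mulVec, scGram, Matrix.of_apply, Pi.star_apply, star_trivial,
        Finset.mul_sum, sq, Finset.sum_mul, ← Finset.sum_add_distrib]
      rw [Finset.sum_comm]
      refine Finset.sum_congr rfl fun i _ => Finset.sum_congr rfl fun k _ => ?_
      ring
    have hwi : ∀ i, w i = v i * ν i z := fun i => by
      simp [hw, stdVec, Pi.single_apply]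
    rw [h1]
    by_cases hw0 : w = 0
    · have hv0 : ∀ i, i ≠ j → v i = 0 := fun i hi => by
        have := hwi i
        rw [hw0] at this
        exact (mul_eq_zero.1 this.symm).resolve_right (hj i hi)
      have hvj : v j ≠ 0 := fun h2 => hv (funext fun i => by
        by_cases hi : i = j
        · rw [hi, h2]; rfl
        · exact hv0 i hi)
      have h3 : ∑ i, v i * τ i z = v j * τ j z :=
        Finset.sum_eq_single j (fun i _ hi => by rw [hv0 i hi, zero_mul]) (by simp)
      rw [h3, hw0, map_zero, add_zero]
      exact sq_pos_of_ne_zero (mul_ne_zero hvj hτj)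
    · have h2 : dFun x (φ.symm z) (dSymm φ z w) = 0 := by
        rw [← fderiv_fPull hS.smooth hφ hz, hw]
        simp only [map_sum, map_smul, smul_eq_mul]
        refine Finset.sum_eq_zero fun i _ => ?_
        rw [mul_assoc, hb i, mul_zero]
      exact add_pos_of_nonneg_of_pos (sq_nonneg _)
        (hS.sc.2 _ h0 _ (dSymm_ne_zero hφ hz hw0) h2)

namespace FrameChart

variable (C : FrameChart n x h)

/-- The part of the domain of the frame where `x > 0`. -/
def pos : Set (Eu n) := {z | z ∈ C.O ∧ 0 < fPull x C.φ z}

/-- The domain of the frame in the manifold. -/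
def U : Set M := C.φ.source ∩ C.φ ⁻¹' C.O

theorem pos_subset : C.pos ⊆ C.O := fun _ hz => hz.1

theorem pos_subset_posTarget : C.pos ⊆ posTarget x C.φ := fun _ hz => ⟨C.subset hz.1, hz.2⟩

theorem isOpen_pos (hx : Continuous x) : IsOpen C.pos := by
  have h1 : C.pos = C.O ∩ posTarget x C.φ := by
    ext z
    exact ⟨fun hz => ⟨hz.1, C.pos_subset_posTarget hz⟩, fun hz => ⟨hz.1, hz.2.2⟩⟩
  rw [h1]
  exact C.isOpen.inter (isOpen_posTarget hx _)

theorem isOpen_U : IsOpen C.U := C.φ.isOpen_inter_preimage C.isOpen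

theorem symm_mem {z : Eu n} (hz : z ∈ C.O) : C.φ.symm z ∈ C.U :=
  ⟨C.φ.map_target (C.subset hz), by
    change C.φ (C.φ.symm z) ∈ C.O
    rwa [C.φ.right_inv (C.subset hz)]⟩

theorem map_mem_pos {p : M} (hp : p ∈ C.U) (hx : 0 < x p) : C.φ p ∈ C.pos := by
  refine ⟨hp.2, ?_⟩
  rw [fPull, C.φ.left_inv hp.1]
  exact hx

theorem ϖ_ne (i : Fin n) {z : Eu n} (hz : z ∈ C.pos) : C.ϖ i z ≠ 0 :=
  C.ϖ_ne_zero i z hz.1 hz.2.ne'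

/-- The frame of the tangent space. -/
def frame (z : Eu n) : Eu n →L[ℝ] Eu n := (dSymm C.φ z).comp (diagL fun i => C.ϖ i z)

/-- The inverse of the frame. -/
def coframe (z : Eu n) : Eu n →L[ℝ] Eu n :=
  (diagL fun i => (C.ϖ i z)⁻¹).comp (dMap C.φ (C.φ.symm z))

theorem coframe_comp_frame {z : Eu n} (hz : z ∈ C.pos) :
    (C.coframe z).comp (C.frame z) = ContinuousLinearMap.id ℝ (Eu n) := by
  rw [coframe, frame, ContinuousLinearMap.comp_assoc, ← ContinuousLinearMap.comp_assoc
    (dMap C.φ (C.φ.symm z)), dMap_comp_dSymm C.mem (C.subset hz.1), ContinuousLinearMap.id_comp]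
  exact diagL_comp_diagL fun i => inv_mul_cancel₀ (C.ϖ_ne i hz)

theorem frame_comp_coframe {z : Eu n} (hz : z ∈ C.pos) :
    (C.frame z).comp (C.coframe z) = ContinuousLinearMap.id ℝ (Eu n) := by
  have h1 := dSymm_comp_dMap C.mem (C.φ.map_target (C.subset hz.1))
  rw [C.φ.right_inv (C.subset hz.1)] at h1
  rw [coframe, frame, ContinuousLinearMap.comp_assoc, ← ContinuousLinearMap.comp_assoc
    (diagL fun i => C.ϖ i z), diagL_comp_diagL fun i => mul_inv_cancel₀ (C.ϖ_ne i hz),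
    ContinuousLinearMap.id_comp, h1]

theorem det_frame_ne_zero {z : Eu n} (hz : z ∈ C.pos) : (C.frame z).det ≠ 0 := by
  have h1 : ((C.coframe z).comp (C.frame z)).det = 1 := by
    rw [C.coframe_comp_frame hz]; exact LinearMap.det_id
  intro h0
  have h2 : ((C.coframe z).comp (C.frame z)).det = (C.coframe z).det * (C.frame z).det :=
    LinearMap.det_comp _ _
  rw [h1, h0, mul_zero] at h2
  exact one_ne_zero h2

/-- The components of a tensor field in the frame. -/
def comp {m : ℕ} (u : TField n M m) (z : Eu n) : (Fin m → Fin n) → ℂ :=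
  frameComp C.ϖ (tPull u C.φ) z

theorem comp_eq_stdComp {m : ℕ} (u : TField n M m) (z : Eu n) :
    C.comp u z = stdComp (tAt u (C.φ.symm z) (C.frame z)) :=
  (stdComp_compContinuousLinearMap_diagL C.ϖ (tPull u C.φ) z).symm

theorem comp_apply {m : ℕ} (u : TField n M m) (z : Eu n) (K : Fin m → Fin n) :
    C.comp u z K = u (C.φ.symm z) fun s => dSymm C.φ z (C.ϖ (K s) z • stdVec (K s)) := rfl

theorem smoothArr_comp {m : ℕ} {u : TField n M m} (hu : u ∈ TensorSections x m) :
    SmoothArr C.pos (C.comp u) := by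
  intro K
  have h1 := smoothArr_stdComp ((contDiffOn_tPull hu C.mem).mono C.pos_subset_posTarget) K
  have h2 : ContDiffOn ℝ ∞ (fun z => ∏ s, C.ϖ (K s) z) C.pos :=
    contDiffOn_prod fun s _ => (C.smooth_ϖ (K s)).mono C.pos_subset
  exact (h2.smul h1).congr fun z _ => frameComp_eq C.ϖ (tPull u C.φ) z K

/-- The tensor field with given components in the frame. -/
def ofArr {m : ℕ} (a : Eu n → (Fin m → Fin n) → ℂ) : TField n M m := fun p =>
  ContinuousMultilinearMap.compContinuousLinearMap (M₁ := fun _ : Fin m => Eu n)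
    (M₁' := fun _ : Fin m => Eu n) (ofComp (a (C.φ p))) fun _ => C.coframe (C.φ p)

theorem comp_ofArr {m : ℕ} (a : Eu n → (Fin m → Fin n) → ℂ) {z : Eu n} (hz : z ∈ C.pos) :
    C.comp (C.ofArr a) z = a z := by
  rw [comp_eq_stdComp]
  have h1 : tAt (C.ofArr a) (C.φ.symm z) (C.frame z) = ofComp (a z) := by
    rw [← C.φ.right_inv (C.subset hz.1)]
    ext v
    simp only [tAt, ofArr, C.φ.right_inv (C.subset hz.1)]
    change ofComp (a z) (fun s => (C.coframe z).comp (C.frame z) (v s)) = _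
    rw [C.coframe_comp_frame hz]
    rfl
  rw [h1, stdComp_ofComp]

theorem eq_of_comp_eq {m : ℕ} {u w : TField n M m} {z : Eu n} (hz : z ∈ C.pos)
    (huw : C.comp u z = C.comp w z) : u (C.φ.symm z) = w (C.φ.symm z) := by
  rw [comp_eq_stdComp, comp_eq_stdComp] at huw
  have h1 := ext_stdComp fun I => congrFun huw I
  have h2 : ∀ u : TField n M m, ∀ v : Fin m → Eu n, u (C.φ.symm z) v =
      tAt u (C.φ.symm z) (C.frame z) fun s => C.coframe z (v s) := by
    intro u v
    change _ = u (C.φ.symm z) fun s => (C.frame z).comp (C.coframe z) (v s)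
    rw [C.frame_comp_coframe hz]
    rfl
  refine ContinuousMultilinearMap.ext fun v => ?_
  exact (h2 u v).trans ((congrArg (fun T : ContinuousMultilinearMap ℝ (fun _ : Fin m => Eu n) ℂ =>
    T fun s => C.coframe z (v s)) h1).trans (h2 w v).symm)

theorem eq_iff_comp_eq {m : ℕ} {u w : TField n M m} {p : M} (hp : p ∈ C.U) (hx : 0 < x p) :
    u p = w p ↔ C.comp u (C.φ p) = C.comp w (C.φ p) := by
  constructor
  · intro h1
    ext K
    rw [comp_apply, comp_apply, C.φ.left_inv hp.1, h1]
  · intro h1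
    have := C.eq_of_comp_eq (C.map_mem_pos hp hx) h1
    rwa [C.φ.left_inv hp.1] at this

theorem comp_congr {m : ℕ} {u w : TField n M m} {z : Eu n}
    (huw : u (C.φ.symm z) = w (C.φ.symm z)) : C.comp u z = C.comp w z := by
  ext K
  rw [comp_apply, comp_apply, huw]

theorem isSymArr_comp {m : ℕ} {u : TField n M m} (hu : u ∈ SymSections x m) {z : Eu n}
    (hz : z ∈ C.pos) : IsSymArr (C.comp u z) := by
  intro σ I
  exact hu.2 (C.φ.symm z) hz.2 σ fun s => dSymm C.φ z (C.ϖ (I s) z • stdVec (I s))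

theorem symm_of_isSymArr_comp {m : ℕ} {u : TField n M m} {z : Eu n}
    (hz : z ∈ C.pos) (hu : IsSymArr (C.comp u z)) (σ : Equiv.Perm (Fin m)) (v : Fin m → Eu n) :
    u (C.φ.symm z) (fun i => v (σ i)) = u (C.φ.symm z) v := by
  have h1 : C.comp (fun p => (u p).domDomCongr σ) z = C.comp u z := by
    ext I
    exact hu σ I
  have h2 := C.eq_of_comp_eq hz h1
  exact congrArg (fun T : Cov n m (C.φ.symm z) => T v) h2

theorem comp_symmetrize {m : ℕ} (u : TField n M m) (z : Eu n) :
    C.comp (fun p => symmetrize (u p)) z = symM n m *ᵥ C.comp u z := by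
  ext K
  rw [symM_mulVec, comp_apply]
  refine (symmetrize_apply _ _).trans ?_
  push_cast
  rfl

theorem comp_smul_fun {m : ℕ} (f : M → ℝ) (u : TField n M m) (z : Eu n) :
    C.comp (fun p => f p • u p) z = (f (C.φ.symm z) : ℂ) • C.comp u z := by
  ext K
  exact Complex.real_smul

/-- The bilinear form in the frame. -/
theorem gramOf_bAt_frame (G : BField n M) (z : Eu n) (i k : Fin n) :
    gramOf (bAt G (C.φ.symm z) (C.frame z)) i k =
      C.ϖ i z * C.ϖ k z * bPull G C.φ z (stdVec i) (stdVec k) := by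
  change bPull G C.φ z (diagL (fun i => C.ϖ i z) (stdVec i)) (diagL (fun i => C.ϖ i z) (stdVec k))
    = _
  rw [diagL_stdVec, diagL_stdVec]
  simp only [map_smul, _root_.smul_apply, smul_eq_mul]
  ring

/-- The Gram matrix of the scattering metric in the frame. -/
def gramH (z : Eu n) : Matrix (Fin n) (Fin n) ℝ := scGram h C.φ C.τ C.ν z

/-- The singular powers of `x` cancel: `e_i x = -τ_i x²` absorbs `x⁻⁴`, and `ϖ_i = x ν_i` absorbs
`x⁻²`. The result makes sense up to the boundary. -/
theorem gramOf_scMetric (hx : ContMDiff (J n) (modelWithCornersSelf ℝ ℝ) ∞ x) {z : Eu n}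
    (hz : z ∈ C.pos) : gramOf (bAt (scMetric x h) (C.φ.symm z) (C.frame z)) = C.gramH z := by
  ext i k
  have hX : fPull x C.φ z ≠ 0 := hz.2.ne'
  have h1 : ∀ i, C.ϖ i z * fderiv ℝ (fPull x C.φ) z (stdVec i) = -(C.τ i z * fPull x C.φ z ^ 2) :=
    fun i => C.dd_x i z hz.1
  rw [gramOf_bAt_frame, bPull_scMetric hx h C.mem (C.subset hz.1), gramH, scGram, Matrix.of_apply]
  have e1 : C.ϖ i z * C.ϖ k z * ((fPull x C.φ z ^ 4)⁻¹ * (fderiv ℝ (fPull x C.φ) z (stdVec i) *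
      fderiv ℝ (fPull x C.φ) z (stdVec k))) = C.τ i z * C.τ k z := by
    calc _ = (fPull x C.φ z ^ 4)⁻¹ * ((C.ϖ i z * fderiv ℝ (fPull x C.φ) z (stdVec i)) *
          (C.ϖ k z * fderiv ℝ (fPull x C.φ) z (stdVec k))) := by ring
      _ = _ := by rw [h1, h1]; field_simp
  have e2 : C.ϖ i z * C.ϖ k z * (fPull x C.φ z ^ 2)⁻¹ = C.ν i z * C.ν k z := by
    rw [← C.x_mul_ν i z hz.1, ← C.x_mul_ν k z hz.1]; field_simp
  rw [mul_add, e1, ← mul_assoc, e2]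

/-- `tInner` uses the standard basis of the tangent space at the point. The passage to the frame is
an invertible change of basis, under which the induced inner product is invariant. -/
theorem arrInner_comp {m : ℕ} (hx : ContMDiff (J n) (modelWithCornersSelf ℝ ℝ) ∞ x)
    (u w : TField n M m) {z : Eu n} (hz : z ∈ C.pos) :
    tInner (scMetric x h) (C.φ.symm z) (u (C.φ.symm z)) (w (C.φ.symm z)) =
      arrInner (C.gramH z)⁻¹ (C.comp u z) (C.comp w z) := by
  rw [← C.gramOf_scMetric hx hz, comp_eq_stdComp, comp_eq_stdComp]
  refine Eq.trans ?_ (arrInner_stdComp_pull (C.det_frame_ne_zero hz)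
    (scMetric x h (C.φ.symm z)) (u (C.φ.symm z)) (w (C.φ.symm z))).symm
  simp only [tInner, arrInner, dotProduct, Matrix.mulVec, Pi.star_apply, star_sum,
    Finset.mul_sum]
  refine Finset.sum_congr rfl fun a _ => Finset.sum_congr rfl fun c _ => ?_
  simp only [kpow, Matrix.of_apply, Matrix.map_apply, star_mul', star_prod, Complex.ofReal_prod,
    Complex.star_def, Complex.conj_ofReal]
  change (∏ i, (((gramOf (scMetric x h (C.φ.symm z)))⁻¹ (a i) (c i) : ℝ) : ℂ)) *
    (stdComp (u (C.φ.symm z)) a * starRingEnd ℂ (stdComp (w (C.φ.symm z)) c)) = _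
  ring

theorem smooth_gramH (hh : IsSmoothSymForm h) (i k : Fin n) :
    ContDiffOn ℝ ∞ (fun z => C.gramH z i k) C.O := by
  have hb := (((contDiffOn_bPull hh.2 C.mem).clm_apply (contDiffOn_const (c := stdVec i))).clm_apply
      (contDiffOn_const (c := stdVec k))).mono C.subset
  exact ((C.smooth_τ i).mul (C.smooth_τ k)).add (((C.smooth_ν i).mul (C.smooth_ν k)).mul hb)

theorem posDef_gramH (hS : ScSetup x h) {z : Eu n} (hz : z ∈ C.O) (h0 : 0 ≤ fPull x C.φ z) :
    (C.gramH z).PosDef := by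
  rcases h0.eq_or_lt with h0 | h0
  · obtain ⟨j, hj, -, hτj, -, -⟩ := C.bdry z hz h0.symm
    refine posDef_scGram hS C.mem (C.subset hz) h0.symm hτj (fun i hi => (hj i hi).1) fun i => ?_
    rw [C.ν_mul i z hz, ← h0, zero_mul]
  · have hz' : z ∈ C.pos := ⟨hz, h0⟩
    rw [← C.gramOf_scMetric hS.smooth hz']
    refine posDef_gramOf (fun v w => hS.isMetricOn.symm _ h0 _ _) fun v hv => ?_
    refine hS.isMetricOn.pos _ h0 _ ?_
    intro h2
    refine hv ?_
    have := congrArg (fun L : Eu n →L[ℝ] Eu n => L v) (C.coframe_comp_frame hz')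
    have h3 : C.frame z v = 0 := h2
    simp only [ContinuousLinearMap.comp_apply, h3, map_zero] at this
    exact this.symm

end FrameChart

end FrameCharts

/-! ### Connection coefficients in scattering frames, smooth up to the boundary -/

section Connections

open Matrix

variable {n : ℕ}

/-- The zeroth order coefficient of a covariant derivative. -/
def connM (m : ℕ) (s : Fin n → ℂ) (γ : Fin n → Fin n → Fin n → ℝ) :
    Matrix (Fin (m + 1) → Fin n) (Fin m → Fin n) ℂ :=
  Matrix.of fun K I => (if Fin.tail K = I then s (K 0) else 0) -
    ∑ q, ∑ l, if Function.update (Fin.tail K) q l = I then (γ (K 0) (Fin.tail K q) l : ℂ) else 0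

theorem connM_mulVec {m : ℕ} (s : Fin n → ℂ) (γ : Fin n → Fin n → Fin n → ℝ)
    (v : (Fin m → Fin n) → ℂ) (K : Fin (m + 1) → Fin n) :
    (connM m s γ *ᵥ v) K = s (K 0) * v (Fin.tail K) -
      ∑ q, ∑ l, (γ (K 0) (Fin.tail K q) l : ℂ) * v (Function.update (Fin.tail K) q l) := by
  simp only [connM, Matrix.mulVec, dotProduct, Matrix.of_apply, sub_mul, Finset.sum_sub_distrib,
    Finset.sum_mul]
  congr 1
  · simp
  · rw [Finset.sum_comm]
    refine Finset.sum_congr rfl fun q _ => ?_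
    rw [Finset.sum_comm]
    refine Finset.sum_congr rfl fun l _ => ?_
    simp

theorem sum_tensM_mulVec {m : ℕ} (a : Fin n → (Fin m → Fin n) → ℂ) (K : Fin (m + 1) → Fin n) :
    (∑ i, tensM m i *ᵥ a i) K = a (K 0) (Fin.tail K) := by
  simp [Finset.sum_apply, tensM_mulVec]

/-- Writing the Christoffel symbols through the inverse Gram matrix makes their smoothness a
consequence of Cramer's rule. -/
theorem christoffel_eq {B : Eu n → Eu n →L[ℝ] Eu n →L[ℝ] ℝ} {z : Eu n}
    (hs : ∀ v w, B z v w = B z w v) (hB : ∀ v, v ≠ 0 → 0 < B z v v) (i k l : Fin n) :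
    christoffel B z (stdVec i) (stdVec k) l =
      ∑ r, (gramOf (B z))⁻¹ l r * christoffelForm B z (stdVec i) (stdVec k) (stdVec r) := by
  set Γ := christoffel B z (stdVec i) (stdVec k) with hΓ
  have h1 : gramOf (B z) *ᵥ (fun l => Γ l) =
      fun r => christoffelForm B z (stdVec i) (stdVec k) (stdVec r) := by
    ext r
    rw [← christoffel_spec hB, ← hΓ, hs]
    conv_rhs => rw [eq_sum_stdVec Γ]
    simp only [map_sum, map_smul, smul_eq_mul, gramOf, Matrix.mulVec, dotProduct, Matrix.of_apply]
    exact Finset.sum_congr rfl fun a _ => mul_comm _ _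
  have h2 : IsUnit (gramOf (B z)).det := isUnit_iff_ne_zero.2 (posDef_gramOf hs hB).det_pos.ne'
  have h3 : (fun l => Γ l) = (gramOf (B z))⁻¹ *ᵥ
      fun r => christoffelForm B z (stdVec i) (stdVec k) (stdVec r) := by
    rw [← h1, Matrix.mulVec_mulVec, Matrix.nonsing_inv_mul _ h2, Matrix.one_mulVec]
  exact congrFun h3 l

theorem contDiffOn_det {O : Set (Eu n)} {A : Eu n → Matrix (Fin n) (Fin n) ℝ}
    (hA : ∀ i k, ContDiffOn ℝ ∞ (fun z => A z i k) O) : ContDiffOn ℝ ∞ (fun z => (A z).det) O := by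
  simp only [Matrix.det_apply']
  exact ContDiffOn.sum fun σ _ => contDiffOn_const.mul (contDiffOn_prod fun i _ => hA _ _)

theorem contDiffOn_inv {O : Set (Eu n)} {A : Eu n → Matrix (Fin n) (Fin n) ℝ}
    (hA : ∀ i k, ContDiffOn ℝ ∞ (fun z => A z i k) O) (hd : ∀ z ∈ O, (A z).det ≠ 0)
    (i k : Fin n) : ContDiffOn ℝ ∞ (fun z => (A z)⁻¹ i k) O := by
  have h1 : ContDiffOn ℝ ∞ (fun z => (A z).det⁻¹ * ((A z).updateRow k (Pi.single i 1)).det) O := by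
    refine ((contDiffOn_det hA).inv hd).mul (contDiffOn_det fun a c => ?_)
    by_cases h : a = k
    · subst h; simp only [Matrix.updateRow_self]; exact contDiffOn_const
    · simp only [Matrix.updateRow_ne h]; exact hA a c
  refine h1.congr fun z _ => ?_
  rw [Matrix.inv_def, Matrix.smul_apply, Ring.inverse_eq_inv', Matrix.adjugate_apply, smul_eq_mul]

theorem contDiffOn_christoffelForm {O : Set (Eu n)} {B : Eu n → Eu n →L[ℝ] Eu n →L[ℝ] ℝ}
    (hO : IsOpen O) (hB : ContDiffOn ℝ ∞ B O) (u v w : Eu n) :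
    ContDiffOn ℝ ∞ (fun z => christoffelForm B z u v w) O := by
  simp only [christoffelForm_apply]
  have h : ∀ u v w, ContDiffOn ℝ ∞ (fun z => fderiv ℝ B z u v w) O := fun u v w =>
    ((contDiffOn_fderiv_apply hO hB u).clm_apply contDiffOn_const).clm_apply contDiffOn_const
  exact contDiffOn_const.mul (((h _ _ _).add (h _ _ _)).sub (h _ _ _))

variable {M : Type*} [TopologicalSpace M] [ChartedSpace (Eu n) M]
  [IsManifold (J n) ∞ M] {x : M → ℝ} {h : BField n M}

theorem smul_exp_mem_tensorSections {m : ℕ} (hx : ContMDiff (J n) (modelWithCornersSelf ℝ ℝ) ∞ x)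
    {u : TField n M m} (hu : u ∈ TensorSections x m) (F : ℝ) :
    (fun q => Real.exp (F / x q) • u q) ∈ TensorSections x m := by
  intro p hp
  have h₂ : chartAt (Eu n) p ∈ IsManifold.maximalAtlas (J n) ∞ M :=
    IsManifold.chart_mem_maximalAtlas p
  have hpt := (chartAt (Eu n) p).map_source (mem_chart_source _ p)
  have h1 : ContDiffAt ℝ ∞ (fPull x (chartAt (Eu n) p)) (chartAt (Eu n) p p) :=
    (contDiffOn_fPull hx h₂).contDiffAt ((chartAt (Eu n) p).open_target.mem_nhds hpt)
  have h2 : fPull x (chartAt (Eu n) p) (chartAt (Eu n) p p) ≠ 0 := by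
    rw [fPull, (chartAt (Eu n) p).left_inv (mem_chart_source _ p)]
    exact hp.ne'
  exact ((contDiffAt_const (c := F)).div h1 h2).exp.smul (hu p hp)

namespace FrameChart

variable (C : FrameChart n x h)

/-- The functions `γ` are the connection coefficients of `G` in the frame, and are smooth up to the
boundary. -/
structure IsConn (G : BField n M) (γ : Fin n → Fin n → Fin n → Eu n → ℝ) : Prop where
  smooth : ∀ i k l, ContDiffOn ℝ ∞ (γ i k l) C.O
  spec : ∀ i k l, ∀ z ∈ C.pos, C.ϖ i z * C.ϖ k z *
    christoffel (bPull G C.φ) z (stdVec i) (stdVec k) l =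
      (γ i k l z - if k = l then C.θ i k z else 0) * C.ϖ l z

/-- The operator `e^{-F/x} ∇ e^{F/x}` in the frame. -/
def nabOp (γ : Fin n → Fin n → Fin n → Eu n → ℝ) (F : ℝ) (m : ℕ) :
    FOp n (Fin (m + 1) → Fin n) (Fin m → Fin n) where
  b i _ := tensM m i
  c z := connM m (fun i => ((F * C.τ i z : ℝ) : ℂ)) fun i k l => γ i k l z

theorem smooth_nabOp {γ : Fin n → Fin n → Fin n → Eu n → ℝ}
    (hγ : ∀ i k l, ContDiffOn ℝ ∞ (γ i k l) C.O) (F : ℝ) (m : ℕ) :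
    (C.nabOp γ F m).Smooth C.O := by
  refine ⟨fun i => SmoothMat.const _, fun K I => ?_⟩
  have h1 : ∀ (c : Prop) [Decidable c] (f : Eu n → ℂ), ContDiffOn ℝ ∞ f C.O →
      ContDiffOn ℝ ∞ (fun z => if c then f z else 0) C.O := by
    intro c _ f hf
    by_cases hc : c
    · simpa [hc] using hf
    · simpa [hc] using contDiffOn_const
  exact (h1 _ _ (contDiffOn_ofReal (contDiffOn_const.mul (C.smooth_τ _)))).sub
    (ContDiffOn.sum fun q _ => ContDiffOn.sum fun l _ => h1 _ _ (contDiffOn_ofReal (hγ _ _ _)))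

/-- The weight satisfies `e_i e^{F/x} = F τ_i e^{F/x}`, so conjugation adds the smooth covector `F
τ` to the differentiation index. The exponentials themselves cancel. -/
theorem comp_conjOp_covDeriv {m : ℕ} (hx : ContMDiff (J n) (modelWithCornersSelf ℝ ℝ) ∞ x)
    {G : BField n M} (hG : IsMetricOn x G) {γ : Fin n → Fin n → Fin n → Eu n → ℝ}
    (hγ : C.IsConn G γ) (F : ℝ) {u : TField n M m} (hu : u ∈ TensorSections x m) {z : Eu n}
    (hz : z ∈ C.pos) :
    C.comp (conjOp x F (covDeriv G) u) z = (C.nabOp γ F m).app C.ϖ (C.comp u) z := by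
  set u' : TField n M m := fun q => Real.exp (F / x q) • u q with hu'
  have hu's : u' ∈ TensorSections x m := smul_exp_mem_tensorSections hx hu F
  have hO := C.isOpen_pos hx.continuous
  have hz' := C.pos_subset_posTarget hz
  have hcu := C.smoothArr_comp hu
  have hX : DifferentiableAt ℝ (fPull x C.φ) z :=
    differentiableAt_of_contDiffOn C.φ.open_target (contDiffOn_fPull hx C.mem) hz'.1
  have hX0 : fPull x C.φ z ≠ 0 := hz.2.ne'
  have hE : ∀ K, (fun y => C.comp u' y K) = fun y =>
      Real.exp (F / fPull x C.φ y) • C.comp u y K := by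
    intro K
    ext y
    rw [show C.comp u' y = _ from C.comp_smul_fun (fun q => Real.exp (F / x q)) u y]
    rw [Pi.smul_apply, smul_eq_mul, Complex.real_smul]
  have hEd : HasFDerivAt (fun y => Real.exp (F / fPull x C.φ y))
      (Real.exp (F / fPull x C.φ z) • (-(F / fPull x C.φ z ^ 2)) • fderiv ℝ (fPull x C.φ) z) z := by
    have h1 : HasDerivAt (fun t : ℝ => F / t) (-(F / fPull x C.φ z ^ 2)) (fPull x C.φ z) := by
      have := (hasDerivAt_inv hX0).const_mul F
      simpa [div_eq_mul_inv] using this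
    exact (h1.comp_hasFDerivAt z hX.hasFDerivAt).exp
  have hdE : ∀ i, dd C.ϖ i (fun y => Real.exp (F / fPull x C.φ y)) z =
      Real.exp (F / fPull x C.φ z) * (F * C.τ i z) := by
    intro i
    have h1 : C.ϖ i z * fderiv ℝ (fPull x C.φ) z (stdVec i) = -(C.τ i z * fPull x C.φ z ^ 2) :=
      C.dd_x i z hz.1
    rw [dd, hEd.fderiv]
    simp only [_root_.smul_apply, smul_eq_mul]
    calc _ = Real.exp (F / fPull x C.φ z) * (-(F / fPull x C.φ z ^ 2)) *
          (C.ϖ i z * fderiv ℝ (fPull x C.φ) z (stdVec i)) := by ring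
      _ = _ := by rw [h1]; field_simp
  have h1 : C.comp (conjOp x F (covDeriv G) u) z =
      (Real.exp (-(F / x (C.φ.symm z))) : ℂ) • C.comp (covDeriv G u') z := by
    exact C.comp_smul_fun (fun p => Real.exp (-(F / x p))) (covDeriv G u') z
  ext K
  rw [h1, Pi.smul_apply, comp, frameComp, tPull_covDeriv hx.continuous hG hu's C.mem hz']
  have h2 := frameComp_covDerivCoord (U := tPull u' C.φ)
    (fun i => differentiableAt_of_contDiffOn C.isOpen (C.smooth_ϖ i) hz.1)
    (fun i k => C.dd_ϖ i k z hz.1) (fun i k l => hγ.spec i k l z hz)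
    (differentiableAt_of_contDiffOn (isOpen_posTarget hx.continuous C.φ)
      (contDiffOn_tPull hu's C.mem) hz') K
  rw [show (covDerivCoord (bPull G C.φ) (tPull u' C.φ) z) (fun s => C.ϖ (K s) z • stdVec (K s)) = _
    from h2]
  have h3 := dd_smul (ϖ := C.ϖ) hEd.differentiableAt (hcu.differentiableAt hO hz (Fin.tail K)) (K 0)
  rw [show (fun y => frameComp C.ϖ (tPull u' C.φ) y (Fin.tail K)) = _ from hE (Fin.tail K), h3, hdE]
  have h4 : ∀ L, frameComp C.ϖ (tPull u' C.φ) z L =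
      Real.exp (F / fPull x C.φ z) • C.comp u z L := fun L => congrFun (hE L) z
  simp only [h4]
  rw [FOp.app, Pi.add_apply]
  simp only [nabOp]
  rw [sum_tensM_mulVec, connM_mulVec]
  have h5 : (Real.exp (-(F / x (C.φ.symm z))) : ℂ) * (Real.exp (F / fPull x C.φ z) : ℂ) = 1 := by
    rw [← Complex.ofReal_mul, ← Real.exp_add, neg_add_cancel, Real.exp_zero, Complex.ofReal_one]
  simp only [Complex.real_smul, smul_eq_mul, mul_left_comm _ (Real.exp (F / fPull x C.φ z) : ℂ),
    ← Finset.mul_sum]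
  rw [Complex.ofReal_mul, mul_assoc, ← mul_add, ← mul_sub, ← mul_assoc, h5, one_mul]
  simp only [ddV]
  ring

/-- The connection coefficients of a metric which is smooth up to the boundary. -/
theorem isConn_smooth {G : BField n M} (hs : ∀ p v w, G p v w = G p w v)
    (hpos : ∀ p v, v ≠ 0 → 0 < G p v v) (hG : ContDiffOn ℝ ∞ (bPull G C.φ) C.φ.target) :
    C.IsConn G fun i k l z => C.q i k l z *
      christoffel (bPull G C.φ) z (stdVec i) (stdVec k) l + if k = l then C.θ i k z else 0 where
  smooth i k l := by
    have hs' : ∀ z v w, bPull G C.φ z v w = bPull G C.φ z w v := fun z v w => hs _ _ _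
    have hpos' : ∀ z ∈ C.O, ∀ v, v ≠ 0 → 0 < bPull G C.φ z v v := fun z hz v hv =>
      hpos _ _ (dSymm_ne_zero C.mem (C.subset hz) hv)
    have h1 : ContDiffOn ℝ ∞ (fun z => christoffel (bPull G C.φ) z (stdVec i) (stdVec k) l)
        C.O := by
      refine ContDiffOn.congr (f := fun z => ∑ r, (gramOf (bPull G C.φ z))⁻¹ l r *
        christoffelForm (bPull G C.φ) z (stdVec i) (stdVec k) (stdVec r)) ?_
        fun z hz => christoffel_eq (hs' z) (hpos' z hz) i k l
      refine ContDiffOn.sum fun r _ => (contDiffOn_inv (fun a c => ?_) (fun z hz =>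
        (posDef_gramOf (hs' z) (hpos' z hz)).det_pos.ne') l r).mul
        (contDiffOn_christoffelForm C.isOpen (hG.mono C.subset) _ _ _)
      exact ((hG.mono C.subset).clm_apply contDiffOn_const).clm_apply contDiffOn_const
    refine ((C.smooth_q i k l).mul h1).add ?_
    by_cases hc : k = l
    · simpa [hc] using C.smooth_θ i l
    · simpa [hc] using contDiffOn_const
  spec i k l z hz := by
    rw [add_sub_cancel_right, C.mul_ϖ i k l z hz.1]
    ring

/-- The Christoffel form of the scattering metric in the frame. -/
def scForm (i k r : Fin n) (z : Eu n) : ℝ :=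
  2⁻¹ * ((dd C.ϖ i (fun y => C.gramH y k r) z - (C.θ i k z + C.θ i r z) * C.gramH z k r) +
    (dd C.ϖ k (fun y => C.gramH y i r) z - (C.θ k i z + C.θ k r z) * C.gramH z i r) -
    (dd C.ϖ r (fun y => C.gramH y i k) z - (C.θ r i z + C.θ r k z) * C.gramH z i k))

theorem gramH_eq (hx : ContMDiff (J n) (modelWithCornersSelf ℝ ℝ) ∞ x) {z : Eu n}
    (hz : z ∈ C.pos) (i k : Fin n) : C.gramH z i k =
      C.ϖ i z * C.ϖ k z * bPull (scMetric x h) C.φ z (stdVec i) (stdVec k) := by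
  rw [← C.gramOf_bAt_frame, C.gramOf_scMetric hx hz]

theorem dd_gramH (hS : ScSetup x h) {z : Eu n} (hz : z ∈ C.pos) (i k r : Fin n) :
    dd C.ϖ i (fun y => C.gramH y k r) z = (C.θ i k z + C.θ i r z) * C.gramH z k r +
      C.ϖ i z * C.ϖ k z * C.ϖ r z *
        fderiv ℝ (bPull (scMetric x h) C.φ) z (stdVec i) (stdVec k) (stdVec r) := by
  have hO := C.isOpen_pos hS.smooth.continuous
  have hB := (hS.isMetricOn.smooth C.φ C.mem).mono C.pos_subset_posTarget
  have hB' : DifferentiableAt ℝ (fun y => bPull (scMetric x h) C.φ y (stdVec k) (stdVec r)) z :=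
    differentiableAt_of_contDiffOn hO
      ((hB.clm_apply contDiffOn_const).clm_apply contDiffOn_const) hz
  have hϖ := fun i => differentiableAt_of_contDiffOn C.isOpen (C.smooth_ϖ i) hz.1
  rw [dd_congr hO (fun y hy => C.gramH_eq hS.smooth hy k r) hz]
  have h1 := dd_smul (ϖ := C.ϖ) ((hϖ k).mul (hϖ r)) hB' i
  have h2 := dd_smul (ϖ := C.ϖ) (hϖ k) (hϖ r) i
  simp only [smul_eq_mul] at h1 h2
  refine h1.trans ?_
  rw [show dd C.ϖ i (C.ϖ k * C.ϖ r) z = _ from h2, C.dd_ϖ i k z hz.1, C.dd_ϖ i r z hz.1,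
    C.gramH_eq hS.smooth hz, fderiv_apply₂ (differentiableAt_of_contDiffOn hO hB hz)]
  simp only [dd, smul_eq_mul, Pi.mul_apply]
  ring

/-- Subtracting the `θ` terms removes the derivatives of the frame coefficients from those of the
Gram matrix. Thus the Koszul form of the scattering metric, singular at `x = 0` in coordinates, is
expressed in the frame by functions smooth up to the boundary. -/
theorem scForm_eq (hS : ScSetup x h) {z : Eu n} (hz : z ∈ C.pos) (i k r : Fin n) :
    C.scForm i k r z = C.ϖ i z * C.ϖ k z * C.ϖ r z *
      christoffelForm (bPull (scMetric x h) C.φ) z (stdVec i) (stdVec k) (stdVec r) := by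
  rw [scForm, C.dd_gramH hS hz, C.dd_gramH hS hz, C.dd_gramH hS hz, christoffelForm_apply]
  ring

/-- The connection coefficients of the scattering metric. -/
def scConn (i k l : Fin n) (z : Eu n) : ℝ :=
  ∑ r, (C.gramH z)⁻¹ l r * C.scForm i k r z + if k = l then C.θ i k z else 0

theorem isConn_scConn (hS : ScSetup x h) : C.IsConn (scMetric x h) C.scConn where
  smooth i k l := by
    have h1 : ∀ i k r, ContDiffOn ℝ ∞ (fun z => dd C.ϖ i (fun y => C.gramH y k r) z -
        (C.θ i k z + C.θ i r z) * C.gramH z k r) C.O := fun i k r =>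
      (contDiffOn_dd C.isOpen C.smooth_ϖ (C.smooth_gramH hS.form k r) i).sub
        (((C.smooth_θ i k).add (C.smooth_θ i r)).mul (C.smooth_gramH hS.form k r))
    have h2 : ContDiffOn ℝ ∞ (fun z => ∑ r, (C.gramH z)⁻¹ l r * C.scForm i k r z) C.O := by
      refine ContDiffOn.sum fun r _ =>
        (contDiffOn_inv (C.smooth_gramH hS.form) C.det_ne_zero l r).mul ?_
      exact contDiffOn_const.mul (((h1 i k r).add (h1 k i r)).sub (h1 r i k))
    refine h2.add ?_
    by_cases hc : k = l
    · simpa [hc] using C.smooth_θ i l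
    · simpa [hc] using contDiffOn_const
  spec i k l z hz := by
    rw [scConn, add_sub_cancel_right]
    set B := bPull (scMetric x h) C.φ with hB
    set Γ := christoffel B z (stdVec i) (stdVec k) with hΓ
    have hz' := C.pos_subset_posTarget hz
    have h1 : C.gramH z *ᵥ (fun l => C.ϖ i z * C.ϖ k z * Γ l / C.ϖ l z) =
        fun r => C.scForm i k r z := by
      ext r
      rw [C.scForm_eq hS hz, ← hB, ← christoffel_spec (fun v hv => hS.isMetricOn.bPull_pos C.mem hz' v hv),
        hS.isMetricOn.bPull_symm hz', ← hB, ← hΓ]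
      conv_rhs => rw [eq_sum_stdVec Γ]
      simp only [map_sum, map_smul, smul_eq_mul, Matrix.mulVec, dotProduct, Finset.mul_sum]
      refine Finset.sum_congr rfl fun a _ => ?_
      have := C.ϖ_ne a hz
      rw [C.gramH_eq hS.smooth hz, ← hB]
      field_simp
    have h2 : IsUnit (C.gramH z).det := isUnit_iff_ne_zero.2 (C.det_ne_zero z hz.1)
    have h3 : (fun l => C.ϖ i z * C.ϖ k z * Γ l / C.ϖ l z) = (C.gramH z)⁻¹ *ᵥ
        fun r => C.scForm i k r z := by
      rw [← h1, Matrix.mulVec_mulVec, Matrix.nonsing_inv_mul _ h2, Matrix.one_mulVec]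
    have h4 : C.ϖ i z * C.ϖ k z * Γ l / C.ϖ l z = ∑ r, (C.gramH z)⁻¹ l r * C.scForm i k r z :=
      congrFun h3 l
    rw [← h4, div_mul_cancel₀ _ (C.ϖ_ne l hz)]

end FrameChart

end Connections

/-! ### Existence of scattering frames near every point of `{x ≥ 0}` -/

section Existence

open Matrix

variable {n : ℕ}

/-- The map that replaces the `j`-th coordinate by the function `X`. -/
def straighten (X : Eu n → ℝ) (j : Fin n) (z : Eu n) : Eu n := z + (X z - z j) • stdVec j

theorem straighten_apply (X : Eu n → ℝ) (j : Fin n) (z : Eu n) : straighten X j z j = X z := by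
  simp [straighten, stdVec]

theorem contDiffAt_straighten {X : Eu n → ℝ} {j : Fin n} {z : Eu n} (hX : ContDiffAt ℝ ∞ X z) :
    ContDiffAt ℝ ∞ (straighten X j) z :=
  contDiffAt_id.add ((hX.sub (EuclideanSpace.proj j : Eu n →L[ℝ] ℝ).contDiff.contDiffAt).smul
    contDiffAt_const)

theorem exists_hasFDerivAt_straighten {X : Eu n → ℝ} {j : Fin n} {z : Eu n}
    (hX : DifferentiableAt ℝ X z) (hj : fderiv ℝ X z (stdVec j) ≠ 0) :
    ∃ L : Eu n ≃L[ℝ] Eu n, HasFDerivAt (straighten X j) (L : Eu n →L[ℝ] Eu n) z := by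
  set L : Eu n →L[ℝ] Eu n := ContinuousLinearMap.id ℝ (Eu n) +
    (fderiv ℝ X z - (EuclideanSpace.proj j : Eu n →L[ℝ] ℝ)).smulRight (stdVec j) with hL
  have h1 : HasFDerivAt (straighten X j) L z :=
    (hasFDerivAt_id z).add ((hX.hasFDerivAt.sub
      (EuclideanSpace.proj j : Eu n →L[ℝ] ℝ).hasFDerivAt).smul_const (stdVec j))
  have hinj : Function.Injective (L : Eu n →ₗ[ℝ] Eu n) := by
    rw [← LinearMap.ker_eq_bot, LinearMap.ker_eq_bot']
    intro v hv
    have hv' : v + (fderiv ℝ X z v - v j) • (stdVec j : Eu n) = 0 := hv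
    have h2 : ∀ i, i ≠ j → v i = 0 := fun i hi => by
      have := congrArg (fun w : Eu n => w i) hv'
      simpa [stdVec, hi] using this
    have h3 : v = v j • stdVec j := by
      ext i
      by_cases hi : i = j
      · subst hi; simp [stdVec]
      · simp [stdVec, hi, h2 i hi]
    have h4 : fderiv ℝ X z v = 0 := by
      have := congrArg (fun w : Eu n => w j) hv'
      simpa [stdVec] using this
    rw [h3, map_smul, smul_eq_mul] at h4
    rw [h3, (mul_eq_zero.1 h4).resolve_right hj, zero_smul]
  exact ⟨(LinearEquiv.ofInjectiveEndo (L : Eu n →ₗ[ℝ] Eu n) hinj).toContinuousLinearEquiv, h1⟩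

variable {M : Type*} [TopologicalSpace M] [ChartedSpace (Eu n) M]
  [IsManifold (J n) ∞ M] {x : M → ℝ} {h : BField n M}

/-- Near a boundary point there is a chart in which `x` is a coordinate. -/
theorem exists_straightened_chart (hx : ContMDiff (J n) (modelWithCornersSelf ℝ ℝ) ∞ x) {p : M}
    (hp : dFun (n := n) x p ≠ 0) :
    ∃ φ ∈ IsManifold.maximalAtlas (J n) ∞ M, p ∈ φ.source ∧
      ∃ j : Fin n, ∀ z ∈ φ.target, fPull x φ z = z j := by
  set φ₀ := chartAt (Eu n) p with hφ₀
  have h₀ : φ₀ ∈ IsManifold.maximalAtlas (J n) ∞ M := IsManifold.chart_mem_maximalAtlas p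
  have hps := mem_chart_source (Eu n) p
  set z₀ := φ₀ p with hz₀
  have hz₀t : z₀ ∈ φ₀.target := φ₀.map_source hps
  set X := fPull x φ₀ with hX
  have hXs : ContDiffOn ℝ ∞ X φ₀.target := contDiffOn_fPull hx h₀
  have hXa : ∀ z ∈ φ₀.target, ContDiffAt ℝ ∞ X z := fun z hz =>
    hXs.contDiffAt (φ₀.open_target.mem_nhds hz)
  obtain ⟨j, hj⟩ : ∃ j, fderiv ℝ X z₀ (stdVec j) ≠ 0 := by
    by_contra! hc
    refine hp (ContinuousLinearMap.ext fun v => ?_)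
    have h1 : fderiv ℝ X z₀ (dMap φ₀ p v) = 0 := by
      rw [eq_sum_stdVec (dMap φ₀ p v)]
      simp [hc]
    rw [fderiv_fPull hx h₀ hz₀t] at h1
    have h2 : dSymm φ₀ z₀ (dMap φ₀ p v) = v :=
      congrArg (fun L : Eu n →L[ℝ] Eu n => L v) (dSymm_comp_dMap h₀ hps)
    rw [h2, φ₀.left_inv hps] at h1
    exact h1
  obtain ⟨L₀, hL₀⟩ := exists_hasFDerivAt_straighten ((hXa z₀ hz₀t).differentiableAt (by simp)) hj
  set Ψ₀ := (contDiffAt_straighten (j := j) (hXa z₀ hz₀t)).toOpenPartialHomeomorph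
    (straighten X j) hL₀ (by simp) with hΨ₀
  -- The inverse function theorem yields a smooth inverse only near the base point. On `W` the
  -- differential of the straightening map is invertible everywhere, so the restricted inverse is
  -- smooth on all of its domain.
  set W : Set (Eu n) := φ₀.target ∩ {z | fderiv ℝ X z (stdVec j) ≠ 0} with hW
  have hWo : IsOpen W :=
    (contDiffOn_fderiv_apply φ₀.open_target hXs (stdVec j)).continuousOn.isOpen_inter_preimage
      φ₀.open_target isOpen_ne
  set Ψ := Ψ₀.restrOpen W hWo with hΨ
  have hΨc : ∀ z, Ψ z = straighten X j z := fun z => rfl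
  have hΨs : Ψ.source = Ψ₀.source ∩ W := rfl
  have hΨsW : ∀ z ∈ Ψ.source, z ∈ W := fun z hz => hz.2
  have hsm : ContDiffOn ℝ ∞ Ψ Ψ.source := fun z hz =>
    (contDiffAt_straighten (hXa z (hΨsW z hz).1)).contDiffWithinAt
  have hsm' : ContDiffOn ℝ ∞ Ψ.symm Ψ.target := fun z hz => by
    have h1 := hΨsW _ (Ψ.map_target hz)
    obtain ⟨L, hL⟩ := exists_hasFDerivAt_straighten ((hXa _ h1.1).differentiableAt (by simp)) h1.2
    exact (Ψ.contDiffAt_symm hz hL (contDiffAt_straighten (hXa _ h1.1))).contDiffWithinAt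
  refine ⟨φ₀.trans Ψ, ?_, ?_, j, ?_⟩
  · refine OpenPartialHomeomorph.mem_maximalAtlas_of_contMDiffOn _ ?_ ?_
    · exact (contMDiffOn_iff_contDiffOn.2 hsm).comp
        ((contMDiffOn_of_mem_maximalAtlas h₀).mono fun q hq => hq.1) fun q hq => hq.2
    · exact (contMDiffOn_symm_of_mem_maximalAtlas h₀).comp
        ((contMDiffOn_iff_contDiffOn.2 hsm').mono fun q hq => hq.1) fun q hq => hq.2
  · exact ⟨hps, ContDiffAt.mem_toOpenPartialHomeomorph_source _ hL₀ (by simp), hz₀t, hj⟩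
  · intro z hz
    have h1 : Ψ (Ψ.symm z) = z := Ψ.right_inv hz.1
    rw [hΨc] at h1
    change X (Ψ.symm z) = z j
    rw [← straighten_apply X j, h1]

namespace FrameChart

/-- The coordinate frame over the part of a chart where `x > 0`. -/
def interior (hS : ScSetup x h) (p : M) : FrameChart n x h where
  φ := chartAt (Eu n) p
  O := posTarget x (chartAt (Eu n) p)
  ϖ _ _ := 1
  ν _ z := (fPull x (chartAt (Eu n) p) z)⁻¹
  b i z := fderiv ℝ (fPull x (chartAt (Eu n) p)) z (stdVec i) / fPull x (chartAt (Eu n) p) z ^ 2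
  τ i z := -(fderiv ℝ (fPull x (chartAt (Eu n) p)) z (stdVec i) / fPull x (chartAt (Eu n) p) z ^ 2)
  θ _ _ _ := 0
  q _ _ _ _ := 1
  mem := IsManifold.chart_mem_maximalAtlas p
  isOpen := isOpen_posTarget hS.smooth.continuous _
  subset := Set.inter_subset_left
  smooth_ϖ _ := contDiffOn_const
  smooth_ν _ := ((contDiffOn_fPull hS.smooth (IsManifold.chart_mem_maximalAtlas p)).mono
    Set.inter_subset_left).inv fun _ hz => ne_of_gt hz.2
  smooth_b i := ((contDiffOn_fderiv_apply (chartAt (Eu n) p).open_target (contDiffOn_fPull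
    hS.smooth (IsManifold.chart_mem_maximalAtlas p)) _).mono Set.inter_subset_left).div
    (((contDiffOn_fPull hS.smooth (IsManifold.chart_mem_maximalAtlas p)).mono
      Set.inter_subset_left).pow 2) fun _ hz => pow_ne_zero _ (ne_of_gt hz.2)
  smooth_τ i := (((contDiffOn_fderiv_apply (chartAt (Eu n) p).open_target (contDiffOn_fPull
    hS.smooth (IsManifold.chart_mem_maximalAtlas p)) _).mono Set.inter_subset_left).div
    (((contDiffOn_fPull hS.smooth (IsManifold.chart_mem_maximalAtlas p)).mono
      Set.inter_subset_left).pow 2) fun _ hz => pow_ne_zero _ (ne_of_gt hz.2)).neg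
  smooth_θ _ _ := contDiffOn_const
  smooth_q _ _ _ := contDiffOn_const
  dd_ϖ i k z _ := by simp [dd]
  mul_ϖ i k l z _ := by simp
  dd_x i z hz := by
    have : fPull x (chartAt (Eu n) p) z ≠ 0 := ne_of_gt hz.2
    simp only [dd, one_smul]
    field_simp
  x_mul_ν i z hz := mul_inv_cancel₀ (ne_of_gt hz.2)
  ν_mul i z hz := by
    have : fPull x (chartAt (Eu n) p) z ≠ 0 := ne_of_gt hz.2
    field_simp
  ϖ_ne_zero _ _ _ _ := one_ne_zero
  bdry z hz h0 := absurd h0 (ne_of_gt hz.2)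
  det_ne_zero z hz := by
    have h₀ : chartAt (Eu n) p ∈ IsManifold.maximalAtlas (J n) ∞ M :=
      IsManifold.chart_mem_maximalAtlas p
    refine ne_of_eq_of_ne (congrArg Matrix.det ?_) (posDef_gramOf
      (fun v w => hS.isMetricOn.bPull_symm hz v w)
      (fun v hv => hS.isMetricOn.bPull_pos h₀ hz v hv)).det_pos.ne'
    ext i k
    rw [gramOf, Matrix.of_apply, bPull_scMetric hS.smooth h h₀ hz.1, scGram, Matrix.of_apply]
    have : fPull x (chartAt (Eu n) p) z ≠ 0 := ne_of_gt hz.2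
    field_simp

theorem mem_interior_U (hS : ScSetup x h) {p : M} (hp : 0 < x p) : p ∈ (interior hS p).U := by
  refine ⟨mem_chart_source _ p, (chartAt (Eu n) p).map_source (mem_chart_source _ p), ?_⟩
  change 0 < x ((chartAt (Eu n) p).symm (chartAt (Eu n) p p))
  rwa [(chartAt (Eu n) p).left_inv (mem_chart_source _ p)]

theorem exists_mem_U_of_eq_zero (hS : ScSetup x h) {p : M} (hp : x p = 0) :
    ∃ C : FrameChart n x h, p ∈ C.U := by
  obtain ⟨φ, hφ, hps, j, hj⟩ := exists_straightened_chart hS.smooth (hS.dx p hp)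
  -- The order of vanishing of the frame field: `x²∂_x` in the normal direction `j`, and `x∂_y` in
  -- the others.
  let e : Fin n → ℕ := fun i => if i = j then 2 else 1
  have he : ∀ i, e i = 1 + if i = j then 1 else 0 := fun i => by
    by_cases hi : i = j <;> simp [e, hi]
  let ϖ : Fin n → Eu n → ℝ := fun i z => z j ^ e i
  let ν : Fin n → Eu n → ℝ := fun i z => z j ^ (e i - 1)
  let τ : Fin n → Eu n → ℝ := fun i _ => if i = j then -1 else 0
  have hc : ContDiff ℝ ∞ (fun z : Eu n => z j) := (EuclideanSpace.proj j : Eu n →L[ℝ] ℝ).contDiff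
  have hdz : ∀ i, ∀ z ∈ φ.target, fderiv ℝ (fPull x φ) z (stdVec i) = if i = j then 1 else 0 := by
    intro i z hz
    have h1 : fPull x φ =ᶠ[nhds z] fun y => y j :=
      Filter.eventually_of_mem (φ.open_target.mem_nhds hz) hj
    have h2 : HasFDerivAt (fun y : Eu n => y j) (EuclideanSpace.proj j : Eu n →L[ℝ] ℝ) z :=
      (EuclideanSpace.proj j : Eu n →L[ℝ] ℝ).hasFDerivAt
    rw [h1.fderiv_eq, h2.fderiv]
    simp [stdVec, eq_comm]
  have hg : ∀ i k, ContDiffOn ℝ ∞ (fun z => scGram h φ τ ν z i k) φ.target := by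
    intro i k
    have hb := ((contDiffOn_bPull hS.form.2 hφ).clm_apply (contDiffOn_const (c := stdVec i))).clm_apply
      (contDiffOn_const (c := stdVec k))
    exact (contDiffOn_const (c := (if i = j then (-1 : ℝ) else 0) * if k = j then -1 else 0)).add
      (((hc.pow (e i - 1)).mul (hc.pow (e k - 1))).contDiffOn.mul hb)
  have hzp : (φ p) j = 0 := by
    rw [← hj _ (φ.map_source hps), fPull, φ.left_inv hps, hp]
  refine ⟨{
    φ := φ
    -- The Gram matrix is positive definite at `p`, as checked in the last goal, so this open set is
    -- a neighbourhood of `φ p`.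
    O := φ.target ∩ {z | (scGram h φ τ ν z).det ≠ 0}
    ϖ := ϖ
    ν := ν
    b := fun i _ => if i = j then 1 else 0
    τ := τ
    θ := fun i k z => if i = j then e k * z j else 0
    -- The natural subtraction is never truncated, because `e i + e k ≥ 2 ≥ e l`. The exponent is
    -- zero exactly when `i, k ≠ j` and `l = j`.
    q := fun i k l z => z j ^ (e i + e k - e l)
    mem := hφ
    isOpen := (contDiffOn_det hg).continuousOn.isOpen_inter_preimage φ.open_target isOpen_ne
    subset := Set.inter_subset_left
    smooth_ϖ := fun i => (hc.pow _).contDiffOn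
    smooth_ν := fun i => (hc.pow _).contDiffOn
    smooth_b := fun i => contDiffOn_const
    smooth_τ := fun i => contDiffOn_const
    smooth_θ := fun i k => by
      by_cases hi : i = j
      · simpa [hi] using (contDiff_const.mul hc).contDiffOn
      · simpa [hi] using contDiffOn_const
    smooth_q := fun i k l => (hc.pow _).contDiffOn
    dd_ϖ := fun i k z hz => ?_
    mul_ϖ := fun i k l z hz => ?_
    dd_x := fun i z hz => ?_
    x_mul_ν := fun i z hz => ?_
    ν_mul := fun i z hz => ?_
    ϖ_ne_zero := fun i z hz h0 => ?_
    bdry := fun z hz h0 => ?_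
    det_ne_zero := fun z hz => hz.2 }, hps, φ.map_source hps, ?_⟩
  · have h2 : HasFDerivAt (fun y : Eu n => y j) (EuclideanSpace.proj j : Eu n →L[ℝ] ℝ) z :=
      (EuclideanSpace.proj j : Eu n →L[ℝ] ℝ).hasFDerivAt
    have h3 : HasFDerivAt (ϖ k) _ z := h2.pow (e k)
    rw [dd, h3.fderiv]
    by_cases hi : i = j
    · subst hi
      by_cases hk : k = i <;> simp [ϖ, e, stdVec, hk] <;> ring
    · simp [stdVec, hi, Ne.symm hi]
  · simp only [ϖ, ← pow_add]
    congr 1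
    have := he i; have := he k; have := he l
    split_ifs at * <;> omega
  · rw [dd, hdz i z hz.1, hj z hz.1]
    by_cases hi : i = j <;> simp [ϖ, τ, e, hi]
  · rw [hj z hz.1]
    by_cases hi : i = j <;> simp [ϖ, ν, e, hi, sq]
  · rw [hdz i z hz.1, hj z hz.1]
    by_cases hi : i = j <;> simp [ν, e, hi]
  · rw [hj z hz.1] at h0
    exact pow_ne_zero _ h0
  · rw [hj z hz.1] at h0
    refine ⟨j, fun i hi => ⟨by simp [ν, e, hi], by simp [τ, hi], by simp [hi]⟩, by simp [ν, e, h0],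
      by simp [τ], by simp, fun i k => by simp [h0], fun i k l hq => ?_⟩
    rw [h0] at hq
    have h1 : e i + e k - e l = 0 := by
      by_contra hne
      exact hq (zero_pow hne)
    rw [he, he, he] at h1
    split_ifs at h1 <;> omega
  · refine (posDef_scGram hS hφ (φ.map_source hps) ?_ (j := j) (by simp [τ])
      (fun i hi => by simp [ν, e, hi]) fun i => ?_).det_pos.ne'
    · rw [fPull, φ.left_inv hps, hp]
    · rw [hdz i _ (φ.map_source hps)]
      by_cases hi : i = j <;> simp [ν, e, hi, hzp]

theorem exists_mem_U (hS : ScSetup x h) {p : M} (hp : 0 ≤ x p) :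
    ∃ C : FrameChart n x h, p ∈ C.U := by
  rcases hp.eq_or_lt with hp | hp
  · exact exists_mem_U_of_eq_zero hS hp.symm
  · exact ⟨interior hS p, mem_interior_U hS hp⟩

/-- A tensor field whose components in the frames are smooth is smooth. -/
theorem mem_tensorSections_of_comp {m : ℕ} (hS : ScSetup x h) {u : TField n M m}
    (hu : ∀ C : FrameChart n x h, SmoothArr C.pos (C.comp u)) : u ∈ TensorSections x m := by
  intro p hp
  set C := interior hS p with hC
  have h1 := C.map_mem_pos (mem_interior_U hS hp) hp
  have h2 : ContDiffOn ℝ ∞ (tPull u C.φ) C.pos := by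
    refine contDiffOn_of_stdComp fun I => ((hu C) I).congr fun z _ => ?_
    rw [comp, frameComp_eq]
    simp [hC, interior, stdComp]
  exact h2.contDiffAt ((C.isOpen_pos hS.smooth.continuous).mem_nhds h1)

theorem mem_symSections_of_comp {m : ℕ} (hS : ScSetup x h) {u : TField n M m}
    (hu : ∀ C : FrameChart n x h, SmoothArr C.pos (C.comp u))
    (hs : ∀ C : FrameChart n x h, ∀ z ∈ C.pos, IsSymArr (C.comp u z)) : u ∈ SymSections x m := by
  refine ⟨mem_tensorSections_of_comp hS hu, fun p hp σ v => ?_⟩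
  set C := interior hS p with hC
  have hpU := mem_interior_U hS hp
  have h1 := C.map_mem_pos hpU hp
  have h2 := C.symm_of_isSymArr_comp h1 (hs C _ h1) σ
  rw [C.φ.left_inv hpU.1] at h2
  exact h2 v

end FrameChart

end Existence

/-! ### The `L²` pairing in charts, its invariance, and the divergences of the frame -/

section Pairing

open Matrix MeasureTheory

variable {n : ℕ} {M : Type*} [TopologicalSpace M] [ChartedSpace (Eu n) M]

/-- The integrand of the pairing of tensor fields in a chart. -/
def dens (G : BField n M) (φ : OpenPartialHomeomorph M (Eu n)) {m : ℕ} (S T : TField n M m)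
    (z : Eu n) : ℂ :=
  (Real.sqrt (gramOf (bPull G φ z)).det : ℂ) *
    tInner G (φ.symm z) (S (φ.symm z)) (T (φ.symm z))

/-- The pairing of tensor fields over a part of the domain of a chart. -/
def pairOn (G : BField n M) (φ : OpenPartialHomeomorph M (Eu n)) (W : Set M) {m : ℕ}
    (S T : TField n M m) : ℂ :=
  ∫ z in φ.target ∩ φ.symm ⁻¹' W, dens G φ S T z

theorem chartPairing_eq (G : BField n M) (p : M) {m : ℕ} (S T : TField n M m) :
    chartPairing G p S T = pairOn G (chartAt (Eu n) p) Set.univ S T := by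
  have : (extChartAt (J n) p).target = (chartAt (Eu n) p).target ∩
      (chartAt (Eu n) p).symm ⁻¹' Set.univ := by
    simp [extChartAt]
  rw [chartPairing, this]
  rfl

theorem tInner_zero_left (G : BField n M) (p : M) {m : ℕ} (T : Cov n m p) :
    tInner G p 0 T = 0 := by
  refine Finset.sum_eq_zero fun a _ => Finset.sum_eq_zero fun b _ => ?_
  exact mul_eq_zero_of_right _ (zero_mul _)

theorem dens_eq_zero (G : BField n M) (φ : OpenPartialHomeomorph M (Eu n)) {m : ℕ}
    {S : TField n M m} (T : TField n M m) {z : Eu n} (hz : S (φ.symm z) = 0) :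
    dens G φ S T z = 0 := by
  rw [dens, hz, tInner_zero_left, mul_zero]

theorem pairOn_eq_of_subset (G : BField n M) (φ : OpenPartialHomeomorph M (Eu n)) {W W' K : Set M}
    (hW' : IsOpen W') (hKW : K ⊆ W) (hWW' : W ⊆ W') {m : ℕ}
    {S : TField n M m} (T : TField n M m) (hS : ∀ p, p ∉ K → S p = 0) :
    pairOn G φ W' S T = pairOn G φ W S T := by
  refine setIntegral_eq_of_subset_of_forall_sdiff_eq_zero
    (φ.symm.isOpen_inter_preimage hW').measurableSet ?_ ?_
  · exact fun z hz => ⟨hz.1, hWW' hz.2⟩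
  · exact fun z hz => dens_eq_zero G φ T (hS _ fun hK => hz.2 ⟨hz.1.1, hKW hK⟩)

variable [IsManifold (J n) ∞ M]

/-- The pairing does not depend on the chart. -/
theorem pairOn_eq (G : BField n M) {φ₁ φ₂ : OpenPartialHomeomorph M (Eu n)}
    (h₁ : φ₁ ∈ IsManifold.maximalAtlas (J n) ∞ M) (h₂ : φ₂ ∈ IsManifold.maximalAtlas (J n) ∞ M)
    {W : Set M} (hW : IsOpen W) (hW₁ : W ⊆ φ₁.source) (hW₂ : W ⊆ φ₂.source) {m : ℕ}
    (S T : TField n M m) : pairOn G φ₁ W S T = pairOn G φ₂ W S T := by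
  set s := φ₁.target ∩ φ₁.symm ⁻¹' W with hs
  have hsub : ∀ z ∈ s, z ∈ (φ₁.symm.trans φ₂).source := fun z hz => ⟨hz.1, hW₂ hz.2⟩
  have himg : (φ₂ ∘ φ₁.symm) '' s = φ₂.target ∩ φ₂.symm ⁻¹' W := by
    ext y
    constructor
    · rintro ⟨z, hz, rfl⟩
      refine ⟨φ₂.map_source (hW₂ hz.2), ?_⟩
      change φ₂.symm (φ₂ (φ₁.symm z)) ∈ W
      rw [φ₂.left_inv (hW₂ hz.2)]
      exact hz.2
    · rintro ⟨hy, hyW⟩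
      have hyW' : φ₂.symm y ∈ W := hyW
      refine ⟨φ₁ (φ₂.symm y), ⟨φ₁.map_source (hW₁ hyW'), ?_⟩, ?_⟩
      · change φ₁.symm (φ₁ (φ₂.symm y)) ∈ W
        rwa [φ₁.left_inv (hW₁ hyW')]
      · change φ₂ (φ₁.symm (φ₁ (φ₂.symm y))) = y
        rw [φ₁.left_inv (hW₁ hyW'), φ₂.right_inv hy]
  have hinj : Set.InjOn (φ₂ ∘ φ₁.symm) s := fun a ha c hc hac => by
    have h1 : φ₁.symm a = φ₁.symm c := φ₂.injOn (hW₂ ha.2) (hW₂ hc.2) hac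
    exact φ₁.symm.injOn ha.1 hc.1 h1
  have hd : ∀ z ∈ s, HasFDerivWithinAt (φ₂ ∘ φ₁.symm) (fderiv ℝ (φ₂ ∘ φ₁.symm) z) s z := fun z hz =>
    (differentiableAt_of_contDiffOn (φ₁.symm.trans φ₂).open_source (contDiffOn_transition h₁ h₂)
      (hsub z hz)).hasFDerivAt.hasFDerivWithinAt
  have hms : MeasurableSet s := (φ₁.symm.isOpen_inter_preimage hW).measurableSet
  have key := integral_image_eq_integral_abs_det_fderiv_smul volume hms hd hinj
    (fun y => dens G φ₂ S T y)
  rw [himg] at key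
  rw [pairOn, pairOn, key]
  refine setIntegral_congr_fun hms fun z hz => ?_
  have h3 : φ₂.symm ((φ₂ ∘ φ₁.symm) z) = φ₁.symm z := φ₂.left_inv (hW₂ hz.2)
  -- The Jacobian enters the Gram determinant squared. Its absolute value, after the square root, is
  -- the factor in the change of variables formula.
  have h4 : (gramOf (bPull G φ₁ z)).det = (fderiv ℝ (φ₂ ∘ φ₁.symm) z).det ^ 2 *
      (gramOf (bPull G φ₂ ((φ₂ ∘ φ₁.symm) z))).det := by
    rw [bPull_transition G h₁ h₂ (hsub z hz), gramOf_pullB, Matrix.det_mul, Matrix.det_mul,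
      Matrix.det_transpose, det_matOf]
    simp only [Function.comp_apply]
    ring
  simp only [dens]
  rw [h4, Real.sqrt_mul (sq_nonneg _), Real.sqrt_sq_eq_abs, h3, Complex.real_smul]
  push_cast
  ring

theorem contDiffAt_tPull_of_tPull {m : ℕ} {u : TField n M m}
    {φ φ₂ : OpenPartialHomeomorph M (Eu n)} (h : φ ∈ IsManifold.maximalAtlas (J n) ∞ M)
    (h₂ : φ₂ ∈ IsManifold.maximalAtlas (J n) ∞ M) {p : M} (hp : p ∈ φ.source) (hp₂ : p ∈ φ₂.source)
    (hu : ContDiffAt ℝ ∞ (tPull u φ₂) (φ₂ p)) : ContDiffAt ℝ ∞ (tPull u φ) (φ p) := by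
  have hz' : φ p ∈ (φ.symm.trans φ₂).source := by
    refine ⟨φ.map_source hp, ?_⟩
    change φ.symm (φ p) ∈ φ₂.source
    rwa [φ.left_inv hp]
  have ho := (φ.symm.trans φ₂).open_source
  have hτ : ContDiffAt ℝ ∞ (φ₂ ∘ φ.symm) (φ p) :=
    (contDiffOn_transition h h₂).contDiffAt (ho.mem_nhds hz')
  have h1 : ContDiffAt ℝ ∞ (tPull u φ₂) ((φ₂ ∘ φ.symm) (φ p)) := by
    rwa [Function.comp_apply, φ.left_inv hp]
  have h3 : tPull u φ =ᶠ[nhds (φ p)] fun y => (tPull u φ₂ (φ₂ (φ.symm y))).compContinuousLinearMap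
      fun _ => fderiv ℝ (φ₂ ∘ φ.symm) y :=
    Filter.eventually_of_mem (ho.mem_nhds hz') fun y hy => tPull_transition u h h₂ hy
  refine ContDiffAt.congr_of_eventuallyEq ?_ h3
  exact ContDiffAt.tensor_pull (h1.comp (φ p) hτ) (hτ.fderiv_right (m := ∞) (by simp))

variable {x : M → ℝ} {h : BField n M}

namespace FrameChart

variable (C : FrameChart n x h)

/-- The part of the domain of the frame in the manifold where `x > 0`. -/
def posU : Set M := C.U ∩ {p | 0 < x p}

theorem isOpen_posU (hx : Continuous x) : IsOpen C.posU :=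
  C.isOpen_U.inter (isOpen_lt continuous_const hx)

theorem posU_subset : C.posU ⊆ C.φ.source := fun _ hp => hp.1.1

theorem target_inter_preimage_posU : C.φ.target ∩ C.φ.symm ⁻¹' C.posU = C.pos := by
  ext z
  constructor
  · rintro ⟨hz, ⟨-, h1⟩, h2⟩
    rw [Set.mem_preimage, C.φ.right_inv hz] at h1
    exact ⟨h1, h2⟩
  · exact fun hz => ⟨C.subset hz.1, C.symm_mem hz.1, hz.2⟩

/-- The Riemannian density in the chart. -/
def vol (z : Eu n) : ℝ := Real.sqrt (gramOf (bPull (scMetric x h) C.φ z)).det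

theorem dens_eq (hx : ContMDiff (J n) (modelWithCornersSelf ℝ ℝ) ∞ x) {m : ℕ}
    (S T : TField n M m) {z : Eu n} (hz : z ∈ C.pos) : dens (scMetric x h) C.φ S T z =
      (C.vol z : ℂ) * (C.comp S z ⬝ᵥ star (kpow m (cplx (C.gramH z)⁻¹) *ᵥ C.comp T z)) := by
  rw [dens, C.arrInner_comp hx S T hz]
  rfl

theorem pairOn_posU (hx : ContMDiff (J n) (modelWithCornersSelf ℝ ℝ) ∞ x) {m : ℕ}
    (S T : TField n M m) : pairOn (scMetric x h) C.φ C.posU S T = ∫ z in C.pos, (C.vol z : ℂ) *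
      (C.comp S z ⬝ᵥ star (kpow m (cplx (C.gramH z)⁻¹) *ᵥ C.comp T z)) := by
  rw [pairOn, target_inter_preimage_posU]
  exact setIntegral_congr_fun (C.isOpen_pos hx.continuous).measurableSet
    fun z hz => C.dens_eq hx S T hz

theorem det_gram_pos (hS : ScSetup x h) {z : Eu n} (hz : z ∈ C.pos) :
    0 < (gramOf (bPull (scMetric x h) C.φ z)).det := by
  have hz' := C.pos_subset_posTarget hz
  exact (posDef_gramOf (fun v w => hS.isMetricOn.bPull_symm hz' v w)
    fun v hv => hS.isMetricOn.bPull_pos C.mem hz' v hv).det_pos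

theorem vol_pos (hS : ScSetup x h) {z : Eu n} (hz : z ∈ C.pos) : 0 < C.vol z :=
  Real.sqrt_pos.2 (C.det_gram_pos hS hz)

theorem smooth_vol (hS : ScSetup x h) : ContDiffOn ℝ ∞ C.vol C.pos := by
  have hB := (hS.isMetricOn.smooth C.φ C.mem).mono C.pos_subset_posTarget
  refine ContDiffOn.sqrt (contDiffOn_det fun i k => ?_) fun z hz => (C.det_gram_pos hS hz).ne'
  exact (hB.clm_apply contDiffOn_const).clm_apply contDiffOn_const

theorem det_gramH_eq (hS : ScSetup x h) {z : Eu n} (hz : z ∈ C.pos) :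
    (C.gramH z).det = ((∏ k, C.ϖ k z) * C.vol z) ^ 2 := by
  have h1 : C.gramH z = Matrix.diagonal (fun k => C.ϖ k z) *
      gramOf (bPull (scMetric x h) C.φ z) * Matrix.diagonal (fun k => C.ϖ k z) := by
    ext i k
    rw [C.gramH_eq hS.smooth hz, Matrix.mul_diagonal, Matrix.diagonal_mul]
    simp only [gramOf, Matrix.of_apply]
    ring
  rw [h1, Matrix.det_mul, Matrix.det_mul, Matrix.det_diagonal, mul_pow, vol,
    Real.sq_sqrt (C.det_gram_pos hS hz).le]
  ring

/-- The divergence of the frame with respect to the Riemannian density. -/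
def kap (i : Fin n) (z : Eu n) : ℝ :=
  2⁻¹ * (dd C.ϖ i (fun y => (C.gramH y).det) z / (C.gramH z).det) + C.θ i i z - ∑ k, C.θ i k z

theorem smooth_kap (hh : IsSmoothSymForm h) (i : Fin n) : ContDiffOn ℝ ∞ (C.kap i) C.O := by
  have h1 := contDiffOn_det (C.smooth_gramH hh)
  exact ((contDiffOn_const.mul ((contDiffOn_dd C.isOpen C.smooth_ϖ h1 i).div h1
    C.det_ne_zero)).add (C.smooth_θ i i)).sub (ContDiffOn.sum fun k _ => C.smooth_θ i k)

/-- Logarithmic differentiation of `det gramH = ((∏ ϖ) * vol)²` expresses the derivative of the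
density through `det gramH` and `θ`, and `∂_i ϖ_i = θ_ii`. No division by `ϖ` occurs in `kap`, which
is therefore smooth up to the boundary although the density is not. -/
theorem fderiv_vol (hS : ScSetup x h) (i : Fin n) {z : Eu n} (hz : z ∈ C.pos) :
    fderiv ℝ (fun y => C.ϖ i y * C.vol y) z (stdVec i) = C.kap i z * C.vol z := by
  have hO := C.isOpen_pos hS.smooth.continuous
  have hϖ := fun i => differentiableAt_of_contDiffOn C.isOpen (C.smooth_ϖ i) hz.1
  have hv := differentiableAt_of_contDiffOn hO (C.smooth_vol hS) hz
  have hvp := C.vol_pos hS hz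
  have hp : DifferentiableAt ℝ (fun y => ∏ k, C.ϖ k y) z :=
    (HasFDerivAt.finsetProd fun b _ => (hϖ _).hasFDerivAt).differentiableAt
  have h1 : dd C.ϖ i (fun y => ∏ k, C.ϖ k y) z = (∑ k, C.θ i k z) * ∏ k, C.ϖ k z :=
    dd_prod i Finset.univ C.ϖ (C.θ i) z hϖ fun k => C.dd_ϖ i k z hz.1
  have h2 : fderiv ℝ (C.ϖ i) z (stdVec i) = C.θ i i z := by
    have : C.ϖ i z * fderiv ℝ (C.ϖ i) z (stdVec i) = C.θ i i z * C.ϖ i z := C.dd_ϖ i i z hz.1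
    rw [mul_comm] at this
    exact mul_right_cancel₀ (C.ϖ_ne i hz) this
  have hP0 : ∏ k, C.ϖ k z ≠ 0 := Finset.prod_ne_zero_iff.2 fun k _ => C.ϖ_ne k hz
  have h3 := dd_congr (ϖ := C.ϖ) hO (fun y hy => C.det_gramH_eq hS hy) hz i
  have h4 := dd_smul (ϖ := C.ϖ) hp hv i
  simp only [smul_eq_mul] at h4
  have h5 := dd_smul (ϖ := C.ϖ) (hp.mul hv) (hp.mul hv) i
  simp only [smul_eq_mul] at h5
  have h6 : dd C.ϖ i (fun y => ((∏ k, C.ϖ k y) * C.vol y) ^ 2) z =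
      2 * ((∏ k, C.ϖ k z) * C.vol z) *
        ((∑ k, C.θ i k z) * (∏ k, C.ϖ k z) * C.vol z + (∏ k, C.ϖ k z) * dd C.ϖ i C.vol z) := by
    rw [← h1, ← h4]
    simp only [sq]
    refine h5.trans ?_
    change dd C.ϖ i (fun y => (∏ k, C.ϖ k y) * C.vol y) z * _ + _ *
      dd C.ϖ i (fun y => (∏ k, C.ϖ k y) * C.vol y) z = _
    simp only [Pi.mul_apply]
    ring
  have h7 : C.kap i z * C.vol z = dd C.ϖ i C.vol z + C.θ i i z * C.vol z := by
    rw [kap, h3, h6, C.det_gramH_eq hS hz]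
    field_simp
    ring
  rw [h7, fderiv_fun_mul (hϖ i) hv]
  simp only [_root_.add_apply, _root_.smul_apply, smul_eq_mul, h2, dd]
  ring

theorem smoothMat_kpow_inv (hh : IsSmoothSymForm h) (m : ℕ) :
    SmoothMat C.O fun z => kpow m (cplx (C.gramH z)⁻¹) :=
  SmoothMat.kpow (A := fun z => cplx (C.gramH z)⁻¹) (fun i k => contDiffOn_ofReal
    (contDiffOn_inv (C.smooth_gramH hh) C.det_ne_zero i k)) m

theorem smoothMat_kpow (hh : IsSmoothSymForm h) (m : ℕ) :
    SmoothMat C.O fun z => kpow m (cplx (C.gramH z)) :=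
  SmoothMat.kpow (A := fun z => cplx (C.gramH z))
    (fun i k => contDiffOn_ofReal (C.smooth_gramH hh i k)) m

theorem kpow_inv_mul_kpow (m : ℕ) {z : Eu n} (hz : z ∈ C.O) :
    kpow m (cplx (C.gramH z)⁻¹) * kpow m (cplx (C.gramH z)) = 1 := by
  rw [← kpow_mul, ← cplx_mul, Matrix.nonsing_inv_mul (C.gramH z) (isUnit_iff_ne_zero.2 (C.det_ne_zero z hz)),
    cplx_one, kpow_one]

theorem kpow_mul_kpow_inv (m : ℕ) {z : Eu n} (hz : z ∈ C.O) :
    kpow m (cplx (C.gramH z)) * kpow m (cplx (C.gramH z)⁻¹) = 1 := by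
  rw [← kpow_mul, ← cplx_mul, Matrix.mul_nonsing_inv (C.gramH z) (isUnit_iff_ne_zero.2 (C.det_ne_zero z hz)),
    cplx_one, kpow_one]

/-- The adjoint of a first order operator on symmetric tensors, in the frame. -/
def adjOp {m k : ℕ} (L : FOp n (Fin k → Fin n) (Fin m → Fin n)) :
    FOp n (Fin m → Fin n) (Fin k → Fin n) :=
  (L.adj C.ϖ C.kap (fun z => kpow m (cplx (C.gramH z)))
    fun z => kpow k (cplx (C.gramH z)⁻¹)).lmul (symM n m)

theorem smooth_adjOp (hh : IsSmoothSymForm h) {m k : ℕ}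
    {L : FOp n (Fin k → Fin n) (Fin m → Fin n)} (hL : L.Smooth C.O) : (C.adjOp L).Smooth C.O :=
  (FOp.Smooth.adj C.isOpen C.smooth_ϖ (C.smooth_kap hh) (C.smoothMat_kpow hh m)
    (C.smoothMat_kpow_inv hh k) hL).lmul _

/-- Integration by parts against a symmetric tensor field. -/
theorem pairOn_adj [T2Space M] (hS : ScSetup x h) {m k : ℕ} {L : FOp n (Fin k → Fin n) (Fin m → Fin n)}
    (hL : L.Smooth C.O) {u a : TField n M m} {w Pu : TField n M k} (hu : u ∈ SymSections x m)
    (hw : w ∈ TensorSections x k) {K : Set M} (hK : IsCompact K) (hKU : K ⊆ C.posU)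
    (hu0 : ∀ p, p ∉ K → u p = 0) (hPu : ∀ z ∈ C.pos, C.comp Pu z = L.app C.ϖ (C.comp u) z)
    (ha : ∀ z ∈ C.pos, C.comp a z = (C.adjOp L).app C.ϖ (C.comp w) z) :
    pairOn (scMetric x h) C.φ C.posU Pu w = pairOn (scMetric x h) C.φ C.posU u a := by
  have hO := C.isOpen_pos hS.smooth.continuous
  set K' := C.φ '' K with hK'
  have hK'c : IsCompact K' :=
    hK.image_of_continuousOn (C.φ.continuousOn.mono (hKU.trans C.posU_subset))
  have hK'O : K' ⊆ C.pos := by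
    rintro _ ⟨p, hp, rfl⟩
    exact C.map_mem_pos (hKU hp).1 (hKU hp).2
  have hcu0 : ∀ z ∈ C.pos, z ∉ K' → C.comp u z = 0 := by
    intro z hz hzK
    ext I
    rw [comp_apply, hu0 _ fun hc => hzK ⟨_, hc, C.φ.right_inv (C.subset hz.1)⟩]
    rfl
  classical
  -- Outside the chart target the components of `u` are those at default values of the inverse
  -- chart. Cutting off by `K'` gives a function on all of `ℝⁿ` with compact support in `C.pos`.
  set f : Eu n → (Fin m → Fin n) → ℂ := fun z => if z ∈ K' then C.comp u z else 0 with hf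
  have hfu : ∀ z ∈ C.pos, f z = C.comp u z := by
    intro z hz
    by_cases hzK : z ∈ K'
    · simp [hf, hzK]
    · simp [hf, hzK, hcu0 z hz hzK]
  have hf0 : ∀ z, z ∉ K' → f z = 0 := fun z hz => by simp [hf, hz]
  have hfs : SmoothArr C.pos f := fun I =>
    (C.smoothArr_comp hu.1 I).congr fun z hz => congrFun (hfu z hz) I
  have hLf : ∀ z ∈ C.pos, C.comp Pu z = L.app C.ϖ f z := by
    intro z hz
    rw [hPu z hz, FOp.app, FOp.app, hfu z hz]
    congr 1
    exact Finset.sum_congr rfl fun i _ => by rw [ddV_congr hO hfu hz]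
  have hL' : L.Smooth C.pos := ⟨fun i => (hL.b i).mono C.pos_subset, hL.c.mono C.pos_subset⟩
  have key := FOp.integral_adj hO (fun i => (C.smooth_ϖ i).mono C.pos_subset)
    (fun i => (C.smooth_kap hS.form i).mono C.pos_subset) (C.smooth_vol hS)
    (fun i z hz => C.fderiv_vol hS i hz) (fun z hz => C.kpow_inv_mul_kpow m hz.1)
    ((C.smoothMat_kpow_inv hS.form m).mono C.pos_subset)
    ((C.smoothMat_kpow hS.form m).mono C.pos_subset)
    ((C.smoothMat_kpow_inv hS.form k).mono C.pos_subset) hL' hK'c hK'O hfs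
    (C.smoothArr_comp hw) hf0
  have hLf0 : ∀ z, z ∉ K' → L.app C.ϖ f z = 0 := by
    intro z hz
    have : ∀ i, ddV C.ϖ i f z = 0 := fun i => by
      ext I
      simp only [ddV, dd]
      rw [fderiv_eq_zero_off hK'c.isClosed (fun y hy => congrFun (hf0 y hy) I) hz]
      simp
    simp [FOp.app, this, hf0 z hz]
  rw [C.pairOn_posU hS.smooth, C.pairOn_posU hS.smooth]
  refine Eq.trans ?_ ((((setIntegral_eq_integral_of_forall_compl_eq_zero (s := C.pos) ?_).trans
    key).trans (setIntegral_eq_integral_of_forall_compl_eq_zero (s := C.pos) ?_).symm).trans ?_)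
  · exact setIntegral_congr_fun hO.measurableSet fun z hz => by simp only [hLf z hz]
  · intro z hz
    rw [hLf0 z fun hc => hz (hK'O hc), zero_dotProduct, mul_zero]
  · intro z hz
    rw [hf0 z fun hc => hz (hK'O hc), zero_dotProduct, mul_zero]
  · refine setIntegral_congr_fun hO.measurableSet fun z hz => ?_
    simp only [hfu z hz, ha z hz, adjOp, FOp.lmul_app]
    congr 1
    -- A symmetrization may be inserted in front of `u`. It is self-adjoint and commutes with the
    -- fibre metric, so it moves onto the adjoint as the projection contained in `adjOp`.
    conv_lhs => rw [← symM_mulVec_of_isSymArr (C.isSymArr_comp hu hz)]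
    rw [mulVec_dotProduct_star, symM_conjTranspose, Matrix.mulVec_mulVec, Matrix.mulVec_mulVec,
      symM_mul_kpow]

end FrameChart

end Pairing

/-! ### Existence, uniqueness and local form of the formal adjoint -/

section GlobalAdjoint

open Matrix MeasureTheory

variable {n : ℕ} {M : Type*} [TopologicalSpace M] [ChartedSpace (Eu n) M]
  [IsManifold (J n) ∞ M] {x : M → ℝ} {h : BField n M}

namespace FrameChart

variable (C : FrameChart n x h)

theorem contDiffOn_tPull_of_comp {m : ℕ} {u : TField n M m} {W : Set (Eu n)} (hW : W ⊆ C.pos)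
    (hu : SmoothArr W (C.comp u)) : ContDiffOn ℝ ∞ (tPull u C.φ) W := by
  refine contDiffOn_of_stdComp fun I => ?_
  have h1 : ContDiffOn ℝ ∞ (fun z => ∏ s, C.ϖ (I s) z) W :=
    contDiffOn_prod fun s _ => (C.smooth_ϖ (I s)).mono (hW.trans C.pos_subset)
  have h2 : ∀ z ∈ W, ∏ s, C.ϖ (I s) z ≠ 0 := fun z hz =>
    Finset.prod_ne_zero_iff.2 fun s _ => C.ϖ_ne _ (hW hz)
  refine ((h1.inv h2).smul (hu I)).congr fun z hz => ?_
  change _ = (∏ s, C.ϖ (I s) z)⁻¹ • frameComp C.ϖ (tPull u C.φ) z I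
  rw [frameComp_eq, smul_smul, inv_mul_cancel₀ (h2 z hz), one_smul]
  rfl

theorem smoothArr_comp_of_contDiffAt {m : ℕ} {u : TField n M m} {W : Set (Eu n)} (hW : W ⊆ C.pos)
    (hu : ∀ z ∈ W, ContDiffAt ℝ ∞ (tPull u C.φ) z) : SmoothArr W (C.comp u) := by
  intro K
  have h1 := smoothArr_stdComp (fun z hz => (hu z hz).contDiffWithinAt) K
  have h2 : ContDiffOn ℝ ∞ (fun z => ∏ s, C.ϖ (K s) z) W :=
    contDiffOn_prod fun s _ => (C.smooth_ϖ (K s)).mono (hW.trans C.pos_subset)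
  exact (h2.smul h1).congr fun z _ => frameComp_eq C.ϖ (tPull u C.φ) z K

theorem isSymArr_comp_of_symm {m : ℕ} {u : TField n M m} {z : Eu n}
    (hu : ∀ (σ : Equiv.Perm (Fin m)) (v : Fin m → Eu n),
      u (C.φ.symm z) (fun i => v (σ i)) = u (C.φ.symm z) v) : IsSymArr (C.comp u z) :=
  fun σ I => hu σ fun s => dSymm C.φ z (C.ϖ (I s) z • stdVec (I s))

/-- A symmetric tensor field is determined by its pairings with test fields. -/
theorem comp_eq_of_pairOn_eq [T2Space M] (hS : ScSetup x h) {m : ℕ} {S T : TField n M m}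
    {W : Set (Eu n)} (hW : IsOpen W) (hWp : W ⊆ C.pos) (hSs : SmoothArr W (C.comp S))
    (hTs : SmoothArr W (C.comp T)) (hS' : ∀ z ∈ W, IsSymArr (C.comp S z))
    (hT' : ∀ z ∈ W, IsSymArr (C.comp T z)) {z₀ : Eu n} (hz₀ : z₀ ∈ W)
    (H : ∀ u ∈ SymSections x m, ∀ K, IsCompact K → K ⊆ C.φ.symm '' W → (∀ p, p ∉ K → u p = 0) →
      pairOn (scMetric x h) C.φ C.posU u S = pairOn (scMetric x h) C.φ C.posU u T) :
    C.comp S z₀ = C.comp T z₀ := by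
  have hWO : W ⊆ C.O := hWp.trans C.pos_subset
  have hO := C.isOpen_pos hS.smooth.continuous
  set A : Eu n → Matrix (Fin m → Fin n) (Fin m → Fin n) ℂ :=
    fun z => kpow m (cplx (C.gramH z)⁻¹) with hA
  have hAs : SmoothMat W A := (C.smoothMat_kpow_inv hS.form m).mono hWO
  -- Lowering with the fibre metric makes the test field explicit: for `u = χ b`, with a bump
  -- function `χ`, the difference of the two pairings is the integral of `χ |b|²` against the
  -- density.
  set b : Eu n → (Fin m → Fin n) → ℂ := fun z => A z *ᵥ (C.comp S z - C.comp T z) with hb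
  have hbs : SmoothArr W b := hAs.mulVec fun I => (hSs I).sub (hTs I)
  have hb' : ∀ z ∈ W, IsSymArr (b z) := by
    intro z hz
    have h1 : IsSymArr (C.comp S z - C.comp T z) := fun σ I => by
      rw [Pi.sub_apply, Pi.sub_apply, hS' z hz σ I, hT' z hz σ I]
    have h2 : b z = symM n m *ᵥ b z := by
      rw [hb]
      simp only
      rw [hA, Matrix.mulVec_mulVec, symM_mul_kpow, ← Matrix.mulVec_mulVec,
        symM_mulVec_of_isSymArr h1]
    rw [h2]
    exact isSymArr_symM_mulVec _
  suffices hb0 : b z₀ = 0 by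
    have h1 : kpow m (cplx (C.gramH z₀)) *ᵥ b z₀ = C.comp S z₀ - C.comp T z₀ := by
      rw [hb]
      simp only
      rw [hA, Matrix.mulVec_mulVec, C.kpow_mul_kpow_inv m (hWO hz₀), Matrix.one_mulVec]
    rw [hb0, Matrix.mulVec_zero] at h1
    exact (sub_eq_zero.1 h1.symm)
  obtain ⟨χ, hχW, hχc, hχs, hχr, hχ1⟩ :=
    exists_contDiff_tsupport_subset (n := ⊤) (hW.mem_nhds hz₀)
  have hχs' : ContDiffOn ℝ ∞ (fun z => (χ z : ℂ)) W := contDiffOn_ofReal hχs.contDiffOn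
  set K' := tsupport χ with hK'
  have hχ0 : ∀ z, z ∉ K' → χ z = 0 := fun z hz => image_eq_zero_of_notMem_tsupport hz
  set f : Eu n → (Fin m → Fin n) → ℂ := fun z => (χ z : ℂ) • b z with hf
  have hfs : SmoothArr W f := fun I => hχs'.mul (hbs I)
  have hf0 : ∀ z, z ∉ K' → f z = 0 := fun z hz => by simp [hf, hχ0 z hz]
  set K := C.φ.symm '' K' with hK
  have hWt : W ⊆ C.φ.target := hWO.trans C.subset
  have hKc : IsCompact K :=
    hχc.isCompact.image_of_continuousOn (C.φ.symm.continuousOn.mono (hχW.trans hWt))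
  classical
  -- The field is set to zero off the compact set `K`, since `ofArr` has no meaning outside the
  -- frame domain. In a Hausdorff space `K` is closed, so `u` is smooth across its complement.
  set u : TField n M m := fun p => if p ∈ K then C.ofArr f p else 0 with hu
  have hu0 : ∀ p, p ∉ K → u p = 0 := fun p hp => if_neg hp
  have hcu : ∀ z ∈ C.pos, C.comp u z = f z := by
    intro z hz
    by_cases hzK : C.φ.symm z ∈ K
    · rw [C.comp_congr (w := C.ofArr f) (if_pos hzK), C.comp_ofArr f hz]
    · have h1 : z ∉ K' := fun hc => hzK ⟨z, hc, rfl⟩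
      rw [hf0 z h1]
      ext I
      rw [comp_apply, hu0 _ hzK]
      rfl
  have huT : u ∈ TensorSections x m := by
    intro p hp
    have h₂ : chartAt (Eu n) p ∈ IsManifold.maximalAtlas (J n) ∞ M :=
      IsManifold.chart_mem_maximalAtlas p
    by_cases hpK : p ∈ K
    · obtain ⟨z, hz, rfl⟩ := hpK
      have h1 : ContDiffOn ℝ ∞ (tPull u C.φ) W := C.contDiffOn_tPull_of_comp hWp
        fun I => (hfs I).congr fun y hy => congrFun (hcu y (hWp hy)) I
      refine contDiffAt_tPull_of_tPull h₂ C.mem (mem_chart_source _ _)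
        (C.φ.map_target (hWt (hχW hz))) ?_
      rw [C.φ.right_inv (hWt (hχW hz))]
      exact h1.contDiffAt (hW.mem_nhds (hχW hz))
    · have h1 : ∀ᶠ y in nhds (chartAt (Eu n) p p), (chartAt (Eu n) p).symm y ∈ Kᶜ := by
        refine ((chartAt (Eu n) p).continuousAt_symm ((chartAt (Eu n) p).map_source
          (mem_chart_source _ p))).eventually_mem (hKc.isClosed.isOpen_compl.mem_nhds ?_)
        rwa [(chartAt (Eu n) p).left_inv (mem_chart_source _ p)]
      have h2 : tRep u p =ᶠ[nhds (chartAt (Eu n) p p)] fun _ => 0 := by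
        filter_upwards [h1] with y hy
        change tPull u (chartAt (Eu n) p) y = 0
        rw [tPull, tAt, hu0 _ hy]
        rfl
      exact contDiffAt_const.congr_of_eventuallyEq h2
  have huS : u ∈ SymSections x m := by
    refine ⟨huT, fun p _ σ v => ?_⟩
    by_cases hpK : p ∈ K
    · obtain ⟨z, hz, rfl⟩ := hpK
      refine C.symm_of_isSymArr_comp (hWp (hχW hz)) ?_ σ v
      rw [hcu z (hWp (hχW hz))]
      intro σ I
      simp only [hf, Pi.smul_apply, hb' z (hχW hz) σ I]
    · rw [hu0 p hpK]; rfl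
  have key := H u huS K hKc (Set.image_mono hχW) hu0
  rw [C.pairOn_posU hS.smooth, C.pairOn_posU hS.smooth] at key
  have hint : ∀ R : TField n M m, SmoothArr W (C.comp R) →
      Integrable (fun z => (C.vol z : ℂ) * (f z ⬝ᵥ star (A z *ᵥ C.comp R z))) ∧
      ∫ z in C.pos, (C.vol z : ℂ) * (C.comp u z ⬝ᵥ star (A z *ᵥ C.comp R z)) =
        ∫ z, (C.vol z : ℂ) * (f z ⬝ᵥ star (A z *ᵥ C.comp R z)) := by
    intro R hR
    refine ⟨integrable_of_zero_off hW hχc.isCompact hχW ((contDiffOn_ofReal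
      ((C.smooth_vol hS).mono hWp)).mul (hfs.dotProduct_star (hAs.mulVec hR))) fun z hz => ?_, ?_⟩
    · rw [hf0 z hz, zero_dotProduct, mul_zero]
    · refine Eq.trans ?_ (setIntegral_eq_integral_of_forall_compl_eq_zero (s := C.pos) ?_)
      · exact setIntegral_congr_fun hO.measurableSet fun z hz => by simp only [hcu z hz]
      · intro z hz
        rw [hf0 z fun hc => hz (hWp (hχW hc)), zero_dotProduct, mul_zero]
  rw [(hint S hSs).2, (hint T hTs).2, ← sub_eq_zero, ← integral_sub (hint S hSs).1 (hint T hTs).1]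
    at key
  -- A continuous nonnegative function with compact support; its integral vanishes, whereas `r z₀ ≠
  -- 0` if `b z₀ ≠ 0`.
  set r : Eu n → ℝ := fun z => C.vol z * (χ z * ∑ I, Complex.normSq (b z I)) with hr
  have hrI : ∀ z, (C.vol z : ℂ) * (f z ⬝ᵥ star (A z *ᵥ C.comp S z)) -
      (C.vol z : ℂ) * (f z ⬝ᵥ star (A z *ᵥ C.comp T z)) = (r z : ℂ) := by
    intro z
    have h1 : star (b z) = star (A z *ᵥ C.comp S z) - star (A z *ᵥ C.comp T z) := by
      rw [hb]
      simp only [Matrix.mulVec_sub, star_sub]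
    rw [← mul_sub, ← dotProduct_sub, ← h1, hf, smul_dotProduct, hr]
    simp only [dotProduct, Pi.star_apply, Complex.star_def, Complex.mul_conj, smul_eq_mul]
    push_cast
    rfl
  simp only [hrI] at key
  have hr0 : ∀ z, z ∉ K' → r z = 0 := fun z hz => by simp [hr, hχ0 z hz]
  have hnorm : ContDiff ℝ ∞ fun w : ℂ => Complex.normSq w := by
    simp only [Complex.normSq_apply]
    exact (Complex.reCLM.contDiff.mul Complex.reCLM.contDiff).add
      (Complex.imCLM.contDiff.mul Complex.imCLM.contDiff)
  have hrs : ContDiff ℝ ∞ r := contDiff_of_zero_off hW hχc.isCompact hχW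
    (((C.smooth_vol hS).mono hWp).mul (hχs.contDiffOn.mul
      (ContDiffOn.sum fun I _ => hnorm.comp_contDiffOn (hbs I)))) hr0
  have hrn : 0 ≤ r := fun z => mul_nonneg (Real.sqrt_nonneg _) (mul_nonneg
    (hχr ⟨z, rfl⟩).1 (Finset.sum_nonneg fun I _ => Complex.normSq_nonneg _))
  by_contra hbne
  have h3 : r z₀ ≠ 0 := by
    refine mul_ne_zero (C.vol_pos hS (hWp hz₀)).ne' ?_
    rw [hχ1, one_mul]
    intro h4
    rw [Finset.sum_eq_zero_iff_of_nonneg fun I _ => Complex.normSq_nonneg _] at h4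
    exact hbne (funext fun I => Complex.normSq_eq_zero.1 (h4 I (Finset.mem_univ _)))
  have h5 := hrs.continuous.integral_pos_of_hasCompactSupport_nonneg_nonzero (μ := volume)
    (HasCompactSupport.intro hχc.isCompact hr0) hrn h3
  have h6 : ((∫ z, r z : ℝ) : ℂ) = 0 := integral_ofReal.symm.trans key
  exact h5.ne' (Complex.ofReal_eq_zero.1 h6)

theorem pairOn_transfer (hx : Continuous x) (C' : FrameChart n x h) {m : ℕ} {S : TField n M m}
    (T : TField n M m) {K : Set M} (hK : K ⊆ C.posU) (hK' : K ⊆ C'.posU)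
    (hS : ∀ p, p ∉ K → S p = 0) :
    pairOn (scMetric x h) C.φ C.posU S T = pairOn (scMetric x h) C'.φ C'.posU S T := by
  rw [pairOn_eq_of_subset _ C.φ (C.isOpen_posU hx) (Set.subset_inter hK hK')
    Set.inter_subset_left T hS, pairOn_eq_of_subset _ C'.φ (C'.isOpen_posU hx)
    (Set.subset_inter hK hK') Set.inter_subset_right T hS]
  exact pairOn_eq _ C.mem C'.mem ((C.isOpen_posU hx).inter (C'.isOpen_posU hx))
    (Set.inter_subset_left.trans C.posU_subset) (Set.inter_subset_right.trans C'.posU_subset) S T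

theorem interior_posU (hS : ScSetup x h) (p : M) :
    (interior hS p).posU = (chartAt (Eu n) p).source ∩ {q | 0 < x q} := by
  ext q
  constructor
  · exact fun hq => ⟨hq.1.1, hq.2⟩
  · rintro ⟨hq, hx⟩
    refine ⟨⟨hq, (chartAt (Eu n) p).map_source hq, ?_⟩, hx⟩
    change 0 < x ((chartAt (Eu n) p).symm (chartAt (Eu n) p q))
    rwa [(chartAt (Eu n) p).left_inv hq]

theorem chartPairing_eq_pairOn (hS : ScSetup x h) (p : M) {m : ℕ} {S : TField n M m}
    (T : TField n M m) {K : Set M} (hK : K ⊆ (interior hS p).posU)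
    (hS0 : ∀ q, q ∉ K → S q = 0) : chartPairing (scMetric x h) p S T =
      pairOn (scMetric x h) (interior hS p).φ (interior hS p).posU S T := by
  rw [chartPairing_eq]
  exact pairOn_eq_of_subset _ _ isOpen_univ hK (Set.subset_univ _) T hS0

end FrameChart

/-- In the frames, the operator `P` is given on symmetric tensors by the first order operators
`L`. -/
structure IsLocalOp {m k : ℕ} (P : Op n M m k)
    (L : FrameChart n x h → FOp n (Fin k → Fin n) (Fin m → Fin n)) : Prop where
  smooth : ∀ C, (L C).Smooth C.O
  comp : ∀ u ∈ SymSections x m, ∀ C, ∀ z ∈ C.pos, C.comp (P u) z = (L C).app C.ϖ (C.comp u) z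
  -- Locality, also where `x ≤ 0`: it keeps the support of `P u` inside that of a compactly
  -- supported `u`, as needed to move pairings between charts.
  zero : ∀ u p, (∀ᶠ q in nhds p, u q = 0) → P u p = 0

/-- The adjoint of a first order operator as defined by one frame. -/
def FrameChart.adjField (C : FrameChart n x h) {m k : ℕ} (L : FOp n (Fin k → Fin n) (Fin m → Fin n))
    (w : TField n M k) : TField n M m :=
  C.ofArr ((C.adjOp L).app C.ϖ (C.comp w))

theorem FrameChart.comp_adjField (C : FrameChart n x h) {m k : ℕ}
    (L : FOp n (Fin k → Fin n) (Fin m → Fin n)) (w : TField n M k) {z : Eu n} (hz : z ∈ C.pos) :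
    C.comp (C.adjField L w) z = (C.adjOp L).app C.ϖ (C.comp w) z :=
  C.comp_ofArr _ hz

theorem FrameChart.isSymArr_adjOp_app (C : FrameChart n x h) {m k : ℕ}
    (L : FOp n (Fin k → Fin n) (Fin m → Fin n)) (f : Eu n → (Fin k → Fin n) → ℂ) (z : Eu n) :
    IsSymArr ((C.adjOp L).app C.ϖ f z) := by
  rw [adjOp, FOp.lmul_app]
  exact isSymArr_symM_mulVec _

theorem FrameChart.smoothArr_adjOp_app (C : FrameChart n x h) (hS : ScSetup x h) {m k : ℕ}
    {L : FOp n (Fin k → Fin n) (Fin m → Fin n)} (hL : L.Smooth C.O) {w : TField n M k}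
    (hw : w ∈ TensorSections x k) : SmoothArr C.pos ((C.adjOp L).app C.ϖ (C.comp w)) := by
  have h1 := C.smooth_adjOp hS.form hL
  exact FOp.Smooth.app (C.isOpen_pos hS.smooth.continuous)
    (fun i => (C.smooth_ϖ i).mono C.pos_subset)
    ⟨fun i => (h1.b i).mono C.pos_subset, h1.c.mono C.pos_subset⟩ (C.smoothArr_comp hw)

theorem FrameChart.smoothArr_comp_adjField (C : FrameChart n x h) (hS : ScSetup x h) {m k : ℕ}
    {L : FOp n (Fin k → Fin n) (Fin m → Fin n)} (hL : L.Smooth C.O) {w : TField n M k}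
    (hw : w ∈ TensorSections x k) : SmoothArr C.pos (C.comp (C.adjField L w)) := fun I =>
  (C.smoothArr_adjOp_app hS hL hw I).congr fun _ hy => congrFun (C.comp_adjField L w hy) I

section

variable [T2Space M] {m k : ℕ} {P : Op n M m k}
  {L : FrameChart n x h → FOp n (Fin k → Fin n) (Fin m → Fin n)}

theorem IsLocalOp.zero_off (hP : IsLocalOp P L) {u : TField n M m} {K : Set M} (hK : IsCompact K)
    (hu : ∀ p, p ∉ K → u p = 0) : ∀ p, p ∉ K → P u p = 0 := fun p hp =>
  hP.zero u p (Filter.eventually_of_mem (hK.isClosed.isOpen_compl.mem_nhds hp) fun q hq => hu q hq)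

/-- The adjoints defined by different frames agree. -/
theorem IsLocalOp.comp_adjField_eq (hS : ScSetup x h) (hP : IsLocalOp P L)
    {w : TField n M k} (hw : w ∈ TensorSections x k) (C C' : FrameChart n x h) {z : Eu n}
    (hz : z ∈ C.pos) (hz' : C.φ.symm z ∈ C'.posU) :
    C.comp (C'.adjField (L C') w) z = (C.adjOp (L C)).app C.ϖ (C.comp w) z := by
  have hx := hS.smooth.continuous
  rw [← C.comp_adjField (L C) w hz]
  set S := C'.adjField (L C') w with hSd
  have hSs : SmoothArr C'.pos (C'.comp S) := C'.smoothArr_comp_adjField hS (hP.smooth C') hw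
  have hS1 := C'.contDiffOn_tPull_of_comp subset_rfl hSs
  set W : Set (Eu n) := C.pos ∩ (C.φ.target ∩ C.φ.symm ⁻¹' C'.posU) with hW
  have hWo : IsOpen W := (C.isOpen_pos hx).inter
    (C.φ.symm.isOpen_inter_preimage (C'.isOpen_posU hx))
  refine C.comp_eq_of_pairOn_eq hS hWo Set.inter_subset_left
    (C.smoothArr_comp_of_contDiffAt Set.inter_subset_left fun y hy => ?_)
    ((C.smoothArr_comp_adjField hS (hP.smooth C) hw).mono Set.inter_subset_left)
    (fun y hy => C.isSymArr_comp_of_symm fun σ v => ?_)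
    (fun y hy => by
      rw [C.comp_adjField (L C) w hy.1]
      exact C.isSymArr_adjOp_app _ _ _)
    ⟨hz, C.subset hz.1, hz'⟩ fun u hu K hK hKW hu0 => ?_
  · have h1 : C.φ.symm y ∈ C'.posU := hy.2.2
    have h2 := contDiffAt_tPull_of_tPull C.mem C'.mem (C.φ.map_target hy.2.1) h1.1.1
      (hS1.contDiffAt ((C'.isOpen_pos hx).mem_nhds (C'.map_mem_pos h1.1 h1.2)))
    rwa [C.φ.right_inv hy.2.1] at h2
  · have h1 : C.φ.symm y ∈ C'.posU := hy.2.2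
    have h2 := C'.map_mem_pos h1.1 h1.2
    have h3 := C'.symm_of_isSymArr_comp (u := S) h2 (by
      rw [C'.comp_adjField (L C') w h2]
      exact C'.isSymArr_adjOp_app _ _ _) σ v
    rwa [C'.φ.left_inv h1.1.1] at h3
  · have hKC : K ⊆ C.posU := fun p hp => by
      obtain ⟨y, hy, rfl⟩ := hKW hp
      exact ⟨C.symm_mem hy.1.1, hy.1.2⟩
    have hKC' : K ⊆ C'.posU := fun p hp => by
      obtain ⟨y, hy, rfl⟩ := hKW hp
      exact hy.2.2
    -- Both candidates pair with `u` as `w` pairs with `P u`, computed in the one or the other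
    -- frame, and that pairing does not depend on the chart.
    rw [C.pairOn_transfer hx C' S hKC hKC' hu0,
      ← C'.pairOn_adj hS (hP.smooth C') hu hw hK hKC' hu0 (fun y hy => hP.comp u hu C' y hy)
        (fun y hy => C'.comp_adjField (L C') w hy),
      ← C.pairOn_adj hS (hP.smooth C) hu hw hK hKC hu0 (fun y hy => hP.comp u hu C y hy)
        (fun y hy => C.comp_adjField (L C) w hy),
      C.pairOn_transfer hx C' w hKC hKC' (hP.zero_off hK hu0)]

/-- At each point the adjoint is taken from the interior frame centred there. Independence of the
frame shows that it is given by `adjOp` in every frame at once, which yields smoothness, symmetry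
and the pairing identity. -/
theorem IsLocalOp.exists_isFormalAdjoint (hS : ScSetup x h) (hP : IsLocalOp P L)
    {ℱ : Set (TField n M k)} (hℱ : ℱ ⊆ TensorSections x k) :
    ∃ Q, IsFormalAdjoint x (scMetric x h) (SymSections x m) ℱ P Q := by
  set Q : Op n M k m := fun w p =>
    (FrameChart.interior hS p).adjField (L (FrameChart.interior hS p)) w p with hQ
  have hQc : ∀ w ∈ ℱ, ∀ C : FrameChart n x h, ∀ z ∈ C.pos,
      C.comp (Q w) z = (C.adjOp (L C)).app C.ϖ (C.comp w) z := by
    intro w hw C z hz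
    rw [← hP.comp_adjField_eq hS (hℱ hw) C (FrameChart.interior hS (C.φ.symm z)) hz
      ⟨FrameChart.mem_interior_U hS hz.2, hz.2⟩]
    exact C.comp_congr rfl
  refine ⟨Q, fun w hw => ?_, fun p u hu w hw hK => ?_⟩
  · refine FrameChart.mem_symSections_of_comp hS (fun C I => ?_) fun C z hz => ?_
    · exact (C.smoothArr_adjOp_app hS (hP.smooth C) (hℱ hw) I).congr fun z hz =>
        congrFun (hQc w hw C z hz) I
    · rw [hQc w hw C z hz]
      exact C.isSymArr_adjOp_app _ _ _
  · obtain ⟨K, hKc, hKs, hu0⟩ := hK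
    have hKU : K ⊆ (FrameChart.interior hS p).posU := by
      rw [FrameChart.interior_posU]
      simpa only [extChartAt_source] using hKs
    rw [FrameChart.chartPairing_eq_pairOn hS p w hKU (hP.zero_off hKc hu0),
      FrameChart.chartPairing_eq_pairOn hS p (Q w) hKU hu0]
    exact FrameChart.pairOn_adj _ hS (hP.smooth _) hu (hℱ hw) hKc hKU hu0
      (fun z hz => hP.comp u hu _ z hz) fun z hz => hQc w hw _ z hz

theorem IsLocalOp.isFormalAdjoint (hS : ScSetup x h) (hP : IsLocalOp P L)
    {ℱ : Set (TField n M k)} (hℱ : ℱ ⊆ TensorSections x k) :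
    IsFormalAdjoint x (scMetric x h) (SymSections x m) ℱ P
      (formalAdjoint x (scMetric x h) (SymSections x m) ℱ P) := by
  have h1 := hP.exists_isFormalAdjoint hS hℱ
  rw [formalAdjoint, dif_pos h1]
  exact h1.choose_spec

/-- The formal adjoint in the frames. -/
theorem IsLocalOp.comp_formalAdjoint (hS : ScSetup x h) (hP : IsLocalOp P L)
    {ℱ : Set (TField n M k)} (hℱ : ℱ ⊆ TensorSections x k) {w : TField n M k} (hw : w ∈ ℱ)
    (C : FrameChart n x h) {z : Eu n} (hz : z ∈ C.pos) :
    C.comp (formalAdjoint x (scMetric x h) (SymSections x m) ℱ P w) z =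
      (C.adjOp (L C)).app C.ϖ (C.comp w) z := by
  have hx := hS.smooth.continuous
  have hA := hP.isFormalAdjoint hS hℱ
  set Q := formalAdjoint x (scMetric x h) (SymSections x m) ℱ P with hQ
  set p := C.φ.symm z with hp
  set C' := FrameChart.interior hS p with hC'
  rw [← C.comp_adjField (L C) w hz]
  set W : Set (Eu n) := C.pos ∩ (C.φ.target ∩ C.φ.symm ⁻¹' C'.posU) with hW
  have hWo : IsOpen W := (C.isOpen_pos hx).inter
    (C.φ.symm.isOpen_inter_preimage (C'.isOpen_posU hx))
  have hQw := hA.1 w hw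
  refine C.comp_eq_of_pairOn_eq hS hWo Set.inter_subset_left
    ((C.smoothArr_comp hQw.1).mono Set.inter_subset_left)
    ((C.smoothArr_comp_adjField hS (hP.smooth C) (hℱ hw)).mono Set.inter_subset_left)
    (fun y hy => C.isSymArr_comp hQw hy.1)
    (fun y hy => by
      rw [C.comp_adjField (L C) w hy.1]
      exact C.isSymArr_adjOp_app _ _ _)
    ⟨hz, C.subset hz.1, FrameChart.mem_interior_U hS hz.2, hz.2⟩ fun u hu K hK hKW hu0 => ?_
  have hKC : K ⊆ C.posU := fun p hp => by
    obtain ⟨y, hy, rfl⟩ := hKW hp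
    exact ⟨C.symm_mem hy.1.1, hy.1.2⟩
  have hKC' : K ⊆ C'.posU := fun p hp => by
    obtain ⟨y, hy, rfl⟩ := hKW hp
    exact hy.2.2
  have hKs : K ⊆ (extChartAt (J n) p).source ∩ {q | 0 < x q} := by
    rw [extChartAt_source]
    exact hKC'.trans (FrameChart.interior_posU hS p).subset
  rw [← C.pairOn_adj hS (hP.smooth C) hu (hℱ hw) hK hKC hu0 (fun y hy => hP.comp u hu C y hy)
      (fun y hy => C.comp_adjField (L C) w hy),
    C.pairOn_transfer hx C' _ hKC hKC' hu0,
    C.pairOn_transfer hx C' w hKC hKC' (hP.zero_off hK hu0),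
    ← FrameChart.chartPairing_eq_pairOn hS p _ hKC' hu0,
    ← FrameChart.chartPairing_eq_pairOn hS p w hKC' (hP.zero_off hK hu0)]
  -- The defining identity is available only in preferred charts. The test fields were therefore
  -- restricted to supports lying both in the frame `C` and in the preferred chart at `p`.
  exact (hA.2 p u hu w hw ⟨K, hK, hKs, hu0⟩).symm

end

end GlobalAdjoint

/-! ### The operators `dˢ_F`, `∇_F`, their adjoints and compositions in frames -/

section LocalForms

open Matrix

variable {n : ℕ} {M : Type*} [TopologicalSpace M] [ChartedSpace (Eu n) M]
  [IsManifold (J n) ∞ M] {x : M → ℝ} {h : BField n M}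

theorem smul_zero_cov {m : ℕ} {p : M} (r : ℝ) : r • (0 : Cov n m p) = 0 :=
  ContinuousMultilinearMap.ext fun _ => smul_zero (A := ℂ) r

theorem covDeriv_eq_zero {m : ℕ} (G : BField n M) {u : TField n M m} {p : M}
    (hu : ∀ᶠ q in nhds p, u q = 0) : covDeriv G u p = 0 := by
  have h1 : tRep u p =ᶠ[nhds (chartAt (Eu n) p p)] fun _ => 0 := by
    have h2 := ((chartAt (Eu n) p).continuousAt_symm ((chartAt (Eu n) p).map_source
      (mem_chart_source _ p)))
    rw [ContinuousAt, (chartAt (Eu n) p).left_inv (mem_chart_source _ p)] at h2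
    filter_upwards [h2.eventually hu] with y hy
    change tPull u (chartAt (Eu n) p) y = 0
    rw [tPull, tAt, hy]
    rfl
  have h3 : covDerivCoord (bRep G p) (tRep u p) (extChartAt (J n) p p) = 0 := by
    ext v
    rw [covDerivCoord_apply]
    have h4 : fderiv ℝ (tRep u p) (extChartAt (J n) p p) = 0 :=
      h1.fderiv_eq.trans (by simp)
    have h5 : tRep u p (extChartAt (J n) p p) = 0 := h1.self_of_nhds
    rw [h4, h5]
    simp
  rw [covDeriv, h3]
  rfl

theorem conjOp_covDeriv_eq_zero {m : ℕ} (x : M → ℝ) (F : ℝ) (G : BField n M) {u : TField n M m}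
    {p : M} (hu : ∀ᶠ q in nhds p, u q = 0) : conjOp x F (covDeriv G) u p = 0 := by
  rw [conjOp, covDeriv_eq_zero G (hu.mono fun q hq => by rw [hq]; exact smul_zero_cov _)]
  exact smul_zero_cov _

theorem dsF_eq_symmetrize {m : ℕ} (x : M → ℝ) (g : BField n M) (F : ℝ) (u : TField n M m) (p : M) :
    dsF x g F m u p = symmetrize (conjOp x F (covDeriv g) u p) := by
  refine ContinuousMultilinearMap.ext fun v => ?_
  refine Eq.trans ?_ (symmetrize_apply _ _).symm
  have h1 : ∀ T : Cov n (m + 1) p, ∀ r : ℝ, (r • T) v = (r : ℂ) * T v := fun T r =>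
    Complex.real_smul
  refine (h1 _ _).trans ?_
  rw [symDiff, symmetrize_apply, mul_left_comm, Finset.mul_sum]
  rfl

namespace FrameChart

variable (C : FrameChart n x h)

/-- The connection coefficients of a metric `g` which is smooth up to the boundary. -/
def gConn (g : BField n M) (i k l : Fin n) (z : Eu n) : ℝ :=
  C.q i k l z * christoffel (bPull g C.φ) z (stdVec i) (stdVec k) l + if k = l then C.θ i k z else 0

/-- The operator `dˢ_F` in the frame. -/
def dOp (g : BField n M) (F : ℝ) (m : ℕ) : FOp n (Fin (m + 1) → Fin n) (Fin m → Fin n) :=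
  (C.nabOp (C.gConn g) F m).lmul (symM n (m + 1))

end FrameChart

theorem isLocalOp_nablaF (hS : ScSetup x h) (F : ℝ) (m : ℕ) :
    IsLocalOp (nablaF x h F m) fun C : FrameChart n x h => C.nabOp C.scConn F m where
  smooth C := C.smooth_nabOp (C.isConn_scConn hS).smooth F m
  comp _ hu C _ hz := C.comp_conjOp_covDeriv hS.smooth hS.isMetricOn (C.isConn_scConn hS) F hu.1 hz
  zero _ _ hu := conjOp_covDeriv_eq_zero x F _ hu

variable (g : Bundle.ContMDiffRiemannianMetric (J n) ∞ (Eu n) (fun p : M => TangentSpace (J n) p))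

theorem FrameChart.isConn_gConn (C : FrameChart n x h) : C.IsConn g.inner (C.gConn g.inner) :=
  C.isConn_smooth g.symm g.pos (contDiffOn_bPull g.contMDiff C.mem)

theorem FrameChart.smooth_dOp (C : FrameChart n x h) (F : ℝ) (m : ℕ) :
    (C.dOp g.inner F m).Smooth C.O :=
  (C.smooth_nabOp (C.isConn_gConn g).smooth F m).lmul _

theorem isLocalOp_dsF (hS : ScSetup x h) (F : ℝ) (m : ℕ) :
    IsLocalOp (dsF x g.inner F m) fun C : FrameChart n x h => C.dOp g.inner F m where
  smooth C := C.smooth_dOp g F m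
  comp u hu C z hz := by
    have h1 : dsF x g.inner F m u = fun p => symmetrize (conjOp x F (covDeriv g.inner) u p) :=
      funext fun p => dsF_eq_symmetrize x g.inner F u p
    rw [h1, C.comp_symmetrize (conjOp x F (covDeriv g.inner) u), FrameChart.dOp, FOp.lmul_app,
      C.comp_conjOp_covDeriv hS.smooth (isMetricOn_inner x g) (C.isConn_gConn g) F hu.1 hz]
  zero u p hu := by
    rw [dsF_eq_symmetrize, conjOp_covDeriv_eq_zero x F _ hu]
    refine ContinuousMultilinearMap.ext fun v => (symmetrize_apply _ _).trans ?_
    exact mul_eq_zero_of_right _ (Finset.sum_eq_zero fun σ _ => rfl)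

theorem IsLocalOp.mem_tensorSections (hS : ScSetup x h) {m k : ℕ} {P : Op n M m k}
    {L : FrameChart n x h → FOp n (Fin k → Fin n) (Fin m → Fin n)} (hP : IsLocalOp P L)
    {u : TField n M m} (hu : u ∈ SymSections x m) : P u ∈ TensorSections x k := by
  refine FrameChart.mem_tensorSections_of_comp hS fun C I => ?_
  have h1 : (L C).Smooth C.pos :=
    ⟨fun i => ((hP.smooth C).b i).mono C.pos_subset, (hP.smooth C).c.mono C.pos_subset⟩
  exact (h1.app (C.isOpen_pos hS.smooth.continuous) (fun i => (C.smooth_ϖ i).mono C.pos_subset)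
    (C.smoothArr_comp hu.1) I).congr fun z hz => congrFun (hP.comp u hu C z hz) I

theorem dsF_mem_symSections (hS : ScSetup x h) (F : ℝ) {m : ℕ} {u : TField n M m}
    (hu : u ∈ SymSections x m) : dsF x g.inner F m u ∈ SymSections x (m + 1) := by
  refine FrameChart.mem_symSections_of_comp hS (fun C => C.smoothArr_comp
    ((isLocalOp_dsF g hS F m).mem_tensorSections hS hu)) fun C z hz => ?_
  rw [(isLocalOp_dsF g hS F m).comp u hu C z hz, FrameChart.dOp, FOp.lmul_app]
  exact isSymArr_symM_mulVec _

section

variable [T2Space M]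

theorem deltasF_mem_symSections (hS : ScSetup x h) (F : ℝ) {m : ℕ} {w : TField n M (m + 1)}
    (hw : w ∈ SymSections x (m + 1)) : deltasF x g.inner h F m w ∈ SymSections x m :=
  ((isLocalOp_dsF g hS F m).isFormalAdjoint hS fun _ h => h.1).1 w hw

theorem comp_deltasF (hS : ScSetup x h) (F : ℝ) {m : ℕ} {w : TField n M (m + 1)}
    (hw : w ∈ SymSections x (m + 1)) (C : FrameChart n x h) {z : Eu n} (hz : z ∈ C.pos) :
    C.comp (deltasF x g.inner h F m w) z =
      (C.adjOp (C.dOp g.inner F m)).app C.ϖ (C.comp w) z :=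
  (isLocalOp_dsF g hS F m).comp_formalAdjoint hS (fun _ h => h.1) hw C hz

/-- The operator `∇_F` is considered on symmetric tensors only, so its adjoint takes symmetric
values even on general tensors. -/
theorem nablaFStar_mem_symSections (hS : ScSetup x h) (F : ℝ) {m : ℕ} {w : TField n M (m + 1)}
    (hw : w ∈ TensorSections x (m + 1)) : nablaFStar x h F m w ∈ SymSections x m :=
  ((isLocalOp_nablaF hS F m).isFormalAdjoint hS fun _ h => h).1 w hw

theorem comp_nablaFStar (hS : ScSetup x h) (F : ℝ) {m : ℕ} {w : TField n M (m + 1)}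
    (hw : w ∈ TensorSections x (m + 1)) (C : FrameChart n x h) {z : Eu n} (hz : z ∈ C.pos) :
    C.comp (nablaFStar x h F m w) z = (C.adjOp (C.nabOp C.scConn F m)).app C.ϖ (C.comp w) z :=
  (isLocalOp_nablaF hS F m).comp_formalAdjoint hS (fun _ h => h) hw C hz

/-- The composition of local operators in the frame. -/
theorem FrameChart.app_app_eq (C : FrameChart n x h) (hS : ScSetup x h) {m k l : ℕ}
    {P : FOp n (Fin l → Fin n) (Fin k → Fin n)} {Q : FOp n (Fin k → Fin n) (Fin m → Fin n)}
    (hQ : Q.Smooth C.O) {f : Eu n → (Fin m → Fin n) → ℂ} {w : Eu n → (Fin k → Fin n) → ℂ}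
    (hf : SmoothArr C.pos f) (hw : ∀ z ∈ C.pos, w z = Q.app C.ϖ f z) {z : Eu n}
    (hz : z ∈ C.pos) : P.app C.ϖ w z = (P.comp C.ϖ Q).app C.ϖ f z := by
  have hO := C.isOpen_pos hS.smooth.continuous
  have h1 : P.app C.ϖ w z = P.app C.ϖ (Q.app C.ϖ f) z := by
    rw [FOp.app, FOp.app, hw z hz]
    congr 1
    exact Finset.sum_congr rfl fun i _ => by rw [ddV_congr hO hw hz]
  rw [h1]
  exact FOp.comp_app hO (fun i => (C.smooth_ϖ i).mono C.pos_subset)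
    ⟨fun i => (hQ.b i).mono C.pos_subset, hQ.c.mono C.pos_subset⟩ hf hz

theorem comp_deltasF_dsF (hS : ScSetup x h) (F : ℝ) {m : ℕ} {u : TField n M m}
    (hu : u ∈ SymSections x m) (C : FrameChart n x h) {z : Eu n} (hz : z ∈ C.pos) :
    C.comp (deltasF x g.inner h F m (dsF x g.inner F m u)) z =
      ((C.adjOp (C.dOp g.inner F m)).comp C.ϖ (C.dOp g.inner F m)).app C.ϖ (C.comp u) z := by
  rw [comp_deltasF g hS F (dsF_mem_symSections g hS F hu) C hz]
  exact C.app_app_eq hS (C.smooth_dOp g F m) (C.smoothArr_comp hu.1)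
    (fun y hy => (isLocalOp_dsF g hS F m).comp u hu C y hy) hz

theorem comp_nablaFStar_nablaF (hS : ScSetup x h) (F : ℝ) {m : ℕ} {u : TField n M m}
    (hu : u ∈ SymSections x m) (C : FrameChart n x h) {z : Eu n} (hz : z ∈ C.pos) :
    C.comp (nablaFStar x h F m (nablaF x h F m u)) z =
      ((C.adjOp (C.nabOp C.scConn F m)).comp C.ϖ (C.nabOp C.scConn F m)).app C.ϖ (C.comp u) z := by
  rw [comp_nablaFStar hS F ((isLocalOp_nablaF hS F m).mem_tensorSections hS hu) C hz]
  exact C.app_app_eq hS ((isLocalOp_nablaF hS F m).smooth C) (C.smoothArr_comp hu.1)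
    (fun y hy => (isLocalOp_nablaF hS F m).comp u hu C y hy) hz

theorem comp_dsF_deltasF (hS : ScSetup x h) (F : ℝ) {m : ℕ} {w : TField n M (m + 1)}
    (hw : w ∈ SymSections x (m + 1)) (C : FrameChart n x h) {z : Eu n} (hz : z ∈ C.pos) :
    C.comp (dsF x g.inner F m (deltasF x g.inner h F m w)) z =
      ((C.dOp g.inner F m).comp C.ϖ (C.adjOp (C.dOp g.inner F m))).app C.ϖ (C.comp w) z := by
  rw [(isLocalOp_dsF g hS F m).comp _ (deltasF_mem_symSections g hS F hw) C z hz]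
  exact C.app_app_eq hS (C.smooth_adjOp hS.form (C.smooth_dOp g F m)) (C.smoothArr_comp hw.1)
    (fun y hy => comp_deltasF g hS F hw C hy) hz

end

end LocalForms

/-! ### Operators with smooth frame coefficients as scattering differential operators -/

section Representation

open Matrix

variable {n : ℕ} {M : Type*} [TopologicalSpace M] [ChartedSpace (Eu n) M]
  [IsManifold (J n) ∞ M] {x : M → ℝ} {h : BField n M}

/-- The coefficients of a second order operator given in a chart. -/
def opCoeffs {m k : ℕ} (A : SOp n (Fin k → Fin n) (Fin m → Fin n))
    (φ : OpenPartialHomeomorph M (Eu n)) : Coeffs n M m k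
  | 0, _, K, I, p => A.a0 (φ p) K I
  | 1, w, K, I, p => A.a1 (w 0) (φ p) K I
  | 2, w, K, I, p => A.a2 (w 0) (w 1) (φ p) K I
  | _ + 3, _, _, _, _ => 0

namespace FrameChart

variable (C : FrameChart n x h)

/-- The fields `Vᵢ` for which `x Vᵢ` is the frame. -/
def field (i : Fin n) : VField n M := fun p =>
  dSymm C.φ (C.φ p) (C.ν i (C.φ p) • stdVec i)

theorem field_symm (i : Fin n) {z : Eu n} (hz : z ∈ C.O) :
    C.field i (C.φ.symm z) = C.ν i z • dSymm C.φ z (stdVec i) := by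
  rw [field, C.φ.right_inv (C.subset hz)]
  exact map_smul _ _ _

theorem smul_field (i : Fin n) {z : Eu n} (hz : z ∈ C.O) :
    x (C.φ.symm z) • C.field i (C.φ.symm z) = dSymm C.φ z (C.ϖ i z • stdVec i) := by
  rw [C.field_symm i hz, ← C.x_mul_ν i z hz, map_smul, mul_smul]
  rfl

theorem contMDiffOn_comp_chart {F : Type*} [NormedAddCommGroup F] [NormedSpace ℝ F]
    {f : Eu n → F} (hf : ContDiffOn ℝ ∞ f C.O) :
    ContMDiffOn (J n) (modelWithCornersSelf ℝ F) ∞ (fun p => f (C.φ p)) C.U :=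
  (contMDiffOn_iff_contDiffOn.2 hf).comp
    ((contMDiffOn_of_mem_maximalAtlas C.mem).mono fun _ hp => hp.1) fun _ hp => hp.2

/-- At the boundary the normal field vanishes because `ν j = 0`, and the tangential ones stay
independent. The normal coefficient of a linear relation is killed by the scalar component, where `b
j ≠ 0` and the other `b i` are zero. -/
theorem isScFrame (hS : ScSetup x h) :
    IsScFrame x C.U C.field fun i p => C.b i (C.φ p) where
  smooth i := by
    have h1 := contMDiffOn_dSymm C.mem C.subset ((C.smooth_ν i).smul
      (contDiffOn_const (c := stdVec i)))
    refine (h1.comp ((contMDiffOn_of_mem_maximalAtlas C.mem).mono fun _ hp => hp.1)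
      (fun _ hp => hp.2 : C.U ⊆ C.φ ⁻¹' C.O)).congr fun p hp => ?_
    have h2 := C.φ.left_inv hp.1
    simp only [Function.comp_apply, field]
    rw [h2]
    rfl
  smooth_b i := C.contMDiffOn_comp_chart (C.smooth_b i)
  tangent i p hp := by
    obtain ⟨z, hz, rfl⟩ : ∃ z ∈ C.O, C.φ.symm z = p := ⟨C.φ p, hp.2, C.φ.left_inv hp.1⟩
    rw [C.φ.right_inv (C.subset hz), C.field_symm i hz]
    have h1 := C.ν_mul i z hz
    rw [fderiv_fPull hS.smooth C.mem (C.subset hz)] at h1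
    rw [← h1]
    exact map_smul _ _ _
  indep p hp := by
    obtain ⟨z, hz, rfl⟩ : ∃ z ∈ C.O, C.φ.symm z = p := ⟨C.φ p, hp.2, C.φ.left_inv hp.1⟩
    rw [Fintype.linearIndependent_iff]
    intro c hc
    have h1 : ∑ i, c i * C.b i z = 0 := by
      have := congrArg Prod.fst hc
      rw [C.φ.right_inv (C.subset hz)] at this
      simpa [Prod.fst_sum] using this
    have h2 : ∀ i, c i * C.ν i z = 0 := by
      have h3 : ∑ i, c i • (C.ν i z • dSymm C.φ z (stdVec i)) = (0 : Eu n) := by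
        have := congrArg Prod.snd hc
        simp only [Prod.snd_sum, Prod.snd_zero, Prod.smul_snd] at this
        refine Eq.trans (Finset.sum_congr rfl fun i _ => ?_) this
        rw [C.field_symm i hz]
        rfl
      have h4 : dSymm C.φ z (∑ i, (c i * C.ν i z) • stdVec i) = 0 := by
        rw [map_sum, ← h3]
        exact Finset.sum_congr rfl fun i _ => by rw [map_smul, mul_smul]
      have h5 : ∑ i, (c i * C.ν i z) • (stdVec i : Eu n) = 0 := by
        by_contra hne
        exact dSymm_ne_zero C.mem (C.subset hz) hne h4
      intro i
      have := congrArg (fun v : Eu n => v i) h5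
      simpa [stdVec, Pi.single_apply] using this
    by_cases h0 : fPull x C.φ z = 0
    · obtain ⟨j, hj, -, -, hbj, -⟩ := C.bdry z hz h0
      have h3 : ∀ i, i ≠ j → c i = 0 := fun i hi =>
        (mul_eq_zero.1 (h2 i)).resolve_right (hj i hi).1
      intro i
      by_cases hi : i = j
      · subst hi
        rw [Finset.sum_eq_single i (fun k _ hk => by rw [h3 k hk, zero_mul]) (by simp)] at h1
        exact (mul_eq_zero.1 h1).resolve_right hbj
      · exact h3 i hi
    · intro i
      refine (mul_eq_zero.1 (h2 i)).resolve_right fun hν => C.ϖ_ne_zero i z hz h0 ?_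
      rw [← C.x_mul_ν i z hz, hν, mul_zero]

theorem scComp_eq {m : ℕ} (u : TField n M m) (I : Fin m → Fin n) {z : Eu n} (hz : z ∈ C.O) :
    scComp x C.field u I (C.φ.symm z) = C.comp u z I := by
  rw [comp_apply, scComp]
  congr 1
  funext s
  exact C.smul_field (I s) hz

/-- The function on the manifold need only agree with its chart expression where `x > 0`. This lets
the lemma be applied to its own output, which gives the words of length two. -/
theorem scDeriv_eq (hx : Continuous x) {f : M → ℂ} {f' : Eu n → ℂ} (hf' : ContDiffOn ℝ ∞ f' C.pos)
    (hf : ∀ z ∈ C.pos, f (C.φ.symm z) = f' z) (i : Fin n) {z : Eu n} (hz : z ∈ C.pos) :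
    scDeriv x (C.field i) f (C.φ.symm z) = dd C.ϖ i f' z := by
  have hO := C.isOpen_pos hx
  have hzt := C.subset hz.1
  have hps := C.φ.map_target hzt
  have h1 : f =ᶠ[nhds (C.φ.symm z)] f' ∘ C.φ := by
    have h2 := (C.φ.continuousAt hps).preimage_mem_nhds
      (by rw [C.φ.right_inv hzt]; exact hO.mem_nhds hz : C.pos ∈ nhds (C.φ (C.φ.symm z)))
    filter_upwards [h2, C.φ.open_source.mem_nhds hps] with q hq hqs
    rw [Function.comp_apply, ← hf _ hq, C.φ.left_inv hqs]
  have h2 : MDifferentiableAt (J n) (modelWithCornersSelf ℝ ℂ) f' (C.φ (C.φ.symm z)) := by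
    rw [C.φ.right_inv hzt]
    exact (differentiableAt_of_contDiffOn hO hf' hz).mdifferentiableAt
  have h3 := mfderiv_comp (C.φ.symm z) h2 (mdifferentiableAt_map C.mem hps)
  rw [mfderiv_eq_fderiv, C.φ.right_inv hzt] at h3
  have h4 : dMap C.φ (C.φ.symm z) (dSymm C.φ z (C.ϖ i z • stdVec i)) = C.ϖ i z • stdVec i :=
    congrArg (fun L : Eu n →L[ℝ] Eu n => L (C.ϖ i z • stdVec i)) (dMap_comp_dSymm C.mem hzt)
  rw [scDeriv, C.smul_field i hz.1, h1.mfderiv_eq, dd]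
  refine (congrArg (fun L : Eu n →L[ℝ] ℂ => L (dSymm C.φ z (C.ϖ i z • stdVec i))) h3).trans ?_
  change fderiv ℝ f' z (dMap C.φ (C.φ.symm z) (dSymm C.φ z (C.ϖ i z • stdVec i))) = _
  rw [h4, map_smul]

theorem sum_fin_one (f : (Fin 1 → Fin n) → ℂ) : ∑ w, f w = ∑ i, f fun _ => i :=
  Fintype.sum_equiv (Equiv.funUnique (Fin 1) (Fin n)) _ _ fun w => by
    congr 1
    funext s
    rw [Subsingleton.elim s default]
    rfl

theorem sum_fin_two (f : (Fin 2 → Fin n) → ℂ) : ∑ w, f w = ∑ i, ∑ j, f ![i, j] := by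
  rw [← Fintype.sum_prod_type']
  exact Fintype.sum_equiv (finTwoArrowEquiv (Fin n)) _ _ fun w => by
    congr 1
    funext s
    fin_cases s <;> rfl

theorem opCoeffs_sum (hx : Continuous x) {m k : ℕ}
    (A : SOp n (Fin k → Fin n) (Fin m → Fin n)) {u : TField n M m} (hu : u ∈ TensorSections x m)
    {z : Eu n} (hz : z ∈ C.pos) (K : Fin k → Fin n) :
    A.app C.ϖ (C.comp u) z K = ∑ r ∈ Finset.range 3, ∑ w : Fin r → Fin n, ∑ I : Fin m → Fin n,
      opCoeffs A C.φ r w K I (C.φ.symm z) *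
        wordDeriv x C.field (List.ofFn w) (scComp x C.field u I) (C.φ.symm z) := by
  have hO := C.isOpen_pos hx
  have hcu := C.smoothArr_comp hu
  have hzt := C.φ.right_inv (C.subset hz.1)
  have hϖ := fun i => (C.smooth_ϖ i).mono C.pos_subset
  have h1 : ∀ I i, ∀ y ∈ C.pos, scDeriv x (C.field i) (scComp x C.field u I) (C.φ.symm y) =
      ddV C.ϖ i (C.comp u) y I := fun I i y hy =>
    C.scDeriv_eq hx (hcu I) (fun y hy => C.scComp_eq u I hy.1) i hy
  have h2 : ∀ I i j, scDeriv x (C.field i) (scDeriv x (C.field j) (scComp x C.field u I))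
      (C.φ.symm z) = ddV C.ϖ i (ddV C.ϖ j (C.comp u)) z I := fun I i j =>
    C.scDeriv_eq hx (hcu.ddV hO hϖ j I) (fun y hy => h1 I j y hy) i hz
  simp only [Finset.sum_range_succ, Finset.range_zero, Finset.sum_empty, zero_add, sum_fin_one,
    sum_fin_two, opCoeffs, wordDeriv, List.ofFn_succ, List.ofFn_zero, List.foldr_cons,
    List.foldr_nil, Matrix.cons_val_zero, Matrix.cons_val_one, hzt]
  simp only [SOp.app, Pi.add_apply, Finset.sum_apply, Matrix.mulVec, dotProduct, ← h2,
    ← h1 _ _ z hz, ← C.scComp_eq u _ hz.1]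
  simp only [Fin.succ_zero_eq_one, Matrix.cons_val_one, Matrix.cons_val_fin_one,
    Finset.univ_unique, Finset.sum_singleton]
  ring

theorem smooth_opCoeffs {m k : ℕ} {A : SOp n (Fin k → Fin n) (Fin m → Fin n)} (hA : A.Smooth C.O)
    (r : ℕ) (w : Fin r → Fin n) (K : Fin k → Fin n) (I : Fin m → Fin n) :
    ContMDiffOn (J n) (modelWithCornersSelf ℝ ℂ) ∞ (opCoeffs A C.φ r w K I) C.U := by
  match r, w with
  | 0, _ => exact C.contMDiffOn_comp_chart (hA.a0 K I)
  | 1, w => exact C.contMDiffOn_comp_chart (hA.a1 (w 0) K I)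
  | 2, w => exact C.contMDiffOn_comp_chart (hA.a2 (w 0) (w 1) K I)
  | _ + 3, _ => exact contMDiffOn_const

/-- An operator given in the frame by coefficients smooth up to the boundary is a scattering
operator. -/
theorem represents (hS : ScSetup x h) {m k d : ℕ} (hd : d ≤ 2) {P : Op n M m k}
    {A : SOp n (Fin k → Fin n) (Fin m → Fin n)} (hA : A.Smooth C.O)
    (hAd : ∀ r w K I p, d < r → opCoeffs A C.φ r w K I p = 0)
    (hP : ∀ u ∈ SymSections x m, ∀ z ∈ C.pos, C.comp (P u) z = A.app C.ϖ (C.comp u) z) :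
    Represents x d C.U C.field (opCoeffs A C.φ) P where
  isOpen := C.isOpen_U
  frame := ⟨_, C.isScFrame hS⟩
  smooth := C.smooth_opCoeffs hA
  eq u hu p hp hxp K := by
    obtain ⟨z, hz, rfl⟩ : ∃ z ∈ C.pos, C.φ.symm z = p :=
      ⟨C.φ p, C.map_mem_pos hp hxp, C.φ.left_inv hp.1⟩
    rw [C.scComp_eq (P u) K hz.1, hP u hu z hz, C.opCoeffs_sum hS.smooth.continuous A hu.1 hz]
    symm
    refine Finset.sum_subset (Finset.range_mono (by omega)) fun r _ hr => ?_
    refine Finset.sum_eq_zero fun w _ => Finset.sum_eq_zero fun I _ => ?_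
    rw [hAd r w K I _ (by simpa using hr), zero_mul]

end FrameChart

theorem isScDiff_of_comp (hS : ScSetup x h) {m k d : ℕ} (hd : d ≤ 2) {P : Op n M m k}
    {A : FrameChart n x h → SOp n (Fin k → Fin n) (Fin m → Fin n)} (hA : ∀ C, (A C).Smooth C.O)
    (hAd : ∀ C r w K I p, d < r → opCoeffs (A C) C.φ r w K I p = 0)
    (hP : ∀ u ∈ SymSections x m, ∀ C, ∀ z ∈ C.pos, C.comp (P u) z = (A C).app C.ϖ (C.comp u) z)
    (hs : ∀ u ∈ SymSections x m, P u ∈ SymSections x k) : IsScDiff x d P := by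
  refine ⟨hs, fun p hp => ?_⟩
  obtain ⟨C, hC⟩ := FrameChart.exists_mem_U hS hp
  exact ⟨C.U, hC, C.field, _, C.represents hS hd (hA C) (hAd C) fun u hu z hz => hP u hu C z hz⟩

end Representation

/-! ### Dependence on `F` of compositions of conjugated operators -/

section Twisting

open Matrix

variable {n : ℕ} {ι κ κ' μ : Type*} [Fintype ι] [Fintype κ] [Fintype κ'] [Fintype μ]
  {ϖ τ : Fin n → Eu n → ℝ} {O : Set (Eu n)}

theorem ddM_add {B C : Eu n → Matrix κ ι ℂ} (hO : IsOpen O) (hB : SmoothMat O B)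
    (hC : SmoothMat O C) {z : Eu n} (hz : z ∈ O) (i : Fin n) :
    ddM ϖ i (fun y => B y + C y) z = ddM ϖ i B z + ddM ϖ i C z := by
  ext K I
  exact dd_add (hB.differentiableAt hO hz K I) (hC.differentiableAt hO hz K I) i

theorem ddM_const_smul {B : Eu n → Matrix κ ι ℂ} (hO : IsOpen O) (hB : SmoothMat O B)
    (r : ℂ) {z : Eu n} (hz : z ∈ O) (i : Fin n) :
    ddM ϖ i (fun y => r • B y) z = r • ddM ϖ i B z := by
  ext K I
  refine (dd_mul (differentiableAt_const r) (hB.differentiableAt hO hz K I) i).trans ?_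
  simp [dd, ddM]

namespace SOp

/-- The difference of two operators. -/
def sub (P Q : SOp n κ ι) : SOp n κ ι where
  a2 i j z := P.a2 i j z - Q.a2 i j z
  a1 j z := P.a1 j z - Q.a1 j z
  a0 z := P.a0 z - Q.a0 z

/-- A multiple of an operator. -/
def smul (r : ℂ) (P : SOp n κ ι) : SOp n κ ι where
  a2 i j z := r • P.a2 i j z
  a1 j z := r • P.a1 j z
  a0 z := r • P.a0 z

/-- Composition of a constant matrix with an operator. -/
def rmul (P : SOp n μ κ) (S : Matrix κ ι ℂ) : SOp n μ ι where
  a2 i j z := P.a2 i j z * S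
  a1 j z := P.a1 j z * S
  a0 z := P.a0 z * S

theorem Smooth.sub {P Q : SOp n κ ι} (hP : P.Smooth O) (hQ : Q.Smooth O) : (P.sub Q).Smooth O :=
  ⟨fun i j => (hP.a2 i j).sub (hQ.a2 i j), fun i => (hP.a1 i).sub (hQ.a1 i), hP.a0.sub hQ.a0⟩

theorem Smooth.smul {P : SOp n κ ι} (r : ℂ) (hP : P.Smooth O) : (P.smul r).Smooth O :=
  ⟨fun i j => (hP.a2 i j).smul contDiffOn_const, fun i => (hP.a1 i).smul contDiffOn_const,
    hP.a0.smul contDiffOn_const⟩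

theorem Smooth.rmul {P : SOp n μ κ} (S : Matrix κ ι ℂ) (hP : P.Smooth O) : (P.rmul S).Smooth O :=
  ⟨fun i j => (hP.a2 i j).mul (.const S), fun i => (hP.a1 i).mul (.const S), hP.a0.mul (.const S)⟩

theorem sub_app (P Q : SOp n κ ι) (f : Eu n → ι → ℂ) (z : Eu n) :
    (P.sub Q).app ϖ f z = P.app ϖ f z - Q.app ϖ f z := by
  simp only [app, sub, Matrix.sub_mulVec, Finset.sum_sub_distrib]
  abel

theorem smul_app (r : ℂ) (P : SOp n κ ι) (f : Eu n → ι → ℂ) (z : Eu n) :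
    (P.smul r).app ϖ f z = r • P.app ϖ f z := by
  simp only [app, smul, Matrix.smul_mulVec, Finset.smul_sum, smul_add]

theorem ddV_const_mulVec (hO : IsOpen O) (S : Matrix κ ι ℂ) {f : Eu n → ι → ℂ}
    (hf : SmoothArr O f) {z : Eu n} (hz : z ∈ O) (i : Fin n) :
    ddV ϖ i (fun y => S *ᵥ f y) z = S *ᵥ ddV ϖ i f z := by
  rw [ddV_mulVec hO (.const S) hf hz]
  have h1 : ddM ϖ i (fun _ => S) z = 0 := by
    ext K I
    simp [ddM, dd]
  rw [h1, Matrix.zero_mulVec, zero_add]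

theorem rmul_app (hO : IsOpen O) (hϖ : ∀ i, ContDiffOn ℝ ∞ (ϖ i) O) (P : SOp n μ κ)
    (S : Matrix κ ι ℂ) {f : Eu n → ι → ℂ} (hf : SmoothArr O f) {z : Eu n} (hz : z ∈ O) :
    (P.rmul S).app ϖ f z = P.app ϖ (fun y => S *ᵥ f y) z := by
  have h1 : ∀ j, ∀ y ∈ O, ddV ϖ j (fun y => S *ᵥ f y) y = S *ᵥ ddV ϖ j f y := fun j y hy =>
    ddV_const_mulVec hO S hf hy j
  have h2 : ∀ i j, ddV ϖ i (ddV ϖ j fun y => S *ᵥ f y) z = S *ᵥ ddV ϖ i (ddV ϖ j f) z :=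
    fun i j => by rw [ddV_congr hO (h1 j) hz, ddV_const_mulVec hO S (hf.ddV hO hϖ j) hz]
  simp only [app, rmul, h1 _ z hz, h2, Matrix.mulVec_mulVec]

theorem app_congr (hO : IsOpen O) (P : SOp n κ ι)
    {f g : Eu n → ι → ℂ} (h : ∀ z ∈ O, f z = g z) {z : Eu n} (hz : z ∈ O) :
    P.app ϖ f z = P.app ϖ g z := by
  have h1 : ∀ j, ∀ y ∈ O, ddV ϖ j f y = ddV ϖ j g y := fun j y hy => ddV_congr hO h hy j
  have h2 : ∀ i j, ddV ϖ i (ddV ϖ j f) z = ddV ϖ i (ddV ϖ j g) z :=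
    fun i j => ddV_congr hO (h1 j) hz i
  simp only [app, h1 _ z hz, h2, h z hz]

end SOp

/-- The conjugate `e^{-Fφ} P e^{Fφ}` of a first order operator, where `τ` are the derivatives of
`φ` along the frame. -/
def FOp.twist (τ : Fin n → Eu n → ℝ) (F : ℝ) (P : FOp n κ ι) : FOp n κ ι where
  b := P.b
  c z := P.c z + (F : ℂ) • ∑ i, (τ i z : ℂ) • P.b i z

theorem FOp.smoothMat_twist {P : FOp n κ ι} (hτ : ∀ i, ContDiffOn ℝ ∞ (τ i) O) (hP : P.Smooth O) :
    SmoothMat O fun z => ∑ i, (τ i z : ℂ) • P.b i z :=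
  SmoothMat.sum fun i _ => (hP.b i).smul (contDiffOn_ofReal (hτ i))

theorem FOp.Smooth.twist {P : FOp n κ ι} (hτ : ∀ i, ContDiffOn ℝ ∞ (τ i) O) (F : ℝ)
    (hP : P.Smooth O) : (P.twist τ F).Smooth O :=
  ⟨hP.b, hP.c.add ((FOp.smoothMat_twist hτ hP).smul contDiffOn_const)⟩

/-- The two factors are conjugated by inverse weights, as happens for an operator and its adjoint;
the linear terms therefore enter with opposite signs. -/
theorem FOp.twist_comp_a1 (Q : FOp n μ κ) (P : FOp n κ ι) (F : ℝ) (j : Fin n) (z : Eu n) :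
    ((Q.twist τ (-F)).comp ϖ (P.twist τ F)).a1 j z = (Q.comp ϖ P).a1 j z +
      (F : ℂ) • ∑ i, (τ i z : ℂ) • (Q.b j z * P.b i z - Q.b i z * P.b j z) := by
  simp only [FOp.comp, FOp.twist, Matrix.mul_add, Matrix.add_mul, Matrix.mul_smul,
    Matrix.smul_mul, Matrix.mul_sum, Matrix.sum_mul, smul_sub, Finset.sum_sub_distrib,
    Complex.ofReal_neg, neg_smul, Matrix.neg_mul]
  abel

/-- The first order variation in `F` of the composition of conjugated operators. -/
def FOp.twistVar (ϖ τ : Fin n → Eu n → ℝ) (Q : FOp n μ κ) (P : FOp n κ ι) (z : Eu n) :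
    Matrix μ ι ℂ :=
  ∑ i, Q.b i z * ddM ϖ i (fun y => ∑ k, (τ k y : ℂ) • P.b k y) z +
    (Q.c z * ∑ k, (τ k z : ℂ) • P.b k z - (∑ k, (τ k z : ℂ) • Q.b k z) * P.c z)

theorem FOp.twist_comp_a0 (hO : IsOpen O) (hτ : ∀ i, ContDiffOn ℝ ∞ (τ i) O) (Q : FOp n μ κ)
    {P : FOp n κ ι} (hP : P.Smooth O) (F : ℝ) {z : Eu n} (hz : z ∈ O) :
    ((Q.twist τ (-F)).comp ϖ (P.twist τ F)).a0 z = (Q.comp ϖ P).a0 z +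
      (F : ℂ) • FOp.twistVar ϖ τ Q P z -
      (F : ℂ) ^ 2 • ∑ i, ∑ k, ((τ i z : ℂ) * (τ k z : ℂ)) • (Q.b i z * P.b k z) := by
  have h1 : ∀ i, ddM ϖ i (P.twist τ F).c z = ddM ϖ i P.c z +
      (F : ℂ) • ddM ϖ i (fun y => ∑ k, (τ k y : ℂ) • P.b k y) z := fun i => by
    have hs := FOp.smoothMat_twist hτ hP
    rw [← ddM_const_smul hO hs _ hz]
    exact ddM_add hO hP.c (hs.smul contDiffOn_const) hz i
  have h2 : ∑ i, ∑ k, ((τ i z : ℂ) * (τ k z : ℂ)) • (Q.b i z * P.b k z) =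
      (∑ i, (τ i z : ℂ) • Q.b i z) * ∑ k, (τ k z : ℂ) • P.b k z := by
    rw [Matrix.sum_mul]
    refine Finset.sum_congr rfl fun i _ => ?_
    rw [Matrix.mul_sum]
    exact Finset.sum_congr rfl fun k _ => by rw [Matrix.smul_mul, Matrix.mul_smul, smul_smul]
  rw [h2]
  simp only [FOp.comp, h1, FOp.twistVar]
  simp only [FOp.twist, Complex.ofReal_neg, neg_smul, Matrix.mul_add, Matrix.add_mul,
    Matrix.mul_smul, Matrix.smul_mul, smul_add, smul_sub, Finset.sum_add_distrib, Matrix.neg_mul,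
    ← Finset.smul_sum]
  module

/-- The difference `(Q_F P_F - r Q'_F P'_F - s P''_F Q''_F) S` for conjugated operators, with `Q`,
`Q'` and `Q''` conjugated by the inverse weight. -/
def weitzenbock (ϖ τ : Fin n → Eu n → ℝ) (r s : ℂ) (S : Matrix ι ι ℂ) (P : FOp n κ ι)
    (Q : FOp n ι κ) (P' : FOp n κ ι) (Q' : FOp n ι κ) (P'' : FOp n ι κ') (Q'' : FOp n κ' ι)
    (F : ℝ) : SOp n ι ι :=
  ((((Q.twist τ (-F)).comp ϖ (P.twist τ F)).sub
    (((Q'.twist τ (-F)).comp ϖ (P'.twist τ F)).smul r)).sub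
    (((P''.twist τ F).comp ϖ (Q''.twist τ (-F))).smul s)).rmul S

variable {r s : ℂ} {S : Matrix ι ι ℂ} {P : FOp n κ ι} {Q : FOp n ι κ} {P' : FOp n κ ι}
  {Q' : FOp n ι κ} {P'' : FOp n ι κ'} {Q'' : FOp n κ' ι}

/-- The indices `i, j` are interchanged on the right of the hypothesis, because `P''` and `Q''` are
composed in the opposite order. Substituting it leaves `s (P''_j Q''_i - P''_i Q''_j) S`. The factor
`S` is needed since the relation holds on symmetric arrays only. -/
theorem weitzenbock_a2_antisymm {z : Eu n}
    (h : ∀ i j, Q.b i z * P.b j z * S - r • (Q'.b i z * P'.b j z * S) =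
      s • (P''.b j z * Q''.b i z * S)) (F : ℝ) (i j : Fin n) :
    (weitzenbock ϖ τ r s S P Q P' Q' P'' Q'' F).a2 i j z =
      - (weitzenbock ϖ τ r s S P Q P' Q' P'' Q'' F).a2 j i z := by
  simp only [weitzenbock, SOp.rmul, SOp.sub, SOp.smul, FOp.comp, FOp.twist, Matrix.sub_mul,
    Matrix.smul_mul, h]
  abel

/-- The term linear in `F` is a contraction with `τ` of antisymmetrized products of leading
coefficients. The composition in the opposite order contributes with the opposite sign, and the
second order relation makes the sum zero. -/
theorem weitzenbock_a1 {z : Eu n}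
    (h : ∀ i j, Q.b i z * P.b j z * S - r • (Q'.b i z * P'.b j z * S) =
      s • (P''.b j z * Q''.b i z * S)) (F : ℝ) (j : Fin n) :
    (weitzenbock ϖ τ r s S P Q P' Q' P'' Q'' F).a1 j z =
      (weitzenbock ϖ τ r s S P Q P' Q' P'' Q'' 0).a1 j z := by
  have h3 : ∀ F, ((P''.twist τ F).comp ϖ (Q''.twist τ (-F))).a1 j z = (P''.comp ϖ Q'').a1 j z +
      ((-F : ℝ) : ℂ) • ∑ i, (τ i z : ℂ) • (P''.b j z * Q''.b i z - P''.b i z * Q''.b j z) := by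
    intro F
    rw [← FOp.twist_comp_a1, neg_neg]
  have key : ∀ F, (weitzenbock ϖ τ r s S P Q P' Q' P'' Q'' F).a1 j z =
      ((Q.comp ϖ P).a1 j z - r • (Q'.comp ϖ P').a1 j z - s • (P''.comp ϖ Q'').a1 j z) * S := by
    intro F
    have h4 : (∑ i, (τ i z : ℂ) • (Q.b j z * P.b i z - Q.b i z * P.b j z)) * S -
        r • (∑ i, (τ i z : ℂ) • (Q'.b j z * P'.b i z - Q'.b i z * P'.b j z)) * S +
        s • (∑ i, (τ i z : ℂ) • (P''.b j z * Q''.b i z - P''.b i z * Q''.b j z)) * S = 0 := by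
      simp only [Finset.smul_sum, Matrix.sum_mul, ← Finset.sum_sub_distrib,
        ← Finset.sum_add_distrib]
      refine Finset.sum_eq_zero fun i _ => ?_
      have e1 := sub_eq_iff_eq_add.1 (h i j)
      have e2 := sub_eq_iff_eq_add.1 (h j i)
      simp only [Matrix.smul_mul, Matrix.sub_mul, e1, e2]
      module
    simp only [weitzenbock, SOp.rmul, SOp.sub, SOp.smul, FOp.twist_comp_a1, h3]
    simp only [Matrix.smul_mul] at h4
    simp only [Matrix.smul_mul, Matrix.sub_mul, Matrix.add_mul, Complex.ofReal_neg]
    linear_combination (norm := module) (F : ℂ) • h4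
  rw [key, key]

/-- The coefficient of `F²` contracts the leading coefficients with the symmetric product `τ_i τ_k`,
against which the interchange of indices in the second order relation is invisible; so it cancels.
What remains is affine in `F`, and is recovered from its values at `0` and `1`. -/
theorem weitzenbock_a0 (hO : IsOpen O) (hτ : ∀ i, ContDiffOn ℝ ∞ (τ i) O) (hP : P.Smooth O)
    (hP' : P'.Smooth O) (hQ'' : Q''.Smooth O) {z : Eu n} (hz : z ∈ O)
    (h : ∀ i j, Q.b i z * P.b j z * S - r • (Q'.b i z * P'.b j z * S) =
      s • (P''.b j z * Q''.b i z * S)) (F : ℝ) :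
    (weitzenbock ϖ τ r s S P Q P' Q' P'' Q'' F).a0 z =
      (weitzenbock ϖ τ r s S P Q P' Q' P'' Q'' 0).a0 z +
        (F : ℂ) • ((weitzenbock ϖ τ r s S P Q P' Q' P'' Q'' 1).a0 z -
          (weitzenbock ϖ τ r s S P Q P' Q' P'' Q'' 0).a0 z) := by
  have h3 : ∀ F : ℝ, ((P''.twist τ F).comp ϖ (Q''.twist τ (-F))).a0 z = (P''.comp ϖ Q'').a0 z +
      ((-F : ℝ) : ℂ) • FOp.twistVar ϖ τ P'' Q'' z - ((-F : ℝ) : ℂ) ^ 2 •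
        ∑ i, ∑ k, ((τ i z : ℂ) * (τ k z : ℂ)) • (P''.b i z * Q''.b k z) := by
    intro F
    rw [← FOp.twist_comp_a0 hO hτ P'' hQ'' (-F) hz, neg_neg]
  have h4 : (∑ i, ∑ k, ((τ i z : ℂ) * (τ k z : ℂ)) • (Q.b i z * P.b k z)) * S -
      r • (∑ i, ∑ k, ((τ i z : ℂ) * (τ k z : ℂ)) • (Q'.b i z * P'.b k z)) * S -
      s • (∑ i, ∑ k, ((τ i z : ℂ) * (τ k z : ℂ)) • (P''.b i z * Q''.b k z)) * S = 0 := by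
    rw [Finset.sum_comm (f := fun i k => ((τ i z : ℂ) * (τ k z : ℂ)) • (P''.b i z * Q''.b k z))]
    simp only [Finset.smul_sum, Matrix.sum_mul, ← Finset.sum_sub_distrib]
    refine Finset.sum_eq_zero fun i _ => Finset.sum_eq_zero fun k _ => ?_
    have e1 := sub_eq_iff_eq_add.1 (h i k)
    simp only [Matrix.smul_mul, e1, mul_comm (τ k z : ℂ)]
    module
  have key : ∀ F : ℝ, (weitzenbock ϖ τ r s S P Q P' Q' P'' Q'' F).a0 z =
      ((Q.comp ϖ P).a0 z - r • (Q'.comp ϖ P').a0 z - s • (P''.comp ϖ Q'').a0 z) * S +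
      (F : ℂ) • ((FOp.twistVar ϖ τ Q P z - r • FOp.twistVar ϖ τ Q' P' z +
        s • FOp.twistVar ϖ τ P'' Q'' z) * S) := by
    intro F
    simp only [weitzenbock, SOp.rmul, SOp.sub, SOp.smul, FOp.twist_comp_a0 hO hτ _ hP _ hz,
      FOp.twist_comp_a0 hO hτ _ hP' _ hz, h3]
    simp only [Matrix.smul_mul] at h4
    simp only [Matrix.smul_mul, Matrix.sub_mul, Matrix.add_mul, Complex.ofReal_neg]
    linear_combination (norm := module) -(F : ℂ) ^ 2 • h4
  rw [key F, key 0, key 1]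
  simp only [Complex.ofReal_zero, Complex.ofReal_one]
  module

theorem weitzenbock_smooth (hO : IsOpen O) (hϖ : ∀ i, ContDiffOn ℝ ∞ (ϖ i) O)
    (hτ : ∀ i, ContDiffOn ℝ ∞ (τ i) O) (hP : P.Smooth O) (hQ : Q.Smooth O) (hP' : P'.Smooth O)
    (hQ' : Q'.Smooth O) (hP'' : P''.Smooth O) (hQ'' : Q''.Smooth O) (F : ℝ) :
    (weitzenbock ϖ τ r s S P Q P' Q' P'' Q'' F).Smooth O :=
  ((((hQ.twist hτ _).comp hO hϖ (hP.twist hτ _)).sub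
    (((hQ'.twist hτ _).comp hO hϖ (hP'.twist hτ _)).smul r)).sub
    (((hP''.twist hτ _).comp hO hϖ (hQ''.twist hτ _)).smul s)).rmul S

end Twisting

/-! ### The Weitzenböck formula on symmetric tensors -/

section Weitzenbock

open Matrix

variable {n : ℕ} {M : Type*} [TopologicalSpace M] [ChartedSpace (Eu n) M]
  [IsManifold (J n) ∞ M] {x : M → ℝ} {h : BField n M}

theorem symM_mul_contrM_mul_symM {m : ℕ} (A : Matrix (Fin n) (Fin n) ℂ) (i : Fin n) :
    symM n m * (contrM m A i * symM n (m + 1)) = contrM m A i * symM n (m + 1) := by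
  refine Matrix.ext_of_mulVec_single fun I => ?_
  simp only [← Matrix.mulVec_mulVec]
  exact symM_mulVec_of_isSymArr (isSymArr_contrM_mulVec A i (isSymArr_symM_mulVec _))

namespace FrameChart

variable (C : FrameChart n x h)

theorem nabOp_eq_twist (γ : Fin n → Fin n → Fin n → Eu n → ℝ) (F : ℝ) (m : ℕ) :
    C.nabOp γ F m = (C.nabOp γ 0 m).twist C.τ F := by
  have h1 : (C.nabOp γ F m).c = ((C.nabOp γ 0 m).twist C.τ F).c := by
    funext z
    refine Matrix.ext_of_mulVec_single fun I => ?_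
    ext K
    simp only [nabOp, FOp.twist, Matrix.add_mulVec, Matrix.smul_mulVec, Matrix.sum_mulVec,
      Pi.add_apply, Pi.smul_apply]
    have h2 := sum_tensM_mulVec (fun i => (C.τ i z : ℂ) • (Pi.single I 1 : (Fin m → Fin n) → ℂ)) K
    simp only [Matrix.mulVec_smul] at h2
    rw [h2, connM_mulVec, connM_mulVec]
    simp only [Complex.ofReal_mul, Complex.ofReal_zero, zero_mul, Pi.smul_apply, smul_eq_mul]
    ring
  calc C.nabOp γ F m = ⟨(C.nabOp γ F m).b, (C.nabOp γ F m).c⟩ := rfl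
    _ = ⟨(C.nabOp γ F m).b, ((C.nabOp γ 0 m).twist C.τ F).c⟩ := by rw [h1]
    _ = _ := rfl

theorem dOp_eq_twist (g : BField n M) (F : ℝ) (m : ℕ) :
    C.dOp g F m = (C.dOp g 0 m).twist C.τ F := by
  rw [dOp, nabOp_eq_twist, dOp]
  simp only [FOp.lmul, FOp.twist, Matrix.mul_add, Matrix.mul_smul, Matrix.mul_sum]

/-- Multiplication by the real weight is self-adjoint, so the adjoint of `e^{-F/x} P e^{F/x}` is
`e^{F/x} P* e^{-F/x}`. -/
theorem adjOp_twist {m k : ℕ} (P : FOp n (Fin k → Fin n) (Fin m → Fin n)) (F : ℝ) :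
    C.adjOp (P.twist C.τ F) = (C.adjOp P).twist C.τ (-F) := by
  have h1 : ∀ z, (∑ i, (C.τ i z : ℂ) • P.b i z)ᴴ = ∑ i, (C.τ i z : ℂ) • (P.b i z)ᴴ := fun z => by
    simp [Matrix.conjTranspose_sum, Matrix.conjTranspose_smul]
  have h2 : ∀ z, ((F : ℂ) • ∑ i, (C.τ i z : ℂ) • P.b i z)ᴴ =
      (F : ℂ) • ∑ i, (C.τ i z : ℂ) • (P.b i z)ᴴ := fun z => by
    rw [Matrix.conjTranspose_smul, h1]
    simp
  simp only [adjOp, FOp.lmul, FOp.adj, FOp.twist, Matrix.conjTranspose_add, h2]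
  congr 1
  funext z
  simp only [Matrix.mul_add, Matrix.add_mul, Matrix.mul_sub, Matrix.mul_smul, Matrix.smul_mul,
    Matrix.mul_sum, Matrix.sum_mul, Matrix.mul_neg, smul_neg, Finset.sum_neg_distrib,
    Complex.ofReal_neg, neg_smul, neg_neg]
  abel

theorem adjOp_nabOp_b (γ : Fin n → Fin n → Fin n → Eu n → ℝ) (F : ℝ) (m : ℕ) (i : Fin n)
    {z : Eu n} (hz : z ∈ C.O) : (C.adjOp (C.nabOp γ F m)).b i z =
      -(symM n m * contrM m (cplx (C.gramH z)⁻¹) i) := by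
  simp only [adjOp, FOp.lmul, FOp.adj, nabOp]
  rw [tensM_conjTranspose_mul_kpow, ← Matrix.mul_assoc (kpow m _), C.kpow_mul_kpow_inv m hz,
    Matrix.one_mul, Matrix.mul_neg]

theorem adjOp_dOp_b (g : BField n M) (F : ℝ) (m : ℕ) (i : Fin n) {z : Eu n} (hz : z ∈ C.O) :
    (C.adjOp (C.dOp g F m)).b i z =
      -(contrM m (cplx (C.gramH z)⁻¹) i * symM n (m + 1)) := by
  have h1 : (symM n (m + 1) * tensM m i)ᴴ * kpow (m + 1) (cplx (C.gramH z)⁻¹) =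
      kpow m (cplx (C.gramH z)⁻¹) * (contrM m (cplx (C.gramH z)⁻¹) i * symM n (m + 1)) := by
    rw [Matrix.conjTranspose_mul, symM_conjTranspose, Matrix.mul_assoc, symM_mul_kpow,
      ← Matrix.mul_assoc, tensM_conjTranspose_mul_kpow, Matrix.mul_assoc]
  simp only [adjOp, FOp.lmul, FOp.adj, dOp, nabOp]
  rw [h1, ← Matrix.mul_assoc (kpow m _), C.kpow_mul_kpow_inv m hz, Matrix.one_mul, Matrix.mul_neg,
    symM_mul_contrM_mul_symM]

/-- The relation between the second order coefficients of `δˢdˢ`, `∇*∇` and `dˢδˢ`. -/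
theorem second_order_relation (g : BField n M) (m : ℕ) {z : Eu n} (hz : z ∈ C.O) (i j : Fin n) :
    (C.adjOp (C.dOp g 0 (m + 1))).b i z * (C.dOp g 0 (m + 1)).b j z * symM n (m + 1) -
      ((m + 2 : ℕ) : ℂ)⁻¹ • ((C.adjOp (C.nabOp C.scConn 0 (m + 1))).b i z *
        (C.nabOp C.scConn 0 (m + 1)).b j z * symM n (m + 1)) =
      (((m + 1 : ℕ) : ℂ) / ((m + 2 : ℕ) : ℂ)) • ((C.dOp g 0 m).b j z *
        (C.adjOp (C.dOp g 0 m)).b i z * symM n (m + 1)) := by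
  rw [C.adjOp_dOp_b _ _ _ _ hz, C.adjOp_dOp_b _ _ _ _ hz, C.adjOp_nabOp_b _ _ _ _ hz]
  simp only [dOp, FOp.lmul, nabOp]
  set A := cplx (C.gramH z)⁻¹
  have h1 : contrM (m + 1) A i * symM n (m + 2) * (symM n (m + 2) * tensM (m + 1) j) *
      symM n (m + 1) = contrM (m + 1) A i * symM n (m + 2) * tensM (m + 1) j * symM n (m + 1) := by
    rw [Matrix.mul_assoc (contrM _ _ _), ← Matrix.mul_assoc (symM n (m + 2)), symM_mul_symM,
      ← Matrix.mul_assoc]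
  have h2 : symM n (m + 1) * contrM (m + 1) A i * tensM (m + 1) j * symM n (m + 1) =
      A i j • symM n (m + 1) := by
    rw [Matrix.mul_assoc (symM n (m + 1)), contrM_mul_tensM, Matrix.mul_smul, Matrix.mul_one,
      Matrix.smul_mul, symM_mul_symM]
  have h3 : symM n (m + 1) * tensM m j * (contrM m A i * symM n (m + 1)) * symM n (m + 1) =
      symM n (m + 1) * tensM m j * contrM m A i * symM n (m + 1) := by
    rw [Matrix.mul_assoc _ _ (symM n (m + 1)), Matrix.mul_assoc (contrM m A i), symM_mul_symM,
      ← Matrix.mul_assoc]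
  -- The term `A i j` of the contraction formula is the contribution of `∇*∇`, and the other term
  -- that of `dˢδˢ`.
  simp only [Matrix.neg_mul, Matrix.mul_neg, h1, h2, h3, contrM_symM_tensM]
  module

/-- The difference of the two sides of the Weitzenböck formula, in the frame. -/
def weitz (g : BField n M) (m : ℕ) (F : ℝ) : SOp n (Fin (m + 1) → Fin n) (Fin (m + 1) → Fin n) :=
  weitzenbock C.ϖ C.τ ((m + 2 : ℕ) : ℂ)⁻¹ (((m + 1 : ℕ) : ℂ) / ((m + 2 : ℕ) : ℂ)) (symM n (m + 1))
    (C.dOp g 0 (m + 1)) (C.adjOp (C.dOp g 0 (m + 1))) (C.nabOp C.scConn 0 (m + 1))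
    (C.adjOp (C.nabOp C.scConn 0 (m + 1))) (C.dOp g 0 m) (C.adjOp (C.dOp g 0 m)) F

/-- The first order coefficients of `weitz`. -/
def weitzFirst (g : BField n M) (m : ℕ) (j : Fin n) (z : Eu n) :
    Matrix (Fin (m + 1) → Fin n) (Fin (m + 1) → Fin n) ℂ :=
  ∑ i, (C.θ i j z : ℂ) • (C.weitz g m 0).a2 i j z + (C.weitz g m 0).a1 j z

variable (g : Bundle.ContMDiffRiemannianMetric (J n) ∞ (Eu n) (fun p : M => TangentSpace (J n) p))

theorem smooth_weitz (hS : ScSetup x h) (m : ℕ) (F : ℝ) : (C.weitz g.inner m F).Smooth C.O :=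
  have h1 := fun m => C.smooth_dOp g 0 m
  have h2 := C.smooth_nabOp (C.isConn_scConn hS).smooth 0 (m + 1)
  weitzenbock_smooth C.isOpen C.smooth_ϖ C.smooth_τ (h1 _) (C.smooth_adjOp hS.form (h1 _)) h2
    (C.smooth_adjOp hS.form h2) (h1 _) (C.smooth_adjOp hS.form (h1 _)) F

theorem smooth_weitzFirst (hS : ScSetup x h) (m : ℕ) (j : Fin n) :
    SmoothMat C.O (C.weitzFirst g.inner m j) :=
  have h1 := C.smooth_weitz g hS m 0
  (SmoothMat.sum fun i _ => (h1.a2 i j).smul (contDiffOn_ofReal (C.smooth_θ i j))).add (h1.a1 j)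

/-- Commutators turn the antisymmetric second order part into the `θ` terms of `weitzFirst`. The
only dependence on `F` left is affine and of order zero, which is why `A₁` is a multiplication
operator. -/
theorem weitz_app (hS : ScSetup x h) (m : ℕ) (F : ℝ) {f : Eu n → (Fin (m + 1) → Fin n) → ℂ}
    (hf : SmoothArr C.pos f) {z : Eu n} (hz : z ∈ C.pos) :
    (C.weitz g.inner m F).app C.ϖ f z = ∑ j, C.weitzFirst g.inner m j z *ᵥ ddV C.ϖ j f z +
      ((C.weitz g.inner m 0).a0 z + (F : ℂ) •
        ((C.weitz g.inner m 1).a0 z - (C.weitz g.inner m 0).a0 z)) *ᵥ f z := by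
  have hrel := C.second_order_relation g.inner m hz.1
  rw [SOp.app_eq_of_antisymm (P := C.weitz g.inner m F) (C.isOpen_pos hS.smooth.continuous)
    (fun i => (C.smooth_ϖ i).mono C.pos_subset) (fun i k y hy => C.dd_ϖ i k y hy.1) hf hz
    (weitzenbock_a2_antisymm hrel F), FOp.app]
  have h1 : ∀ j, (C.weitz g.inner m F).a1 j z = (C.weitz g.inner m 0).a1 j z :=
    weitzenbock_a1 hrel F
  have h0 : (C.weitz g.inner m F).a0 z = (C.weitz g.inner m 0).a0 z + (F : ℂ) •
      ((C.weitz g.inner m 1).a0 z - (C.weitz g.inner m 0).a0 z) :=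
    weitzenbock_a0 C.isOpen C.smooth_τ (C.smooth_dOp g 0 _)
      (C.smooth_nabOp (C.isConn_scConn hS).smooth 0 (m + 1))
      (C.smooth_adjOp hS.form (C.smooth_dOp g 0 _)) hz.1 hrel F
  simp only [h1, h0]
  rfl

theorem comp_sub {m : ℕ} (u w : TField n M m) (z : Eu n) :
    C.comp (fun p => u p - w p) z = C.comp u z - C.comp w z := rfl

theorem comp_const_smul {m : ℕ} (r : ℝ) (u : TField n M m) (z : Eu n) :
    C.comp (fun p => r • u p) z = (r : ℂ) • C.comp u z := C.comp_smul_fun (fun _ => r) u z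

end FrameChart

/-- The difference of the two sides of the Weitzenböck formula. -/
def weitzOp (x : M → ℝ) (g h : BField n M) (m : ℕ) (F : ℝ) : Op n M (m + 1) (m + 1) := fun u p =>
  deltasF x g h F (m + 1) (dsF x g F (m + 1) u) p -
    ((m + 2 : ℕ) : ℝ)⁻¹ • nablaFStar x h F (m + 1) (nablaF x h F (m + 1) u) p -
    (((m + 1 : ℕ) : ℝ) / ((m + 2 : ℕ) : ℝ)) • dsF x g F m (deltasF x g h F m u) p

theorem sub_mem_symSections (hS : ScSetup x h) {m : ℕ} {u w : TField n M m}
    (hu : u ∈ SymSections x m) (hw : w ∈ SymSections x m) :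
    (fun p => u p - w p) ∈ SymSections x m :=
  FrameChart.mem_symSections_of_comp hS
    (fun C I => (C.smoothArr_comp hu.1 I).sub (C.smoothArr_comp hw.1 I)) fun C z hz ρ I => by
      rw [C.comp_sub u w, Pi.sub_apply, Pi.sub_apply, C.isSymArr_comp hu hz ρ I,
        C.isSymArr_comp hw hz ρ I]

theorem smul_mem_symSections (hS : ScSetup x h) {m : ℕ} (r : ℝ) {u : TField n M m}
    (hu : u ∈ SymSections x m) : (fun p => r • u p) ∈ SymSections x m :=
  FrameChart.mem_symSections_of_comp hS
    (fun C I => contDiffOn_const.smul (C.smoothArr_comp hu.1 I)) fun C z hz ρ I => by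
      rw [C.comp_const_smul r u, Pi.smul_apply, Pi.smul_apply, C.isSymArr_comp hu hz ρ I]

variable (g : Bundle.ContMDiffRiemannianMetric (J n) ∞ (Eu n) (fun p : M => TangentSpace (J n) p))

section

variable [T2Space M]

theorem weitzOp_mem_symSections (hS : ScSetup x h) (m : ℕ) (F : ℝ) {u : TField n M (m + 1)}
    (hu : u ∈ SymSections x (m + 1)) : weitzOp x g.inner h m F u ∈ SymSections x (m + 1) :=
  sub_mem_symSections hS (sub_mem_symSections hS
    (deltasF_mem_symSections g hS F (dsF_mem_symSections g hS F hu))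
    (smul_mem_symSections hS _ (nablaFStar_mem_symSections hS F
      ((isLocalOp_nablaF hS F _).mem_tensorSections hS hu))))
    (smul_mem_symSections hS _ (dsF_mem_symSections g hS F (deltasF_mem_symSections g hS F hu)))

theorem comp_weitzOp (hS : ScSetup x h) (m : ℕ) (F : ℝ) {u : TField n M (m + 1)}
    (hu : u ∈ SymSections x (m + 1)) (C : FrameChart n x h) {z : Eu n} (hz : z ∈ C.pos) :
    C.comp (weitzOp x g.inner h m F u) z = (C.weitz g.inner m F).app C.ϖ (C.comp u) z := by
  have hO := C.isOpen_pos hS.smooth.continuous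
  have hϖ := fun i => (C.smooth_ϖ i).mono C.pos_subset
  -- The projection at the end of `weitzenbock` acts as the identity on the components of a
  -- symmetric field.
  rw [FrameChart.weitz, weitzenbock, SOp.rmul_app hO hϖ _ _ (C.smoothArr_comp hu.1) hz,
    SOp.app_congr hO _ (fun y hy => symM_mulVec_of_isSymArr (C.isSymArr_comp hu hy)) hz,
    SOp.sub_app, SOp.sub_app, SOp.smul_app, SOp.smul_app, ← C.adjOp_twist, ← C.adjOp_twist,
    ← C.adjOp_twist, ← C.dOp_eq_twist, ← C.dOp_eq_twist, ← C.nabOp_eq_twist,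
    ← comp_deltasF_dsF g hS F hu C hz, ← comp_nablaFStar_nablaF hS F hu C hz,
    ← comp_dsF_deltasF g hS F hu C hz]
  have e1 := C.comp_const_smul (((m + 2 : ℕ) : ℝ)⁻¹)
    (nablaFStar x h F (m + 1) (nablaF x h F (m + 1) u)) z
  have e2 := C.comp_const_smul (((m + 1 : ℕ) : ℝ) / ((m + 2 : ℕ) : ℝ))
    (dsF x g.inner F m (deltasF x g.inner h F m u)) z
  simp only [Complex.ofReal_inv, Complex.ofReal_div, Complex.ofReal_natCast] at e1 e2
  rw [← e1, ← e2]
  rfl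

theorem isScDiff_weitzOp_zero (hS : ScSetup x h) (m : ℕ) :
    IsScDiff x 1 (weitzOp x g.inner h m 0) := by
  refine isScDiff_of_comp hS (A := fun C => ⟨fun _ _ _ => 0, C.weitzFirst g.inner m,
    (C.weitz g.inner m 0).a0⟩) one_le_two (fun C => ⟨fun _ _ => .const 0,
      C.smooth_weitzFirst g hS m, (C.smooth_weitz g hS m 0).a0⟩) ?_ ?_
    fun u hu => weitzOp_mem_symSections g hS m 0 hu
  · intro C r w K I p hr
    match r, w with
    | 2, _ => rfl
    | _ + 3, _ => rfl
  · intro u hu C z hz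
    rw [comp_weitzOp g hS m 0 hu C hz, C.weitz_app g hS m 0 (C.smoothArr_comp hu.1) hz]
    simp [SOp.app]

theorem isScDiff_weitzOp_sub (hS : ScSetup x h) (m : ℕ) :
    IsScDiff x 0 fun u p => weitzOp x g.inner h m 1 u p - weitzOp x g.inner h m 0 u p := by
  refine isScDiff_of_comp hS (A := fun C => ⟨fun _ _ _ => 0, fun _ _ => 0, fun z =>
    (C.weitz g.inner m 1).a0 z - (C.weitz g.inner m 0).a0 z⟩) zero_le_two
    (fun C => ⟨fun _ _ => .const 0, fun _ => .const 0, (C.smooth_weitz g hS m 1).a0.sub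
      (C.smooth_weitz g hS m 0).a0⟩) ?_ ?_ fun u hu => sub_mem_symSections hS
      (weitzOp_mem_symSections g hS m 1 hu) (weitzOp_mem_symSections g hS m 0 hu)
  · intro C r w K I p hr
    match r, w with
    | 1, _ => rfl
    | 2, _ => rfl
    | _ + 3, _ => rfl
  · intro u hu C z hz
    rw [C.comp_sub (weitzOp x g.inner h m 1 u), comp_weitzOp g hS m 0 hu C hz,
      comp_weitzOp g hS m 1 hu C hz, C.weitz_app g hS m 0 (C.smoothArr_comp hu.1) hz,
      C.weitz_app g hS m 1 (C.smoothArr_comp hu.1) hz]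
    simp [SOp.app, Matrix.sub_mulVec]

theorem weitzOp_eq (hS : ScSetup x h) (m : ℕ) (F : ℝ) {u : TField n M (m + 1)}
    (hu : u ∈ SymSections x (m + 1)) {p : M} (hp : 0 < x p) :
    weitzOp x g.inner h m F u p = weitzOp x g.inner h m 0 u p +
      F • (weitzOp x g.inner h m 1 u p - weitzOp x g.inner h m 0 u p) := by
  obtain ⟨C, hC⟩ := FrameChart.exists_mem_U hS hp.le
  refine (C.eq_iff_comp_eq (w := fun p => weitzOp x g.inner h m 0 u p +
    F • (weitzOp x g.inner h m 1 u p - weitzOp x g.inner h m 0 u p)) hC hp).2 ?_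
  have hz := C.map_mem_pos hC hp
  have e1 : C.comp (fun p => weitzOp x g.inner h m 0 u p +
      F • (weitzOp x g.inner h m 1 u p - weitzOp x g.inner h m 0 u p)) (C.φ p) =
      C.comp (weitzOp x g.inner h m 0 u) (C.φ p) + C.comp (fun p => F •
        (weitzOp x g.inner h m 1 u p - weitzOp x g.inner h m 0 u p)) (C.φ p) := rfl
  rw [e1, C.comp_const_smul F fun p => weitzOp x g.inner h m 1 u p - weitzOp x g.inner h m 0 u p,
    C.comp_sub (weitzOp x g.inner h m 1 u)]
  simp only [comp_weitzOp g hS m _ hu C hz, C.weitz_app g hS m _ (C.smoothArr_comp hu.1) hz]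
  simp only [Complex.ofReal_zero, Complex.ofReal_one, Matrix.add_mulVec, Matrix.smul_mulVec]
  module

end

end Weitzenbock

/-! ### Joint ellipticity of the solenoidal Witten Laplacian -/

section Ellipticity

open Matrix

variable {n : ℕ} {M : Type*} [TopologicalSpace M] [ChartedSpace (Eu n) M]
  [IsManifold (J n) ∞ M] {x : M → ℝ} {h : BField n M}

theorem symbolPart_two {m k : ℕ} (A : SOp n (Fin k → Fin n) (Fin m → Fin n))
    (φ : OpenPartialHomeomorph M (Eu n)) (p : M) (ζ : Fin n → ℝ) (v : (Fin m → Fin n) → ℂ) :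
    symbolPart (opCoeffs A φ) 2 p ζ v = (∑ i, ∑ j, ((Complex.I * (ζ i : ℂ)) *
      (Complex.I * (ζ j : ℂ))) • A.a2 i j (φ p)) *ᵥ v := by
  ext K
  simp only [symbolPart, FrameChart.sum_fin_two, opCoeffs, Fin.prod_univ_two, Matrix.mulVec,
    dotProduct, Matrix.sum_apply, Matrix.smul_apply, smul_eq_mul, Finset.sum_mul,
    Matrix.cons_val_zero, Matrix.cons_val_one]
  symm
  rw [Finset.sum_comm]
  refine Finset.sum_congr rfl fun i _ => ?_
  rw [Finset.sum_comm]
  exact Finset.sum_congr rfl fun j _ => Finset.sum_congr rfl fun I _ => by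
    rw [mul_comm (_ * _) (A.a2 i j (φ p) K I)]

theorem symbolPart_one {m k : ℕ} (A : SOp n (Fin k → Fin n) (Fin m → Fin n))
    (φ : OpenPartialHomeomorph M (Eu n)) (p : M) (ζ : Fin n → ℝ) (v : (Fin m → Fin n) → ℂ) :
    symbolPart (opCoeffs A φ) 1 p ζ v =
      (∑ j, (Complex.I * (ζ j : ℂ)) • A.a1 j (φ p)) *ᵥ v := by
  ext K
  simp only [symbolPart, FrameChart.sum_fin_one, opCoeffs, Fin.prod_univ_one, Matrix.mulVec,
    dotProduct, Matrix.sum_apply, Matrix.smul_apply, smul_eq_mul, Finset.sum_mul]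
  symm
  rw [Finset.sum_comm]
  exact Finset.sum_congr rfl fun j _ => Finset.sum_congr rfl fun I _ => by
    rw [mul_comm (Complex.I * _) (A.a1 j (φ p) K I)]

theorem symbolPart_zero {m k : ℕ} (A : SOp n (Fin k → Fin n) (Fin m → Fin n))
    (φ : OpenPartialHomeomorph M (Eu n)) (p : M) (ζ : Fin n → ℝ) (v : (Fin m → Fin n) → ℂ) :
    symbolPart (opCoeffs A φ) 0 p ζ v = A.a0 (φ p) *ᵥ v := by
  ext K
  simp [symbolPart, opCoeffs, Matrix.mulVec, dotProduct]

/-- The kernel of `L* L` on symmetric arrays, for the adjoint with respect to fibre metrics. -/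
theorem mulVec_eq_zero_of_adjoint_mul {m k : ℕ} {G : Matrix (Fin n) (Fin n) ℝ} (hG : G.PosDef)
    (L : Matrix (Fin k → Fin n) (Fin m → Fin n) ℂ) {v : (Fin m → Fin n) → ℂ} (hv : IsSymArr v)
    (h0 : (symM n m * (kpow m (cplx G) * (Lᴴ * kpow k (cplx G⁻¹))) * L) *ᵥ v = 0) :
    L *ᵥ v = 0 := by
  have hdet : IsUnit G.det := isUnit_iff_ne_zero.2 hG.det_pos.ne'
  have h1 : kpow m (cplx G⁻¹) * kpow m (cplx G) = 1 := by
    rw [← kpow_mul, ← cplx_mul, Matrix.nonsing_inv_mul G hdet, cplx_one, kpow_one]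
  have h2 : kpow m (cplx G⁻¹) * (symM n m * (kpow m (cplx G) * (Lᴴ * kpow k (cplx G⁻¹))) * L) =
      symM n m * (Lᴴ * (kpow k (cplx G⁻¹) * L)) := by
    rw [← Matrix.mul_assoc, ← Matrix.mul_assoc, ← symM_mul_kpow, Matrix.mul_assoc (symM n m),
      ← Matrix.mul_assoc (kpow m (cplx G⁻¹)), h1, Matrix.one_mul]
    simp only [Matrix.mul_assoc]
  have h3 : (symM n m * (Lᴴ * (kpow k (cplx G⁻¹) * L))) *ᵥ v = 0 := by
    rw [← h2, ← Matrix.mulVec_mulVec, h0, Matrix.mulVec_zero]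
  -- By `h3` the pairing of `L v` with itself for the definite fibre metric is zero; the
  -- symmetrization is harmless because `v` is symmetric.
  refine eq_zero_of_kpow_form_eq_zero hG.inv _ ?_
  rw [mulVec_dotProduct_star, ← symM_mulVec_of_isSymArr hv, mulVec_dotProduct_star,
    symM_conjTranspose, symM_mulVec_of_isSymArr hv]
  simp only [← Matrix.mulVec_mulVec] at h3
  exact (congrArg (fun w => v ⬝ᵥ star w) h3).trans (by simp)

namespace FrameChart

variable (C : FrameChart n x h)

theorem dOp_symbol_mulVec (g : BField n M) (F : ℝ) (m : ℕ) (ζ : Fin n → ℝ) (z : Eu n)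
    (v : (Fin m → Fin n) → ℂ) :
    (∑ j, (Complex.I * (ζ j : ℂ)) • (C.dOp g F m).b j z) *ᵥ v =
      symM n (m + 1) *ᵥ fun K => Complex.I * (ζ (K 0) : ℂ) * v (Fin.tail K) := by
  simp only [dOp, FOp.lmul, nabOp, ← Matrix.mul_smul, ← Matrix.mul_sum, ← Matrix.mulVec_mulVec]
  congr 1
  ext K
  simp only [Matrix.sum_mulVec, Matrix.smul_mulVec, ← Matrix.mulVec_smul]
  exact sum_tensM_mulVec _ K

/-- The principal symbol is `L* L` with `L` the symmetric product with `iζ`. Its injectivity is the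
triangular case with `μ = 0` and any `j` for which `ζ j ≠ 0`. -/
theorem principal_injective (g : BField n M) (F : ℝ) (m : ℕ) {ζ : Fin n → ℝ} (hζ : ζ ≠ 0)
    (hS : ScSetup x h) {z : Eu n} (hz : z ∈ C.O) (hzx : 0 ≤ fPull x C.φ z)
    {v : (Fin m → Fin n) → ℂ} (hv : IsSymArr v)
    (h0 : (∑ i, ∑ j, ((Complex.I * (ζ i : ℂ)) * (Complex.I * (ζ j : ℂ))) •
      ((C.adjOp (C.dOp g F m)).comp C.ϖ (C.dOp g F m)).a2 i j z) *ᵥ v = 0) : v = 0 := by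
  set L := ∑ j, (Complex.I * (ζ j : ℂ)) • (C.dOp g F m).b j z with hL
  have h1 : L *ᵥ v = 0 := by
    refine mulVec_eq_zero_of_adjoint_mul (C.posDef_gramH hS hz hzx) L hv ?_
    rw [← h0]
    congr 1
    rw [hL, Matrix.conjTranspose_sum, Matrix.sum_mul, Matrix.mul_sum _ _ (kpow m _),
      Matrix.mul_sum _ _ (symM n m), Matrix.sum_mul]
    refine Finset.sum_congr rfl fun i _ => ?_
    rw [Matrix.mul_sum]
    refine Finset.sum_congr rfl fun j _ => ?_
    simp only [FOp.comp, adjOp, FOp.lmul, FOp.adj, Matrix.conjTranspose_smul, Matrix.smul_mul,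
      Matrix.mul_smul, Matrix.mul_neg, Matrix.neg_mul, star_mul', Complex.star_def, Complex.conj_I,
      Complex.conj_ofReal]
    module
  obtain ⟨j, hj⟩ := Function.ne_iff.1 hζ
  rw [hL, dOp_symbol_mulVec] at h1
  refine eq_zero_of_symM_mulVec_eq_zero j (fun i => Complex.I * (ζ i : ℂ))
    (mul_ne_zero Complex.I_ne_zero (Complex.ofReal_ne_zero.2 hj)) (fun _ _ _ => 0)
    (fun _ _ _ _ => rfl) v hv ?_
  simpa using h1

/-- Injectivity of the full symbol at the boundary. -/
theorem boundary_injective (g : BField n M) {F : ℝ} (hF : 0 < F) (m : ℕ) (ζ : Fin n → ℝ)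
    (hS : ScSetup x h) {z : Eu n} (hz : z ∈ C.O) (hzx : fPull x C.φ z = 0)
    {v : (Fin m → Fin n) → ℂ} (hv : IsSymArr v)
    (h0 : ((C.adjOp (C.dOp g F m)).comp C.ϖ (C.dOp g F m)).a0 z *ᵥ v +
      (∑ j, (Complex.I * (ζ j : ℂ)) •
        ((C.adjOp (C.dOp g F m)).comp C.ϖ (C.dOp g F m)).a1 j z) *ᵥ v +
      (∑ i, ∑ j, ((Complex.I * (ζ i : ℂ)) * (Complex.I * (ζ j : ℂ))) •
      ((C.adjOp (C.dOp g F m)).comp C.ϖ (C.dOp g F m)).a2 i j z) *ᵥ v = 0) : v = 0 := by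
  obtain ⟨j, -, -, hτ, -, hθ, hq⟩ := C.bdry z hz hzx
  -- At `x = 0` all frame fields vanish as vectors in the chart. Derivatives of coefficients and
  -- divergences thus drop out, and the full symbol is multiplicative under composition and
  -- adjoints.
  have hϖ : ∀ i, C.ϖ i z = 0 := fun i => by rw [← C.x_mul_ν i z hz, hzx, zero_mul]
  have hdM : ∀ {ι κ : Type} (i : Fin n) (B : Eu n → Matrix κ ι ℂ), ddM C.ϖ i B z = 0 := by
    intro ι κ i B
    ext K I
    simp [ddM, dd, hϖ]
  have hkap : ∀ i, C.kap i z = 0 := fun i => by simp [kap, dd, hϖ, hθ]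
  set P := C.dOp g F m with hP
  set L := ∑ j, (Complex.I * (ζ j : ℂ)) • P.b j z + P.c z with hL
  have h1 : L *ᵥ v = 0 := by
    refine mulVec_eq_zero_of_adjoint_mul (C.posDef_gramH hS hz hzx.ge) L hv ?_
    rw [← h0, ← Matrix.add_mulVec, ← Matrix.add_mulVec]
    congr 1
    -- Conjugation of `iζ` compensates the minus sign from integration by parts: the symbol of the
    -- adjoint is the adjoint of the symbol.
    have e1 : symM n m * (kpow m (cplx (C.gramH z)) * (Lᴴ * kpow (m + 1) (cplx (C.gramH z)⁻¹))) =
        ∑ i, (Complex.I * (ζ i : ℂ)) • (C.adjOp P).b i z + (C.adjOp P).c z := by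
      simp only [adjOp, FOp.lmul, FOp.adj, hdM, hkap, hL, Matrix.conjTranspose_add,
        Matrix.conjTranspose_sum, Matrix.conjTranspose_smul, Matrix.add_mul, Matrix.mul_add,
        Matrix.sum_mul, Matrix.mul_sum, Complex.ofReal_zero, zero_smul, add_zero,
        Finset.sum_const_zero, sub_zero, Matrix.smul_mul, Matrix.mul_smul, star_mul',
        Complex.star_def, Complex.conj_I, Complex.conj_ofReal, Matrix.mul_neg, smul_neg, neg_mul,
        neg_smul, Matrix.neg_mul]
    rw [e1, hL]
    simp only [FOp.comp, hdM, Matrix.mul_zero, Finset.sum_const_zero, zero_add, Matrix.mul_add,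
      Matrix.add_mul, Matrix.sum_mul, Matrix.mul_sum, Matrix.smul_mul, Matrix.mul_smul, smul_add,
      Finset.sum_add_distrib, smul_smul, Finset.smul_sum]
    have e2 : ∑ j, ∑ i, (Complex.I * (ζ j : ℂ) * (Complex.I * (ζ i : ℂ))) •
        ((C.adjOp P).b i z * P.b j z) = ∑ i, ∑ j, (Complex.I * (ζ i : ℂ) *
          (Complex.I * (ζ j : ℂ))) • ((C.adjOp P).b i z * P.b j z) := by
      rw [Finset.sum_comm]
      exact Finset.sum_congr rfl fun i _ => Finset.sum_congr rfl fun j _ => by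
        rw [mul_comm (Complex.I * (ζ j : ℂ))]
    rw [e2]
    abel
  -- This is the shape required by the triangularity lemma: diagonal part `iζ + Fτ`, off-diagonal
  -- part the connection coefficients of `g`.
  have h2 : L *ᵥ v = symM n (m + 1) *ᵥ fun K => (Complex.I * (ζ (K 0) : ℂ) +
      ((F * C.τ (K 0) z : ℝ) : ℂ)) * v (Fin.tail K) + ∑ q, ∑ l,
        (-(C.gConn g (K 0) (Fin.tail K q) l z) : ℂ) * v (Function.update (Fin.tail K) q l) := by
    rw [hL, Matrix.add_mulVec, hP, dOp_symbol_mulVec, dOp, FOp.lmul, nabOp,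
      ← Matrix.mulVec_mulVec, ← Matrix.mulVec_add]
    congr 1
    ext K
    rw [Pi.add_apply, connM_mulVec]
    simp only [neg_mul, Finset.sum_neg_distrib]
    ring
  rw [h2] at h1
  refine eq_zero_of_symM_mulVec_eq_zero j (fun i => Complex.I * (ζ i : ℂ) +
    ((F * C.τ i z : ℝ) : ℂ)) (fun hc => ?_) (fun i k l => (-(C.gConn g i k l z) : ℂ))
    (fun i k l hikl => ?_) v hv h1
  -- The real part of the diagonal entry is `F τ_j`, nonzero for `F > 0` whatever `ζ` is.
  · have := congrArg Complex.re hc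
    simp [hF.ne', hτ] at this
  · have : C.q i k l z = 0 := by
      by_contra hne
      exact hikl (hq i k l hne)
    simp [gConn, this, hθ]

end FrameChart

variable (g : Bundle.ContMDiffRiemannianMetric (J n) ∞ (Eu n) (fun p : M => TangentSpace (J n) p))

theorem isJointElliptic_wittenLaplacian [T2Space M] (hS : ScSetup x h) {F : ℝ} (hF : 0 < F) (m : ℕ) :
    IsJointElliptic x 2 (wittenLaplacian x g.inner h F m) := by
  set A : (C : FrameChart n x h) → SOp n (Fin m → Fin n) (Fin m → Fin n) := fun C =>
    (C.adjOp (C.dOp g.inner F m)).comp C.ϖ (C.dOp g.inner F m) with hAdef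
  have hA : ∀ C, (A C).Smooth C.O := fun C =>
    (C.smooth_adjOp hS.form (C.smooth_dOp g F m)).comp C.isOpen C.smooth_ϖ (C.smooth_dOp g F m)
  have hAd : ∀ (C : FrameChart n x h) r w K I p, 2 < r → opCoeffs (A C) C.φ r w K I p = 0 := by
    intro C r w K I p hr
    match r, w with
    | _ + 3, _ => rfl
  have hP : ∀ u ∈ SymSections x m, ∀ C : FrameChart n x h, ∀ z ∈ C.pos,
      C.comp (wittenLaplacian x g.inner h F m u) z = (A C).app C.ϖ (C.comp u) z :=
    fun u hu C z hz => comp_deltasF_dsF g hS F hu C hz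
  refine ⟨isScDiff_of_comp hS le_rfl hA hAd hP fun u hu =>
    deltasF_mem_symSections g hS F (dsF_mem_symSections g hS F hu), fun p hp => ?_⟩
  obtain ⟨C, hC⟩ := FrameChart.exists_mem_U hS hp
  have hx : fPull x C.φ (C.φ p) = x p := congrArg x (C.φ.left_inv hC.1)
  refine ⟨C.U, hC, C.field, _, C.represents hS le_rfl (hA C) (hAd C) fun u hu z hz =>
    hP u hu C z hz, fun ζ hζ v hv h0 => ?_, fun hp0 ζ v hv h0 => ?_⟩
  · rw [symbolPart_two] at h0
    exact C.principal_injective g.inner F m hζ hS hC.2 (hx.symm ▸ hp) hv h0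
  · simp only [Finset.sum_range_succ, Finset.range_zero, Finset.sum_empty, zero_add] at h0
    refine C.boundary_injective g.inner hF m ζ hS hC.2 (hx.trans hp0) hv ?_
    rw [← symbolPart_zero (A C) C.φ p ζ, ← symbolPart_one (A C) C.φ p, ← symbolPart_two (A C) C.φ p]
    funext K
    have := congrFun h0 K
    simpa only [Pi.add_apply, Pi.zero_apply] using this

theorem isXScDiff_zero (hS : ScSetup x h) {m k d : ℕ} :
    IsXScDiff x d (fun _ _ => 0 : Op n M m k) := by
  have hs : (fun _ => 0 : TField n M k) ∈ SymSections x k :=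
    FrameChart.mem_symSections_of_comp hS (fun _ _ => contDiffOn_const) fun _ _ _ _ _ => rfl
  refine ⟨fun _ _ => 0, ⟨fun _ _ => hs, fun p hp => ?_⟩, fun u _ p _ => (smul_zero_cov (x p)).symm⟩
  obtain ⟨C, hC⟩ := FrameChart.exists_mem_U hS hp
  refine ⟨C.U, hC, C.field, fun _ _ _ _ _ => 0, C.isOpen_U, ⟨_, C.isScFrame hS⟩,
    fun _ _ _ _ => contMDiffOn_const, fun u _ p _ _ K => ?_⟩
  simp only [zero_mul, Finset.sum_const_zero]
  rfl

end Ellipticity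

end Scat

end

theorem mainTheorem8 {n : ℕ} {M : Type*} [TopologicalSpace M] [T2Space M] [SigmaCompactSpace M]
    [ChartedSpace (Eu n) M] [IsManifold (J n) ∞ M]
    (g : Bundle.ContMDiffRiemannianMetric (J n) ∞ (Eu n) (fun p : M => TangentSpace (J n) p))
    (x : M → ℝ) (hx : ContMDiff (J n) (modelWithCornersSelf ℝ ℝ) ∞ x)
    (hdx : ∀ p, x p = 0 → dFun (n := n) x p ≠ 0)
    (h : BField n M) (hh : IsSmoothSymForm h) (hsc : IsScMetric x h) :
    (∃ F₀ : ℝ, 0 < F₀ ∧ ∀ F : ℝ, F₀ ≤ F →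
      IsJointElliptic x 2 (wittenLaplacian x g.inner h F 3)) ∧
    ∃ A₀ A₁ : Op n M 3 3, IsScDiff x 1 A₀ ∧ IsScDiff x 0 A₁ ∧
      ∀ F : ℝ, ∃ R : Op n M 3 3, IsXScDiff x 1 R ∧
        ∀ u ∈ SymSections x 3, ∀ p, 0 < x p →
          deltasF x g.inner h F 3 (dsF x g.inner F 3 u) p =
            (1 / 4 : ℝ) • nablaFStar x h F 3 (nablaF x h F 3 u) p +
            (3 / 4 : ℝ) • dsF x g.inner F 2 (deltasF x g.inner h F 2 u) p +
            (A₀ u p + F • A₁ u p) + R u p := by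
  have hS : ScSetup x h := ⟨hx, hdx, hh, hsc⟩
  -- Every `F > 0` gives joint ellipticity, so the threshold `1` is an arbitrary positive number.
  refine ⟨⟨1, one_pos, fun F hF =>
    isJointElliptic_wittenLaplacian g hS (one_pos.trans_le hF) 3⟩,
    -- With rank `3 = m + 1` the constants are `1/4` and `3/4`. The difference of the two sides is
    -- affine in `F`: `A₀` is its value at `F = 0`, `A₁` its increment from `0` to `1`, and the
    -- remainder is zero.
    weitzOp x g.inner h 2 0, fun u p => weitzOp x g.inner h 2 1 u p - weitzOp x g.inner h 2 0 u p,
    isScDiff_weitzOp_zero g hS 2, isScDiff_weitzOp_sub g hS 2, fun F => ⟨fun _ _ => 0,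
    isXScDiff_zero hS, fun u hu p hp => ?_⟩⟩
  have h1 := weitzOp_eq g hS 2 F hu hp
  have h2 : weitzOp x g.inner h 2 F u p = deltasF x g.inner h F 3 (dsF x g.inner F 3 u) p -
      (1 / 4 : ℝ) • nablaFStar x h F 3 (nablaF x h F 3 u) p -
      (3 / 4 : ℝ) • dsF x g.inner F 2 (deltasF x g.inner h F 2 u) p := by
    rw [weitzOp]
    norm_num
  rw [add_zero, ← h1, h2]
  abel
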